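/- **Setting.** Let $\mathcal C$ and $\mathcal X$ be standard Borel spaces (for example Borel subsets of Euclidean spaces). A prior $\pi(h)$ is the law of a random measurable function $h:\mathcal C^2\to\mathcal X$ (given by a random parameter and a jointly measurable evaluation), and a prior $\pi(\mathbb P_C)$ is a probability law on the set of probability measures on $\mathcal C$. In the model, $(h,\mathbb P_C)\sim\pi(h)\cdot\pi(\mathbb P_C)$, $C_1,\dots,C_n\mid h,\mathbb P_C\overset{iid}{\sim}\mathbb P_C$, and the data are $X_{k\ell}=h(C_k,C_\ell)$, $k\neq\ell$. The object of interest is $\mathbb P_{X_{ij}}$, the law of $h(C_i,C_j)$, $i\ne j$, given $h$ and $\mathbb P_C$. Its posterior is its conditional law given $\{X_{k\ell}\}_{k\ne\ell}$. The posterior *does not smooth across events* if for every finite measurable partition $\{B_1,\dots,B_R\}$ of $\mathcal X$ and a draw $\mathbb P^*$ from the posterior, the distribution of $(\mathbb P^*(B_1),\dots,\mathbb P^*(B_R))$ depends on the data, up to null sets of the law of the data, only through the indicators $\mathbb I\{X_{k\ell}\in B_r\}$, $k\ne\ell$, $r=1,\dots,R$. The law $\pi(\mathbb P_C)$ is the Dirichlet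 process $DP(Q,\alpha)$, with $Q$ a probability measure on $\mathcal C$ and $\alpha>0$, if $(\mathbb P_C(A_1),\dots,\mathbb P_C(A_R))\sim\mathrm{Dir}(\alpha Q(A_1),\dots,\alpha Q(A_R))$ for every finite measurable partition of $\mathcal C$. It is a *trivial process* if (i) $\mathbb P_C=\rho$ a.s. for a deterministic probability measure $\rho$, or (ii) $\mathbb P_C=\delta_Y$ with $Y\sim\rho$ for a probability measure $\rho$, or (iii) $\mathbb P_C=Z\delta_a+(1-Z)\delta_b$ with deterministic $a,b\in\mathcal C$ and a random variable $Z\in[0,1]$. **Theorem.** (1) Suppose that $X_{ij}=h(C_i,C_j)$ is defined only for $C_i\neq C_j$; that is, the data are observed with $C_1,\dots,C_n$ pairwise distinct (all laws are conditional on this event), and $\mathbb P_{X_{ij}}$ is the law of $h(C_i,C_j)$ given $C_i\ne C_j$. Let $n\ge2$, let $Q$ be a probability measure on $\mathcal C$, and let $\pi(h)$ be any prior on $h$. Then as $\alpha\downarrow0$ the posteriors under the priors $\pi(h)\cdot DP(Q,\alpha)$ have a limit $\pi_0(\mathbb P_{X_{ij}}\mid\{X_{k\ell}\}_{k\ne\ell})$,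 in the following sense: along every sequence $\alpha_m\downarrow0$ and for every finite measurable partition $\{B_1,\dots,B_R\}$ of $\mathcal X$, the posterior laws of $(\mathbb P_{X_{ij}}(B_1),\dots,\mathbb P_{X_{ij}}(B_R))$ converge weakly, for almost all data, to the law of that vector under $\pi_0$. The limiting posterior $\pi_0$ does not smooth across events. (2) Suppose that $X_{ij}=h(C_i,C_j)$ for all $i\ne j$, whether or not $C_i=C_j$, so that $\mathbb P_{X_{ij}}$ is the law of $h(C_i,C_j)$ for $C_i,C_j\overset{iid}{\sim}\mathbb P_C$. Suppose that there is an injective measurable map $\mathcal C\to\mathcal X$ (for example $\mathcal X=\mathcal C$). Then there is a prior $\pi(h)$ such that for every prior $\pi(\mathbb P_C)$: the posterior $\pi(\mathbb P_{X_{ij}}\mid\{X_{k\ell}\}_{k\neq\ell})$ does not smooth across events, for every sample size $n\ge2$, if and only if $\pi(\mathbb P_C)$ is a Dirichlet process $DP(Q,\alpha)$ for some $Q$ and some $\alpha>0$, or a trivial process. -/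

import Mathlib

open MeasureTheory ProbabilityTheory Set Filter Topology

universe u v w

noncomputable section

namespace Bilateral

/-- A prior `π(h)` on measurable link functions `h : 𝒞 × 𝒞 → 𝒳`: a random parameter together with
a jointly measurable evaluation map, so that `h` is a random measurable function. -/
structure LinkPrior (C : Type u) (X : Type v) [MeasurableSpace C] [MeasurableSpace X] where
  /-- the parameter space indexing the link functions -/
  H : Type w
  [mH : MeasurableSpace H]
  /-- the law of the random parameter -/
  law : ProbabilityMeasure H
  /-- the link function attached to a parameter -/
  h : H → C → C → X
  measurable_h : Measurable fun p : H × C × C => h p.1 p.2.1 p.2.2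

attribute [instance] LinkPrior.mH

/-- Bilateral data sets `{x_{kl}}_{k ≠ l}` with `n` units. -/
abbrev Data (n : ℕ) (X : Type v) : Type v := {p : Fin n × Fin n // p.1 ≠ p.2} → X

section Model

variable {C : Type u} {X : Type v} [MeasurableSpace C] [MeasurableSpace X]

/-- Finite measurable partitions of the whole space (empty cells are allowed). -/
structure IsPartition {R : ℕ} (B : Fin R → Set X) : Prop where
  measurable : ∀ r, MeasurableSet (B r)
  disjoint : Pairwise fun r s => Disjoint (B r) (B s)
  cover : ⋃ r, B r = Set.univ

/-- The vector `(P(B_1), …, P(B_R))`. -/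
def evalVec {R : ℕ} (B : Fin R → Set X) (P : ProbabilityMeasure X) : Fin R → ℝ :=
  fun r => (P : Measure X).real (B r)

/-- The pairs of distinct latent values. -/
def offDiag (C : Type u) : Set (C × C) := {p | p.1 ≠ p.2}

lemma measurable_iid (n : ℕ) :
    Measurable fun P : ProbabilityMeasure C => Measure.pi fun _ : Fin n => (P : Measure C) := by
  refine Measurable.measure_of_isPiSystem_of_isProbabilityMeasure
    generateFrom_pi.symm isPiSystem_pi ?_
  rintro _ ⟨s, hs, rfl⟩
  simp only [Measure.pi_pi]
  refine Finset.measurable_prod _ fun i _ => ?_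
  exact (Measure.measurable_coe (hs i (mem_univ i))).comp measurable_subtype_coe

/-- `P ↦ P^{⊗ n}`: the conditional law of `(C_1, …, C_n)` given `P_C = P`. -/
def iidKernel (C : Type u) [MeasurableSpace C] (n : ℕ) :
    Kernel (ProbabilityMeasure C) (Fin n → C) :=
  ⟨fun P => Measure.pi fun _ => (P : Measure C), measurable_iid n⟩

instance (n : ℕ) : IsMarkovKernel (iidKernel C n) :=
  ⟨fun P => inferInstanceAs (IsProbabilityMeasure (Measure.pi fun _ : Fin n => (P : Measure C)))⟩

/-- Sample space of the full model: the parameter of `h`, the law `P_C`, and `(C_1, …, C_n)`. -/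
abbrev Sample (η : LinkPrior.{u, v, w} C X) (n : ℕ) : Type (max u w) :=
  η.H × ProbabilityMeasure C × (Fin n → C)

/-- Every pair of distinct units has its pair of latent values in `D`. Here `D` is the set of pairs
`(c, c')` for which `X_{ij} = h(c, c')` is defined. -/
def allDefined (D : Set (C × C)) (η : LinkPrior.{u, v, w} C X) (n : ℕ) : Set (Sample η n) :=
  {ω | ∀ k l : Fin n, k ≠ l → (ω.2.2 k, ω.2.2 l) ∈ D}

/-- Joint law of `(h, P_C, C_1, …, C_n)` under the prior `π(h) · π(P_C)` and
`C_1, …, C_n | h, P_C ∼ iid P_C`, given that all the observations `X_{kl}`, `k ≠ l`, are defined. -/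
def jointLaw (D : Set (C × C)) (η : LinkPrior.{u, v, w} C X)
    (π : ProbabilityMeasure (ProbabilityMeasure C)) (n : ℕ) : Measure (Sample η n) :=
  ((η.law : Measure η.H).prod
    ((π : Measure (ProbabilityMeasure C)) ⊗ₘ iidKernel C n))[|allDefined D η n]

/-- The observed array `X_{kl} = h(C_k, C_l)`, `k ≠ l`. -/
def observe (η : LinkPrior.{u, v, w} C X) (n : ℕ) (ω : Sample η n) : Data n X :=
  fun p => η.h ω.1 (ω.2.2 p.1.1) (ω.2.2 p.1.2)

/-- The law of the observed array. -/
def dataLaw (D : Set (C × C)) (η : LinkPrior.{u, v, w} C X)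
    (π : ProbabilityMeasure (ProbabilityMeasure C)) (n : ℕ) : Measure (Data n X) :=
  (jointLaw D η π n).map (observe η n)

/-- The distribution `P_{X_ij}` induced by a link function and `P_C = P`: the law of `h(C_i, C_j)`
for `C_i, C_j ∼ iid P`, given that `(C_i, C_j) ∈ D`. -/
def pairLaw (D : Set (C × C)) (h : C → C → X) (P : ProbabilityMeasure C) : Measure X :=
  (((P : Measure C).prod (P : Measure C))[|D]).map fun p => h p.1 p.2

/-- The posterior law, given the array `x`, of `(P_{X_ij}(B_1), …, P_{X_ij}(B_R))`. -/
def posterior (D : Set (C × C)) (η : LinkPrior.{u, v, w} C X)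
    (π : ProbabilityMeasure (ProbabilityMeasure C)) (n : ℕ) {R : ℕ} (B : Fin R → Set X)
    (x : Data n X) : Measure (Fin R → ℝ) :=
  haveI : IsFiniteMeasure (jointLaw D η π n) := by unfold jointLaw; infer_instance
  condDistrib (fun ω : Sample η n => fun r => (pairLaw D (η.h ω.1) ω.2.1).real (B r))
    (observe η n) (jointLaw D η π n) x

/-- A posterior of `P_{X_ij}`, given through the laws `post B x` of `(P_{X_ij}(B_1), …,
P_{X_ij}(B_R))`, does not smooth across events: for every finite measurable partition this law
depends on the data `x` only through the indicators of `x_{kl} ∈ B_r`. As posteriors are only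
determined up to null sets of the law `m` of the data, so is this dependence. -/
def DoesNotSmooth {n : ℕ} (m : Measure (Data n X))
    (post : ∀ {R : ℕ}, (Fin R → Set X) → Data n X → Measure (Fin R → ℝ)) : Prop :=
  ∀ (R : ℕ) (B : Fin R → Set X), IsPartition B →
    ∃ g : ({p : Fin n × Fin n // p.1 ≠ p.2} → Fin R → Prop) → Measure (Fin R → ℝ),
      ∀ᵐ x ∂m, post B x = g fun p r => x p ∈ B r

end Model

section Priors

variable {C : Type u} [MeasurableSpace C]

/-- The gamma law with shape `a ≥ 0` and rate one; for `a = 0` it is the point mass at zero. -/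
def gammaLaw (a : ℝ) : Measure ℝ := if a = 0 then Measure.dirac 0 else gammaMeasure a 1

/-- The Dirichlet law with parameters `a_r ≥ 0`, not all zero: the law of normalized independent
gamma variables. -/
def dirichletLaw {R : ℕ} (a : Fin R → ℝ) : Measure (Fin R → ℝ) :=
  (Measure.pi fun r => gammaLaw (a r)).map fun g r => g r / ∑ s, g s

/-- `π` is the law of the Dirichlet process with center measure `Q` and precision `α`. -/
def IsDirichletProcess (Q : ProbabilityMeasure C) (α : ℝ)
    (π : ProbabilityMeasure (ProbabilityMeasure C)) : Prop :=
  ∀ (R : ℕ) (A : Fin R → Set C), IsPartition A →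
    (π : Measure (ProbabilityMeasure C)).map (evalVec A) = dirichletLaw fun r => α * evalVec A Q r

/-- The point mass at `c`, as a probability measure. -/
def pointMass (c : C) : ProbabilityMeasure C := ⟨Measure.dirac c, inferInstance⟩

/-- The mixture `z δ_a + (1 - z) δ_b`, `z ∈ [0, 1]`. -/
def twoPointMix (a b : C) (z : unitInterval) : ProbabilityMeasure C :=
  ⟨ENNReal.ofReal (z : ℝ) • Measure.dirac a + ENNReal.ofReal (1 - (z : ℝ)) • Measure.dirac b, by
    constructor
    simp [← ENNReal.ofReal_add z.2.1 (sub_nonneg.2 z.2.2)]⟩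

/-- The three trivial processes: `P_C = ρ` for a deterministic `ρ`; `P_C = δ_Y` with `Y ∼ ρ`;
`P_C = Z δ_a + (1 - Z) δ_b` with deterministic `a, b` and a random `Z` in `[0, 1]`. -/
def IsTrivialProcess (π : ProbabilityMeasure (ProbabilityMeasure C)) : Prop :=
  (∃ ρ : ProbabilityMeasure C, (π : Measure (ProbabilityMeasure C)) = Measure.dirac ρ) ∨
  (∃ ρ : ProbabilityMeasure C,
    (π : Measure (ProbabilityMeasure C)) = (ρ : Measure C).map pointMass) ∨
  (∃ (a b : C) (ζ : ProbabilityMeasure unitInterval),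
    (π : Measure (ProbabilityMeasure C)) =
      (ζ : Measure unitInterval).map (twoPointMix a b))

end Priors

section Limit

variable {C : Type u} {X : Type v} [MeasurableSpace C] [MeasurableSpace X]

/-- `Lim` is the limit, as the precision tends to zero, of the posteriors of `P_{X_ij}` under the
priors `π(h) · DP(Q, α)`, where `X_{ij} = h(C_i, C_j)` for `C_i ≠ C_j`: along every sequence
`α_m ↓ 0` and for every finite measurable partition, the posterior laws of
`(P_{X_ij}(B_1), …, P_{X_ij}(B_R))` converge weakly to the one under `Lim`, for almost all data. -/
def IsLimitPosterior (Q : ProbabilityMeasure C) (η : LinkPrior.{u, v, w} C X) (n : ℕ)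
    (Lim : Kernel (Data n X) (ProbabilityMeasure X)) : Prop :=
  ∀ (α : ℕ → ℝ) (π : ℕ → ProbabilityMeasure (ProbabilityMeasure C)),
    (∀ m, 0 < α m ∧ IsDirichletProcess Q (α m) (π m)) → Tendsto α atTop (𝓝 0) →
    ∀ (R : ℕ) (B : Fin R → Set X), IsPartition B →
    ∀ j, ∀ᵐ x ∂dataLaw (offDiag C) η (π j) n,
      ∀ f : BoundedContinuousFunction (Fin R → ℝ) ℝ,
        Tendsto (fun m => ∫ y, f y ∂posterior (offDiag C) η (π m) n B x) atTop
          (𝓝 (∫ y, f y ∂(Lim x).map (evalVec B)))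

end Limit

end Bilateral

end

open Bilateral

/-!
Both parts rest on mixed moments, which determine laws on the unit cube (`ext_of_moments`,
`tendsto_integral_of_moments`), and on two recursions for them: the moments of a Dirichlet law
satisfy that of the Pólya urn (`integral_mono_cons_dirichletLaw`), and so the Dirichlet process is
itself an urn, in which a further observation, given a sample `c` from `P_C`, has the law
`(α Q + ∑ δ_{c_i}) / (α + n)` (`IsDirichletProcess.lintegral_urn`). As a factor `P_C(E)` of a
mixed moment is the probability that a further observation falls into `E`, the urn gives all
conditional mixed moments of the masses of disjoint sets, even of sets that depend on the sample
(`IsDirichletProcess.lintegral_massProd`).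

*Vanishing precision.* On the event that the latent values are distinct, the urn has drawn each of
them anew from `Q`, so that up to a constant their law does not depend on `α`. Applied to the sets
`{c_i}`, the urn shows that given the data the mixed moments of the masses `w_i = P_C{c_i}` are
those of the uniform law on the simplex up to an error of order `α`
(`IsDirichletProcess.setLIntegral_mono_atomMass`). With precision tending to zero the masses `w_i`
exhaust `P_C`, and the law of `h(C_i, C_j)` given `C_i ≠ C_j` approaches
`∑_{i ≠ j} w_i w_j δ_{x_ij} / ∑_{i ≠ j} w_i w_j`, an estimate made precise in
`abs_pairLaw_mul_sub_cellMass_le` and carried to the limit in `tendsto_integral_mono_of_ratio`.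
The law of this random measure, `limitPosterior`, assigns to `B_r` a mass which depends on the data
through the indicators of `x_ij ∈ B_r` only.

*Characterization.* The prior on `h` is the point mass at `h(c, c') = e(c)` with `e` the given
injection, so that the latent values are observed and `P_{X_ij}` is the image of `P_C`. Under a
Dirichlet process the posterior is the usual conjugate one, a function of the cell counts; for the
trivial processes, the vector of cell masses is constant, or is itself a function of the
indicators, or the data are determined by the indicators
(`IsDirichletProcess.doesNotSmooth`, `IsTrivialProcess.doesNotSmooth`).

Conversely, absence of smoothing for the partition `{A, Aᶜ}` says that the predictive probability
of `A`, given observations known to lie in subsets of `A` or of `Aᶜ`, depends on the two counts only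
(`CountPredictive`). If all `P_C(E)` are zero or one, `P_C` is a random point mass. Otherwise all
sets that are not null in the mean are charged jointly with positive probability. If there are no
three disjoint such sets, the mean measure lives on two points. If there are, the predictive
probabilities of three disjoint sets add up to one in every configuration, which forces them to be
affine in the counts with a common slope, and consistency in the sample size makes them those of an
urn (`exists_urn_of_three`), with the same correlation `t` for all sets
(`CountPredictive.exists_urnLaw`). For `t = 0` the variances vanish and `P_C` is deterministic; for
`t > 0` the moments are those of the Dirichlet process with precision `(1 - t) / t`.
-/

noncomputable section

namespace Bilateral

open scoped ENNReal

/-! ### Moments on the unit cube -/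

section Moments

variable {ι : Type*}

/-- The monomial `∏ w_i`, over a list of indices. -/
def mono (L : List ι) (w : ι → ℝ) : ℝ := (L.map w).prod

/-- The unit cube `[0, 1]^ι`. -/
def cube (ι : Type*) : Set (ι → ℝ) := Set.pi univ fun _ => Set.Icc 0 1

@[simp] lemma mono_nil (w : ι → ℝ) : mono [] w = 1 := rfl

@[simp] lemma mono_cons (i : ι) (L : List ι) (w : ι → ℝ) :
    mono (i :: L) w = w i * mono L w := by simp [mono]

lemma continuous_mono (L : List ι) : Continuous (mono L : (ι → ℝ) → ℝ) := by
  induction L with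
  | nil => exact continuous_const
  | cons i L ih => exact ((continuous_apply i).mul ih).congr fun w => (mono_cons i L w).symm

lemma mono_mem_Icc {w : ι → ℝ} (hw : w ∈ cube ι) (L : List ι) : mono L w ∈ Set.Icc (0 : ℝ) 1 := by
  induction L with
  | nil => simp
  | cons i L ih =>
    rw [mono_cons]
    have := hw i (mem_univ i)
    exact ⟨mul_nonneg this.1 ih.1, mul_le_one₀ this.2 ih.1 ih.2⟩

/-- On the unit cube a continuous function is a uniform limit of linear combinations of
monomials. -/
lemma exists_mem_span_mono_near (F : C(ι → ℝ, ℝ)) {ε : ℝ} (hε : 0 < ε) :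
    ∃ g ∈ Submodule.span ℝ (range fun L : List ι => (⟨mono L, continuous_mono L⟩ : C(ι → ℝ, ℝ))),
      ∀ w ∈ cube ι, |g w - F w| < ε := by
  set X : ι → C(ι → ℝ, ℝ) := fun i => ⟨fun w => w i, continuous_apply i⟩
  have hsep : (Algebra.adjoin ℝ (range X)).SeparatesPoints := by
    intro x y hxy
    obtain ⟨i, hi⟩ := Function.ne_iff.1 hxy
    exact ⟨X i, ⟨X i, Algebra.subset_adjoin ⟨i, rfl⟩, rfl⟩, hi⟩
  obtain ⟨g, hg, h⟩ :=
    ContinuousMap.exists_mem_subalgebra_near_continuous_of_isCompact_of_separatesPoints hsep F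
      (isCompact_univ_pi fun _ : ι => isCompact_Icc (a := (0 : ℝ)) (b := 1)) hε
  refine ⟨g, ?_, h⟩
  have hg' : g ∈ Subalgebra.toSubmodule (Algebra.adjoin ℝ (range X)) := hg
  rw [Algebra.adjoin_eq_span] at hg'
  refine Submodule.span_mono ?_ hg'
  intro f hf
  obtain ⟨l, hl, rfl⟩ := Submonoid.exists_list_of_mem_closure hf
  clear hf h hg hg'
  induction l with
  | nil => exact ⟨[], by ext; simp⟩
  | cons f l ih =>
    obtain ⟨i, rfl⟩ := hl f (by simp)
    obtain ⟨L, hL⟩ := ih fun y hy => hl y (by simp [hy])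
    refine ⟨i :: L, ?_⟩
    rw [List.prod_cons, ← hL]
    ext w
    simp [X]

variable [Finite ι]

lemma integrable_of_cube {μ : Measure (ι → ℝ)} [IsFiniteMeasure μ] (hμ : ∀ᵐ w ∂μ, w ∈ cube ι)
    {F : (ι → ℝ) → ℝ} (hF : Continuous F) : Integrable F μ := by
  have : Fintype ι := Fintype.ofFinite ι
  obtain ⟨K, hK⟩ := (isCompact_univ_pi fun _ : ι =>
    isCompact_Icc (a := (0 : ℝ)) (b := 1)).exists_bound_of_continuousOn hF.continuousOn
  exact Integrable.of_bound hF.aestronglyMeasurable K (hμ.mono fun w hw => hK w hw)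

/-- Method of moments on the cube: convergence of the moments implies convergence of the integrals
of all continuous functions. -/
lemma tendsto_integral_of_moments {μ : ℕ → Measure (ι → ℝ)} {ν : Measure (ι → ℝ)}
    [∀ m, IsFiniteMeasure (μ m)] [IsFiniteMeasure ν]
    (hμ : ∀ m, ∀ᵐ w ∂μ m, w ∈ cube ι) (hν : ∀ᵐ w ∂ν, w ∈ cube ι)
    (h : ∀ L : List ι, Tendsto (fun m => ∫ w, mono L w ∂μ m) atTop (𝓝 (∫ w, mono L w ∂ν)))
    (F : (ι → ℝ) → ℝ) (hF : Continuous F) :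
    Tendsto (fun m => ∫ w, F w ∂μ m) atTop (𝓝 (∫ w, F w ∂ν)) := by
  have : Fintype ι := Fintype.ofFinite ι
  have hmass : Tendsto (fun m => (μ m).real univ) atTop (𝓝 (ν.real univ)) := by
    simpa using h []
  -- the claim holds for all linear combinations of monomials
  have hspan : ∀ g ∈ Submodule.span ℝ
      (range fun L : List ι => (⟨mono L, continuous_mono L⟩ : C(ι → ℝ, ℝ))),
      Tendsto (fun m => ∫ w, g w ∂μ m) atTop (𝓝 (∫ w, g w ∂ν)) := by
    intro g hg
    induction hg using Submodule.span_induction with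
    | mem g hg => obtain ⟨L, rfl⟩ := hg; exact h L
    | zero => simp
    | add f g _ _ hf hg =>
      simp only [ContinuousMap.add_apply]
      rw [integral_add (integrable_of_cube hν f.continuous) (integrable_of_cube hν g.continuous)]
      refine (hf.add hg).congr fun m => ?_
      rw [integral_add (integrable_of_cube (hμ m) f.continuous)
        (integrable_of_cube (hμ m) g.continuous)]
    | smul a g _ hg =>
      simp only [ContinuousMap.smul_apply, smul_eq_mul, integral_const_mul]
      exact hg.const_mul a
  have near : ∀ {μ : Measure (ι → ℝ)} [IsFiniteMeasure μ], (∀ᵐ w ∂μ, w ∈ cube ι) →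
      ∀ (g : C(ι → ℝ, ℝ)) (δ : ℝ), (∀ w ∈ cube ι, |g w - F w| < δ) →
      |∫ w, g w ∂μ - ∫ w, F w ∂μ| ≤ δ * μ.real univ := by
    intro μ _ hμ g δ hg
    rw [← integral_sub (integrable_of_cube hμ g.continuous) (integrable_of_cube hμ hF)]
    rw [← Real.norm_eq_abs]
    exact norm_integral_le_of_norm_le_const
      (hμ.mono fun w hw => (Real.norm_eq_abs _).trans_le (hg w hw).le)
  rw [Metric.tendsto_atTop]
  intro ε hε
  set M := ν.real univ with hM
  have hM0 : 0 ≤ M := measureReal_nonneg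
  set δ := ε / (4 * (M + 1)) with hδ
  have hδ0 : 0 < δ := by positivity
  obtain ⟨g, hg, hgF⟩ := exists_mem_span_mono_near (⟨F, hF⟩ : C(ι → ℝ, ℝ)) hδ0
  obtain ⟨N₁, h₁⟩ := Metric.tendsto_atTop.1 (hspan g hg) (ε / 4) (by positivity)
  obtain ⟨N₂, h₂⟩ := Metric.tendsto_atTop.1 hmass 1 one_pos
  refine ⟨max N₁ N₂, fun m hm => ?_⟩
  have a₁ := h₁ m (le_trans (le_max_left _ _) hm)
  have a₂ := h₂ m (le_trans (le_max_right _ _) hm)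
  rw [Real.dist_eq] at a₁ a₂ ⊢
  have b₁ := near (hμ m) g δ hgF
  have b₂ := near hν g δ hgF
  have c₁ : δ * (μ m).real univ ≤ δ * (M + 1) := by
    have := (abs_lt.1 a₂).2
    gcongr
    linarith
  have c₂ : δ * M ≤ δ * (M + 1) := by gcongr; linarith
  have c₃ : δ * (M + 1) = ε / 4 := by rw [hδ]; field_simp
  rw [abs_le] at b₁ b₂
  rw [abs_lt] at a₁ ⊢
  constructor <;> linarith [b₁.1, b₁.2, b₂.1, b₂.2, a₁.1, a₁.2]

/-- Finite measures on the cube are determined by their moments. -/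
lemma ext_of_moments {μ ν : Measure (ι → ℝ)} [IsFiniteMeasure μ] [IsFiniteMeasure ν]
    (hμ : ∀ᵐ w ∂μ, w ∈ cube ι) (hν : ∀ᵐ w ∂ν, w ∈ cube ι)
    (h : ∀ L : List ι, ∫ w, mono L w ∂μ = ∫ w, mono L w ∂ν) : μ = ν := by
  refine ext_of_forall_integral_eq_of_IsFiniteMeasure fun f => ?_
  refine tendsto_nhds_unique ?_ (tendsto_integral_of_moments (μ := fun _ => μ) (fun _ => hμ) hν
    (fun L => by rw [h L]; exact tendsto_const_nhds) f f.continuous)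
  exact tendsto_const_nhds

end Moments

/-! ### Gamma and Dirichlet laws -/

section Gamma

lemma isProbabilityMeasure_gammaLaw {a : ℝ} (ha : 0 ≤ a) : IsProbabilityMeasure (gammaLaw a) := by
  unfold gammaLaw
  split_ifs with h
  · infer_instance
  · exact isProbabilityMeasure_gammaMeasure (lt_of_le_of_ne ha (Ne.symm h)) one_pos

lemma ae_gammaLaw_nonneg {a : ℝ} : ∀ᵐ x ∂gammaLaw a, 0 ≤ x := by
  unfold gammaLaw
  split_ifs with h
  · rw [ae_dirac_eq]; exact le_refl (0 : ℝ)
  · have hm : Measurable (gammaPDF a 1) := (measurable_gammaPDFReal a 1).ennreal_ofReal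
    rw [gammaMeasure, ae_withDensity_iff hm]
    refine ae_of_all _ fun x hx => ?_
    by_contra hlt
    exact hx (gammaPDF_of_neg (not_le.1 hlt))

lemma ae_gammaLaw_pos {a : ℝ} (ha : 0 < a) : ∀ᵐ x ∂gammaLaw a, 0 < x := by
  have h0 : ∀ᵐ x ∂gammaLaw a, x ≠ 0 := by
    rw [gammaLaw, if_neg ha.ne', gammaMeasure]
    refine (withDensity_absolutelyContinuous _ _).ae_le ?_
    exact Measure.ae_ne volume 0
  filter_upwards [h0, ae_gammaLaw_nonneg (a := a)] with x hx hx' using lt_of_le_of_ne hx' hx.symm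

/-- Size biasing a gamma law raises its shape by one. -/
lemma lintegral_mul_gammaLaw {a : ℝ} (ha : 0 ≤ a) {f : ℝ → ℝ≥0∞} (hf : Measurable f) :
    ∫⁻ x, ENNReal.ofReal x * f x ∂gammaLaw a =
      ENNReal.ofReal a * ∫⁻ x, f x ∂gammaLaw (a + 1) := by
  rcases ha.eq_or_lt with rfl | ha'
  · simp [gammaLaw]
  have hm : ∀ b, Measurable (gammaPDF b 1) := fun b => (measurable_gammaPDFReal b 1).ennreal_ofReal
  rw [gammaLaw, if_neg ha'.ne', gammaLaw, if_neg (by linarith), gammaMeasure, gammaMeasure,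
    lintegral_withDensity_eq_lintegral_mul _ (hm _) (by fun_prop),
    lintegral_withDensity_eq_lintegral_mul _ (hm _) hf, ← lintegral_const_mul _ (by fun_prop)]
  refine lintegral_congr fun x => ?_
  simp only [Pi.mul_apply]
  rw [← mul_assoc, ← mul_assoc]
  congr 1
  rcases lt_or_ge x 0 with hx | hx
  · rw [gammaPDF_of_neg hx, gammaPDF_of_neg hx]; simp
  rw [gammaPDF_of_nonneg hx, gammaPDF_of_nonneg hx, ← ENNReal.ofReal_mul' hx,
    ← ENNReal.ofReal_mul ha]
  congr 1
  rcases hx.eq_or_lt with rfl | hx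
  · simp [Real.zero_rpow ha'.ne']
  have hΓ := (Real.Gamma_pos_of_pos ha').ne'
  rw [Real.Gamma_add_one ha'.ne', add_sub_cancel_right, Real.rpow_sub_one hx.ne']
  simp only [Real.one_rpow]
  field_simp

lemma lintegral_exp_gammaLaw {a t : ℝ} (ha : 0 ≤ a) (ht : 0 ≤ t) :
    ∫⁻ x, ENNReal.ofReal (Real.exp (-(t * x))) ∂gammaLaw a =
      ENNReal.ofReal ((1 + t) ^ (-a)) := by
  rcases ha.eq_or_lt with rfl | ha'
  · simp [gammaLaw]
  have ht1 : 0 < 1 + t := by linarith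
  have hm : ∀ b r, Measurable (gammaPDF b r) :=
    fun b r => (measurable_gammaPDFReal b r).ennreal_ofReal
  rw [gammaLaw, if_neg ha'.ne', gammaMeasure,
    lintegral_withDensity_eq_lintegral_mul _ (hm _ _) (by fun_prop)]
  have : ∀ x, (gammaPDF a 1 * fun x => ENNReal.ofReal (Real.exp (-(t * x)))) x =
      ENNReal.ofReal ((1 + t) ^ (-a)) * gammaPDF a (1 + t) x := by
    intro x
    simp only [Pi.mul_apply]
    rcases lt_or_ge x 0 with hx | hx
    · rw [gammaPDF_of_neg hx, gammaPDF_of_neg hx]; simp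
    rw [gammaPDF_of_nonneg hx, gammaPDF_of_nonneg hx, ← ENNReal.ofReal_mul' (Real.exp_pos _).le,
      ← ENNReal.ofReal_mul (by positivity)]
    congr 1
    rw [Real.rpow_neg ht1.le, Real.one_rpow, add_mul, neg_add, Real.exp_add]
    have := (Real.rpow_pos_of_pos ht1 a).ne'
    field_simp
  rw [lintegral_congr this, lintegral_const_mul _ (hm _ _), lintegral_gammaPDF_eq_one ha' ht1,
    mul_one]

end Gamma

section Dirichlet

variable {R : ℕ}

/-- The joint law of independent gamma variables with shapes `a_r` and rate one. -/
def gammaPi (a : Fin R → ℝ) : Measure (Fin R → ℝ) := Measure.pi fun r => gammaLaw (a r)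

lemma isProbabilityMeasure_gammaPi {a : Fin R → ℝ} (ha : ∀ r, 0 ≤ a r) :
    IsProbabilityMeasure (gammaPi a) := by
  have := fun r => isProbabilityMeasure_gammaLaw (ha r)
  unfold gammaPi
  infer_instance

lemma ae_gammaPi {a : Fin R → ℝ} (ha : ∀ r, 0 ≤ a r) :
    ∀ᵐ x ∂gammaPi a, ∀ r, 0 ≤ x r ∧ (0 < a r → 0 < x r) := by
  have := fun r => isProbabilityMeasure_gammaLaw (ha r)
  rw [ae_all_iff]
  intro r
  have h : ∀ᵐ y ∂gammaLaw (a r), 0 ≤ y ∧ (0 < a r → 0 < y) := by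
    rcases (ha r).eq_or_lt with h | h
    · filter_upwards [ae_gammaLaw_nonneg (a := a r)] with y hy
      exact ⟨hy, fun h' => absurd h h'.ne⟩
    · filter_upwards [ae_gammaLaw_pos h] with y hy using ⟨hy.le, fun _ => hy⟩
  exact (Measure.tendsto_eval_ae_ae (μ := fun r => gammaLaw (a r)) (i := r)).eventually h

lemma ae_gammaPi_sum_pos {a : Fin R → ℝ} (ha : ∀ r, 0 ≤ a r) (hs : 0 < ∑ r, a r) :
    ∀ᵐ x ∂gammaPi a, (∀ r, 0 ≤ x r) ∧ 0 < ∑ r, x r := by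
  obtain ⟨r, -, hr⟩ := Finset.exists_lt_of_sum_lt (s := Finset.univ) (f := fun _ => (0 : ℝ))
    (g := a) (by simpa using hs)
  filter_upwards [ae_gammaPi ha] with x hx
  exact ⟨fun r => (hx r).1,
    Finset.sum_pos' (fun r _ => (hx r).1) ⟨r, Finset.mem_univ r, (hx r).2 hr⟩⟩

/-- Integration over the `s`-th coordinate first. -/
lemma lintegral_pi_insertNth {n : ℕ} {E : Type*} [MeasurableSpace E]
    (μ : Fin (n + 1) → Measure E) [∀ i, SigmaFinite (μ i)]
    (s : Fin (n + 1)) {f : (Fin (n + 1) → E) → ℝ≥0∞} (hf : Measurable f) :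
    ∫⁻ x, f x ∂Measure.pi μ =
      ∫⁻ r, ∫⁻ y, f (s.insertNth y r) ∂μ s ∂Measure.pi fun j => μ (s.succAbove j) := by
  have h := (measurePreserving_piFinSuccAbove μ s).symm
  have hm := (MeasurableEquiv.piFinSuccAbove (fun _ : Fin (n + 1) => E) s).symm.measurable
  rw [← h.lintegral_comp hf, lintegral_prod_symm
      (fun z => f ((MeasurableEquiv.piFinSuccAbove (fun _ => E) s).symm z))
      (hf.comp hm).aemeasurable]
  rfl

lemma lintegral_pi_prod {n : ℕ} {E : Type*} [MeasurableSpace E] (μ : Fin n → Measure E)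
    [∀ i, SigmaFinite (μ i)] {f : Fin n → E → ℝ≥0∞} (hf : ∀ i, Measurable (f i)) :
    ∫⁻ x, ∏ i, f i (x i) ∂Measure.pi μ = ∏ i, ∫⁻ y, f i y ∂μ i := by
  induction n with
  | zero => simp
  | succ n ih =>
    rw [lintegral_pi_insertNth μ 0 (f := fun x => ∏ i, f i (x i))
      (Finset.measurable_prod _ fun i _ => (hf i).comp (measurable_pi_apply i))]
    simp only [Fin.prod_univ_succ, Fin.insertNth_apply_same]
    have h : ∀ r : Fin n → E, ∫⁻ y, f 0 y * ∏ i : Fin n, f i.succ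
        ((0 : Fin (n + 1)).insertNth (α := fun _ => E) y r i.succ) ∂μ 0 =
        (∫⁻ y, f 0 y ∂μ 0) * ∏ i : Fin n, f i.succ (r i) := by
      intro r
      rw [← lintegral_mul_const _ (hf 0)]
      simp
    simp only [h]
    rw [lintegral_const_mul _ (f := fun r : Fin n → E => ∏ i, f i.succ (r i))
      (Finset.measurable_prod _ fun i _ => (hf _).comp (measurable_pi_apply i))]
    congr 1
    exact ih (fun j => μ j.succ) fun i => hf i.succ

lemma lintegral_mul_gammaPi {a : Fin R → ℝ} (ha : ∀ r, 0 ≤ a r) (s : Fin R)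
    {f : (Fin R → ℝ) → ℝ≥0∞} (hf : Measurable f) :
    ∫⁻ x, ENNReal.ofReal (x s) * f x ∂gammaPi a =
      ENNReal.ofReal (a s) * ∫⁻ x, f x ∂gammaPi (Function.update a s (a s + 1)) := by
  cases R with
  | zero => exact s.elim0
  | succ n =>
    have := fun r => isProbabilityMeasure_gammaLaw (ha r)
    have h' : ∀ r, 0 ≤ Function.update a s (a s + 1) r := by
      intro r
      rcases eq_or_ne r s with rfl | h
      · simpa using add_nonneg (ha r) zero_le_one
      · simpa [h] using ha r
    have := fun r => isProbabilityMeasure_gammaLaw (h' r)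
    have hins : Measurable fun p : (Fin n → ℝ) × ℝ =>
        (s.insertNth p.2 p.1 : Fin (n + 1) → ℝ) :=
      (MeasurableEquiv.piFinSuccAbove (fun _ : Fin (n + 1) => ℝ) s).symm.measurable.comp
        measurable_swap
    have hr : ∀ r : Fin n → ℝ, Measurable fun y : ℝ => f (s.insertNth y r) := fun r =>
      hf.comp (hins.comp measurable_prodMk_left)
    rw [gammaPi, gammaPi, lintegral_pi_insertNth _ s (by fun_prop),
      lintegral_pi_insertNth _ s hf, ← lintegral_const_mul]
    · simp only [Fin.insertNth_apply_same, Function.update_self, ne_eq, Fin.succAbove_ne,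
        not_false_eq_true, Function.update_of_ne]
      exact lintegral_congr fun r => lintegral_mul_gammaLaw (ha s) (hr r)
    · simp only [Function.update_self]
      have := isProbabilityMeasure_gammaLaw (add_nonneg (ha s) zero_le_one)
      exact (hf.comp hins).lintegral_prod_right'

/-- The shape parameters after size biasing along a list of coordinates. -/
def shiftBy (a : Fin R → ℝ) (L : List (Fin R)) : Fin R → ℝ := fun r => a r + L.count r

/-- The constant by which size biasing along a list of coordinates changes the total mass. -/
def shiftConst (a : Fin R → ℝ) : List (Fin R) → ℝ≥0∞
  | [] => 1
  | s :: L => ENNReal.ofReal (a s + L.count s) * shiftConst a L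

lemma update_shiftBy (a : Fin R → ℝ) (s : Fin R) (L : List (Fin R)) :
    Function.update (shiftBy a L) s (shiftBy a L s + 1) = shiftBy a (s :: L) := by
  ext r
  rcases eq_or_ne r s with rfl | h
  · simp [shiftBy, add_assoc]
  · simp [shiftBy, h, List.count_cons_of_ne h.symm]

lemma shiftBy_nonneg {a : Fin R → ℝ} (ha : ∀ r, 0 ≤ a r) (L : List (Fin R)) (r : Fin R) :
    0 ≤ shiftBy a L r := add_nonneg (ha r) (Nat.cast_nonneg _)

lemma sum_shiftBy (a : Fin R → ℝ) (L : List (Fin R)) :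
    ∑ r, shiftBy a L r = ∑ r, a r + L.length := by
  simp only [shiftBy, Finset.sum_add_distrib, add_right_inj]
  induction L with
  | nil => simp
  | cons s L ih => simp [List.count_cons, Finset.sum_add_distrib, ih]

lemma lintegral_mono_mul_gammaPi {a : Fin R → ℝ} (ha : ∀ r, 0 ≤ a r) (L : List (Fin R))
    {f : (Fin R → ℝ) → ℝ≥0∞} (hf : Measurable f) :
    ∫⁻ x, ENNReal.ofReal (mono L x) * f x ∂gammaPi a =
      shiftConst a L * ∫⁻ x, f x ∂gammaPi (shiftBy a L) := by
  induction L generalizing f with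
  | nil =>
    have : shiftBy a [] = a := by ext; simp [shiftBy]
    simp [shiftConst, this]
  | cons s L ih =>
    have h : ∀ᵐ x ∂gammaPi a, ENNReal.ofReal (mono (s :: L) x) * f x =
        ENNReal.ofReal (mono L x) * (ENNReal.ofReal (x s) * f x) := by
      filter_upwards [ae_gammaPi ha] with x hx
      rw [mono_cons, ENNReal.ofReal_mul (hx s).1]
      ring
    rw [lintegral_congr_ae h, ih (by fun_prop), lintegral_mul_gammaPi (shiftBy_nonneg ha L) s hf,
      update_shiftBy, shiftConst, shiftBy]
    ring

/-- The inverse moments of the sum of independent gamma variables are determined by the total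
shape. -/
lemma lintegral_inv_sum_gammaPi {b c : Fin R → ℝ} (hb : ∀ r, 0 ≤ b r) (hc : ∀ r, 0 ≤ c r)
    (hbc : ∑ r, b r = ∑ r, c r) (hs : 0 < ∑ r, b r) (K : ℕ) :
    ∫⁻ x, ENNReal.ofReal (1 / (∑ r, x r) ^ (K + 1)) ∂gammaPi b =
      ∫⁻ x, ENNReal.ofReal (1 / (∑ r, x r) ^ (K + 1)) ∂gammaPi c := by
  -- `K! / s ^ (K + 1)` is the integral of `t ^ K * exp (-t s)` over `t > 0`
  have hlap : ∀ b : Fin R → ℝ, (∀ r, 0 ≤ b r) → 0 < ∑ r, b r →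
      ENNReal.ofReal (Real.Gamma (K + 1)) *
        ∫⁻ x, ENNReal.ofReal (1 / (∑ r, x r) ^ (K + 1)) ∂gammaPi b =
      ∫⁻ t in Ioi (0 : ℝ), ENNReal.ofReal (t ^ K) * ENNReal.ofReal ((1 + t) ^ (-∑ r, b r)) := by
    intro b hb hs
    have := isProbabilityMeasure_gammaPi hb
    rw [← lintegral_const_mul _ (by fun_prop)]
    have h1 : ∀ᵐ x ∂gammaPi b, ENNReal.ofReal (Real.Gamma (K + 1)) *
        ENNReal.ofReal (1 / (∑ r, x r) ^ (K + 1)) =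
        ∫⁻ t in Ioi (0 : ℝ), ENNReal.ofReal (t ^ K) *
          ENNReal.ofReal (Real.exp (-(t * ∑ r, x r))) := by
      filter_upwards [ae_gammaPi_sum_pos hb hs] with x hx
      set S := ∑ r, x r with hS
      have hint := Real.integral_rpow_mul_exp_neg_mul_Ioi (a := (K : ℝ) + 1) (r := S)
        (by positivity) hx.2
      have hne : Real.Gamma (K + 1) ≠ 0 := (Real.Gamma_pos_of_pos (by positivity)).ne'
      have hval : (1 / S) ^ ((K : ℝ) + 1) * Real.Gamma (K + 1) ≠ 0 :=
        mul_ne_zero (Real.rpow_pos_of_pos (by have := hx.2; positivity) _).ne' hne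
      rw [← ENNReal.ofReal_mul (Real.Gamma_pos_of_pos (by positivity)).le]
      have heq : Real.Gamma (K + 1) * (1 / S ^ (K + 1)) =
          ∫ t in Ioi (0 : ℝ), t ^ ((K : ℝ) + 1 - 1) * Real.exp (-(S * t)) := by
        rw [hint, mul_comm]
        congr 1
        rw [← Nat.cast_succ, Real.rpow_natCast, one_div_pow]
      rw [heq, ofReal_integral_eq_lintegral_ofReal]
      · refine setLIntegral_congr_fun measurableSet_Ioi fun t ht => ?_
        rw [← ENNReal.ofReal_mul (pow_nonneg (le_of_lt ht) _), add_sub_cancel_right,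
          Real.rpow_natCast, mul_comm S t]
      · by_contra hni
        rw [integral_undef hni] at hint
        exact hval hint.symm
      · refine (ae_restrict_iff' measurableSet_Ioi).2 (ae_of_all _ fun t ht => ?_)
        have ht : (0 : ℝ) < t := ht
        positivity
    rw [lintegral_congr_ae h1, lintegral_lintegral_swap (by fun_prop)]
    refine setLIntegral_congr_fun measurableSet_Ioi fun t ht => ?_
    have ht : (0 : ℝ) < t := ht
    rw [lintegral_const_mul _ (by fun_prop)]
    congr 1
    have := fun r => isProbabilityMeasure_gammaLaw (hb r)
    have hexp : ∀ x : Fin R → ℝ, ENNReal.ofReal (Real.exp (-(t * ∑ r, x r))) =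
        ∏ r, ENNReal.ofReal (Real.exp (-(t * x r))) := by
      intro x
      rw [← ENNReal.ofReal_prod_of_nonneg fun _ _ => (Real.exp_pos _).le, ← Real.exp_sum,
        Finset.mul_sum, Finset.sum_neg_distrib]
    simp only [hexp, gammaPi]
    rw [lintegral_pi_prod _ (f := fun _ x => ENNReal.ofReal (Real.exp (-(t * x))))
      fun _ => by fun_prop]
    simp only [lintegral_exp_gammaLaw (hb _) ht.le]
    rw [← ENNReal.ofReal_prod_of_nonneg fun _ _ => by positivity, ← Finset.sum_neg_distrib,
      Real.rpow_sum_of_pos (by linarith)]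
  have hΓ : ENNReal.ofReal (Real.Gamma (K + 1)) ≠ 0 := by
    simpa using Real.Gamma_pos_of_pos (by positivity : (0 : ℝ) < K + 1)
  rw [← ENNReal.mul_right_inj hΓ ENNReal.ofReal_ne_top, hlap b hb hs, hlap c hc (hbc ▸ hs), hbc]

lemma lintegral_inv_sum_gammaPi_update {b : Fin R → ℝ} (hb : ∀ r, 0 ≤ b r)
    (hs : 0 < ∑ r, b r) (s : Fin R) (K : ℕ) :
    ∫⁻ x, ENNReal.ofReal (1 / (∑ r, x r) ^ K) ∂gammaPi b =
      ENNReal.ofReal (∑ r, b r) * ∫⁻ x, ENNReal.ofReal (1 / (∑ r, x r) ^ (K + 1))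
        ∂gammaPi (Function.update b s (b s + 1)) := by
  have hup : ∀ r i, 0 ≤ Function.update b r (b r + 1) i := by
    intro r i
    rcases eq_or_ne i r with rfl | h
    · simpa using add_nonneg (hb i) zero_le_one
    · simpa [h] using hb i
  have hsum : ∀ r, ∑ i, Function.update b r (b r + 1) i = ∑ i, b i + 1 := by
    intro r
    rw [Finset.sum_update_of_mem (Finset.mem_univ r), ← Finset.sum_sdiff (Finset.subset_univ {r})]
    simp
    ring
  have h1 : ∀ᵐ x ∂gammaPi b, ENNReal.ofReal (1 / (∑ r, x r) ^ K) =
      ∑ r, ENNReal.ofReal (x r) * ENNReal.ofReal (1 / (∑ r, x r) ^ (K + 1)) := by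
    filter_upwards [ae_gammaPi_sum_pos hb hs] with x hx
    rw [← Finset.sum_mul, ← ENNReal.ofReal_sum_of_nonneg fun r _ => hx.1 r,
      ← ENNReal.ofReal_mul hx.2.le]
    congr 1
    have := hx.2.ne'
    field_simp
    ring
  rw [lintegral_congr_ae h1, lintegral_finsetSum _ fun r _ => by fun_prop,
    ENNReal.ofReal_sum_of_nonneg fun r _ => hb r, Finset.sum_mul]
  refine Finset.sum_congr rfl fun r _ => ?_
  rw [lintegral_mul_gammaPi hb r (by fun_prop)]
  congr 1
  exact lintegral_inv_sum_gammaPi (hup r) (hup s) (by rw [hsum, hsum]) (by rw [hsum]; linarith) K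

lemma measurable_normalize : Measurable fun (g : Fin R → ℝ) r => g r / ∑ s, g s := by fun_prop

lemma isProbabilityMeasure_dirichletLaw {a : Fin R → ℝ} (ha : ∀ r, 0 ≤ a r) :
    IsProbabilityMeasure (dirichletLaw a) := by
  have := isProbabilityMeasure_gammaPi ha
  exact Measure.isProbabilityMeasure_map (μ := gammaPi a) measurable_normalize.aemeasurable

lemma ae_dirichletLaw {a : Fin R → ℝ} (ha : ∀ r, 0 ≤ a r) (hs : 0 < ∑ r, a r) :
    ∀ᵐ w ∂dirichletLaw a, (∀ r, 0 ≤ w r ∧ (0 < a r → 0 < w r)) ∧ ∑ r, w r = 1 := by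
  have hm : MeasurableSet {w : Fin R → ℝ |
      (∀ r, 0 ≤ w r ∧ (0 < a r → 0 < w r)) ∧ ∑ r, w r = 1} := by
    have h0 : ∀ r, MeasurableSet {w : Fin R → ℝ | 0 < a r → 0 < w r} := by
      intro r
      by_cases h : 0 < a r
      · simpa [h] using measurableSet_lt measurable_const (measurable_pi_apply r)
      · simp [h]
    rw [show {w : Fin R → ℝ | (∀ r, 0 ≤ w r ∧ (0 < a r → 0 < w r)) ∧ ∑ r, w r = 1} =
      (⋂ r, ({w | 0 ≤ w r} ∩ {w | 0 < a r → 0 < w r})) ∩ {w | ∑ r, w r = 1} by ext; simp]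
    exact (MeasurableSet.iInter fun r => (measurableSet_le measurable_const
      (measurable_pi_apply r)).inter (h0 r)).inter
        (measurableSet_eq_fun (by fun_prop) measurable_const)
  rw [dirichletLaw, ae_map_iff measurable_normalize.aemeasurable hm]
  filter_upwards [ae_gammaPi ha, ae_gammaPi_sum_pos ha hs] with x hx hx'
  refine ⟨fun r => ⟨div_nonneg (hx r).1 hx'.2.le, fun h => div_pos ((hx r).2 h) hx'.2⟩, ?_⟩
  rw [← Finset.sum_div, div_self hx'.2.ne']

lemma mem_cube_of_sum_eq_one {w : Fin R → ℝ} (h : ∀ r, 0 ≤ w r) (h1 : ∑ r, w r = 1) :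
    w ∈ cube (Fin R) := fun r _ =>
  ⟨h r, h1 ▸ Finset.single_le_sum (f := w) (fun r _ => h r) (Finset.mem_univ r)⟩

lemma ae_dirichletLaw_mem_cube {a : Fin R → ℝ} (ha : ∀ r, 0 ≤ a r) (hs : 0 < ∑ r, a r) :
    ∀ᵐ w ∂dirichletLaw a, w ∈ cube (Fin R) :=
  (ae_dirichletLaw ha hs).mono fun _ hw => mem_cube_of_sum_eq_one (fun r => (hw.1 r).1) hw.2

/-- The moments of Dirichlet laws satisfy the recursion of the Pólya urn. -/
lemma integral_mono_cons_dirichletLaw {a : Fin R → ℝ} (ha : ∀ r, 0 ≤ a r) (hs : 0 < ∑ r, a r)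
    (s : Fin R) (L : List (Fin R)) :
    (∑ r, a r + L.length) * ∫ w, mono (s :: L) w ∂dirichletLaw a =
      (a s + L.count s) * ∫ w, mono L w ∂dirichletLaw a := by
  have hmono : ∀ L : List (Fin R), ∫ w, mono L w ∂dirichletLaw a =
      (shiftConst a L * ∫⁻ x, ENNReal.ofReal (1 / (∑ r, x r) ^ L.length)
        ∂gammaPi (shiftBy a L)).toReal := by
    intro L
    rw [integral_eq_lintegral_of_nonneg_ae
      ((ae_dirichletLaw_mem_cube ha hs).mono fun w hw => (mono_mem_Icc hw L).1)
      (continuous_mono L).aestronglyMeasurable, dirichletLaw,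
      lintegral_map (continuous_mono L).measurable.ennreal_ofReal measurable_normalize,
      ← lintegral_mono_mul_gammaPi ha L (by fun_prop)]
    congr 1
    refine lintegral_congr_ae ?_
    filter_upwards [ae_gammaPi_sum_pos ha hs] with x hx
    rw [← ENNReal.ofReal_mul' (by have := hx.2; positivity)]
    congr 1
    have := hx.2.ne'
    clear hx
    induction L with
    | nil => simp
    | cons r L ih => rw [mono_cons, ih, mono_cons, List.length_cons]; field_simp; ring
  have hpos : 0 < ∑ r, shiftBy a L r := by rw [sum_shiftBy]; positivity
  rw [hmono, hmono, lintegral_inv_sum_gammaPi_update (shiftBy_nonneg ha L) hpos s, sum_shiftBy,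
    update_shiftBy, shiftConst, List.length_cons]
  simp only [ENNReal.toReal_mul]
  rw [ENNReal.toReal_ofReal (add_nonneg (ha s) (Nat.cast_nonneg _)),
    ENNReal.toReal_ofReal (by positivity)]
  ring

end Dirichlet

/-! ### The Dirichlet process and the Pólya urn -/

section Urn

variable {C : Type u} [MeasurableSpace C]

lemma measurable_evalVec {R : ℕ} {A : Fin R → Set C} (hA : ∀ r, MeasurableSet (A r)) :
    Measurable (evalVec A) :=
  measurable_pi_iff.2 fun r =>
    ((Measure.measurable_coe (hA r)).comp measurable_subtype_coe).ennreal_toReal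

lemma evalVec_mem_cube {R : ℕ} (A : Fin R → Set C) (P : ProbabilityMeasure C) :
    evalVec A P ∈ cube (Fin R) := fun _ _ => ⟨measureReal_nonneg, measureReal_le_one⟩

lemma IsPartition.sum_evalVec {R : ℕ} {A : Fin R → Set C} (hA : IsPartition A)
    (P : ProbabilityMeasure C) : ∑ r, evalVec A P r = 1 := by
  simp only [evalVec]
  rw [← measureReal_iUnion_fintype hA.disjoint hA.measurable, hA.cover, probReal_univ]

lemma IsDirichletProcess.integral_mono_cons {Q : ProbabilityMeasure C} {α : ℝ} (hα : 0 < α)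
    {π : ProbabilityMeasure (ProbabilityMeasure C)} (h : IsDirichletProcess Q α π)
    {R : ℕ} {A : Fin R → Set C} (hA : IsPartition A) (s : Fin R) (L : List (Fin R)) :
    (α + L.length) * ∫ P, mono (s :: L) (evalVec A P) ∂(π : Measure (ProbabilityMeasure C)) =
      (α * evalVec A Q s + L.count s) *
        ∫ P, mono L (evalVec A P) ∂(π : Measure (ProbabilityMeasure C)) := by
  have hsum : ∑ r, α * evalVec A Q r = α := by
    rw [← Finset.mul_sum, hA.sum_evalVec, mul_one]
  have hm := (measurable_evalVec hA.measurable).aemeasurable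
    (μ := (π : Measure (ProbabilityMeasure C)))
  rw [← integral_map hm (continuous_mono _).aestronglyMeasurable,
    ← integral_map hm (continuous_mono _).aestronglyMeasurable, h R A hA]
  have := integral_mono_cons_dirichletLaw (a := fun r => α * evalVec A Q r)
    (fun r => mul_nonneg hα.le measureReal_nonneg) (by rw [hsum]; exact hα) s L
  rwa [hsum] at this

/-- `P ↦ P`, as a kernel. -/
def evalKernel (C : Type u) [MeasurableSpace C] : Kernel (ProbabilityMeasure C) C :=
  ⟨fun P => (P : Measure C), measurable_subtype_coe⟩

instance : IsMarkovKernel (evalKernel C) :=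
  ⟨fun P => inferInstanceAs (IsProbabilityMeasure (P : Measure C))⟩

/-- The unnormalized transition kernel `c ↦ α Q + ∑ δ_{c_i}` of the Pólya urn. -/
def urnKernel (Q : ProbabilityMeasure C) (α : ℝ) (n : ℕ) : Kernel (Fin n → C) C :=
  ⟨fun c => ENNReal.ofReal α • (Q : Measure C) + ∑ i, Measure.dirac (c i), by
    refine Measure.measurable_of_measurable_coe _ fun s hs => ?_
    simp only [Measure.add_apply, Measure.smul_apply, Measure.finsetSum_apply]
    refine measurable_const.add (Finset.measurable_sum _ fun i _ => ?_)
    exact (Measure.measurable_coe hs).comp (Measure.measurable_dirac.comp (measurable_pi_apply i))⟩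

lemma urnKernel_apply (Q : ProbabilityMeasure C) (α : ℝ) (n : ℕ) (c : Fin n → C) :
    urnKernel Q α n c = ENNReal.ofReal α • (Q : Measure C) + ∑ i, Measure.dirac (c i) := rfl

instance (Q : ProbabilityMeasure C) (α : ℝ) (n : ℕ) : IsFiniteKernel (urnKernel Q α n) := by
  refine ⟨ENNReal.ofReal α + n, by finiteness, fun c => ?_⟩
  simp [urnKernel_apply]

lemma iidKernel_apply (n : ℕ) (P : ProbabilityMeasure C) :
    iidKernel C n P = Measure.pi fun _ => (P : Measure C) := rfl

lemma evalKernel_apply (P : ProbabilityMeasure C) : evalKernel C P = (P : Measure C) := rfl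

lemma prod_measure_eq_ofReal_mono {T : Type*} {R : ℕ} (e : T ≃ Fin R) (A : T → Set C)
    (P : ProbabilityMeasure C) (L : List T) :
    (L.map fun t => (P : Measure C) (A t)).prod =
      ENNReal.ofReal (mono (L.map e) (evalVec (fun r => A (e.symm r)) P)) := by
  induction L with
  | nil => simp
  | cons t L ih =>
    rw [List.map_cons, List.prod_cons, ih, List.map_cons, mono_cons,
      ENNReal.ofReal_mul (evalVec_mem_cube _ P _ (mem_univ _)).1]
    simp [evalVec, Measure.real]

lemma isPartition_fibers {T : Type*} [MeasurableSpace T] [MeasurableSingletonClass T] {R : ℕ}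
    (e : T ≃ Fin R) {ψ : C → T} (hψ : Measurable ψ) :
    IsPartition fun r => ψ ⁻¹' {e.symm r} where
  measurable r := hψ (measurableSet_singleton _)
  disjoint r s hrs := Disjoint.preimage _ (by simpa using hrs)
  cover := by
    ext c
    simpa using ⟨e (ψ c), by simp⟩

lemma IsDirichletProcess.lintegral_fibers {Q : ProbabilityMeasure C} {α : ℝ} (hα : 0 < α)
    {π : ProbabilityMeasure (ProbabilityMeasure C)} (h : IsDirichletProcess Q α π)
    {T : Type*} [Fintype T] [DecidableEq T] [MeasurableSpace T] [MeasurableSingletonClass T]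
    {ψ : C → T} (hψ : Measurable ψ) (s : T) (L : List T) :
    (ENNReal.ofReal α + L.length) * ∫⁻ P, ((s :: L).map fun t =>
        (P : Measure C) (ψ ⁻¹' {t})).prod ∂(π : Measure (ProbabilityMeasure C)) =
      (ENNReal.ofReal α * (Q : Measure C) (ψ ⁻¹' {s}) + L.count s) *
        ∫⁻ P, (L.map fun t => (P : Measure C) (ψ ⁻¹' {t})).prod
          ∂(π : Measure (ProbabilityMeasure C)) := by
  have e := Fintype.equivFin T
  have hA := isPartition_fibers e hψ
  have hint : ∀ L : List T, ∫⁻ P, (L.map fun t => (P : Measure C) (ψ ⁻¹' {t})).prod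
      ∂(π : Measure (ProbabilityMeasure C)) =
      ENNReal.ofReal (∫ P, mono (L.map e) (evalVec (fun r => ψ ⁻¹' {e.symm r}) P)
        ∂(π : Measure (ProbabilityMeasure C))) := by
    intro L
    have hb : ∀ P, mono (L.map e) (evalVec (fun r => ψ ⁻¹' {e.symm r}) P) ∈ Set.Icc (0 : ℝ) 1 :=
      fun P => mono_mem_Icc (evalVec_mem_cube _ P) _
    rw [ofReal_integral_eq_lintegral_ofReal]
    · exact lintegral_congr fun P => prod_measure_eq_ofReal_mono e (fun t => ψ ⁻¹' {t}) P L
    · refine Integrable.of_bound ((continuous_mono _).measurable.comp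
        (measurable_evalVec hA.measurable)).aestronglyMeasurable 1 (ae_of_all _ fun P => ?_)
      rw [Real.norm_eq_abs, abs_of_nonneg (hb P).1]
      exact (hb P).2
    · exact ae_of_all _ fun P => (hb P).1
  have hQ : 0 ≤ α * evalVec (fun r => ψ ⁻¹' {e.symm r}) Q (e s) :=
    mul_nonneg hα.le measureReal_nonneg
  have key := h.integral_mono_cons hα hA (e s) (L.map e)
  rw [hint, hint, ← ENNReal.ofReal_natCast, ← ENNReal.ofReal_natCast,
    ← ENNReal.ofReal_add hα.le (by positivity), ← ENNReal.ofReal_mul (by positivity),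
    show (Q : Measure C) (ψ ⁻¹' {s}) =
      ENNReal.ofReal (evalVec (fun r => ψ ⁻¹' {e.symm r}) Q (e s)) by
        simp [evalVec, Measure.real], ← ENNReal.ofReal_mul hα.le,
    ← ENNReal.ofReal_add hQ (by positivity),
    ← ENNReal.ofReal_mul (add_nonneg hQ (by positivity))]
  rw [List.length_map, List.count_map_of_injective _ e e.injective] at key
  rw [List.map_cons, key]

lemma count_ofFn {T : Type*} [DecidableEq T] {n : ℕ} (t : Fin n → T) (s : T) :
    (List.ofFn t).count s = (Finset.univ.filter fun i => t i = s).card := by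
  induction n with
  | zero => simp
  | succ n ih =>
    rw [List.ofFn_succ, List.count_cons, ih, Fin.card_filter_univ_succ]
    simp [add_comm]
    split_ifs <;> ring

/-- A measure on `C ^ n × C` is determined by its values on the products of the cells of finite
measurable partitions. -/
lemma ext_of_fibers {n : ℕ} {μ ν : Measure ((Fin n → C) × C)} [IsFiniteMeasure μ]
    (h : ∀ (ψ : C → (Fin n → Prop) × Prop), Measurable ψ →
      ∀ (t : Fin n → (Fin n → Prop) × Prop) s,
      μ ((univ.pi fun i => ψ ⁻¹' {t i}) ×ˢ (ψ ⁻¹' {s})) =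
        ν ((univ.pi fun i => ψ ⁻¹' {t i}) ×ˢ (ψ ⁻¹' {s}))) : μ = ν := by
  classical
  have hpi : MeasurableSpace.generateFrom
      (image2 (· ×ˢ ·) (univ.pi '' univ.pi fun _ : Fin n => {s : Set C | MeasurableSet s})
        {s : Set C | MeasurableSet s}) = Prod.instMeasurableSpace :=
    generateFrom_eq_prod generateFrom_pi MeasurableSpace.generateFrom_measurableSet
      ⟨fun _ => univ, fun _ => ⟨fun _ => univ, fun _ _ => MeasurableSet.univ, by simp⟩,
        iUnion_const _⟩ isCountablySpanning_measurableSet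
  have hrect : ∀ (S : Fin n → Set C) (A : Set C), (∀ i, MeasurableSet (S i)) → MeasurableSet A →
      μ (univ.pi S ×ˢ A) = ν (univ.pi S ×ˢ A) := by
    intro S A hS hA
    set ψ : C → (Fin n → Prop) × Prop := fun c => (fun i => c ∈ S i, c ∈ A) with hψdef
    have hψ : Measurable ψ := by
      refine Measurable.prodMk (measurable_pi_iff.2 fun i => ?_) ?_
      · exact measurableSet_setOfPred.1 (hS i)
      · exact measurableSet_setOfPred.1 hA
    set Ψ : (Fin n → C) × C → (Fin n → (Fin n → Prop) × Prop) × ((Fin n → Prop) × Prop) :=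
      fun p => (fun i => ψ (p.1 i), ψ p.2)
    have hΨ : Measurable Ψ := by fun_prop
    have hmap : μ.map Ψ = ν.map Ψ := by
      refine Measure.ext_of_singleton fun ⟨t, s⟩ => ?_
      rw [Measure.map_apply hΨ (measurableSet_singleton _),
        Measure.map_apply hΨ (measurableSet_singleton _)]
      have : Ψ ⁻¹' {(t, s)} = (univ.pi fun i => ψ ⁻¹' {t i}) ×ˢ (ψ ⁻¹' {s}) := by
        ext p
        simp [Ψ, Prod.ext_iff, funext_iff]
      rw [this]
      exact h ψ hψ t s
    set W : Set ((Fin n → (Fin n → Prop) × Prop) × ((Fin n → Prop) × Prop)) :=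
      {p | (∀ i, (p.1 i).1 i) ∧ p.2.2}
    have hW : univ.pi S ×ˢ A = Ψ ⁻¹' W := by
      ext p
      simp [Ψ, ψ, W]
    rw [hW, ← Measure.map_apply hΨ (Set.toFinite W).measurableSet,
      ← Measure.map_apply hΨ (Set.toFinite W).measurableSet, hmap]
  refine ext_of_generate_finite _ hpi.symm
    (isPiSystem_pi.prod MeasurableSpace.isPiSystem_measurableSet) ?_ ?_
  · rintro _ ⟨_, ⟨S, hS, rfl⟩, A, hA, rfl⟩
    exact hrect S A (fun i => hS i (mem_univ i)) hA
  · have := hrect (fun _ => univ) univ (fun _ => MeasurableSet.univ) MeasurableSet.univ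
    simpa using this

/-- Blackwell and MacQueen's Pólya urn scheme: under a Dirichlet process prior, the conditional law
of the next observation given `c_1, …, c_n` is `(α Q + ∑ δ_{c_i}) / (α + n)`. -/
theorem IsDirichletProcess.lintegral_urn {Q : ProbabilityMeasure C} {α : ℝ} (hα : 0 < α)
    {π : ProbabilityMeasure (ProbabilityMeasure C)} (h : IsDirichletProcess Q α π) {n : ℕ}
    {G : (Fin n → C) × C → ℝ≥0∞} (hG : Measurable G) :
    (ENNReal.ofReal α + n) * ∫⁻ P, ∫⁻ c, ∫⁻ y, G (c, y) ∂(P : Measure C) ∂iidKernel C n P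
        ∂(π : Measure (ProbabilityMeasure C)) =
      ∫⁻ P, ∫⁻ c, ∫⁻ y, G (c, y) ∂urnKernel Q α n c ∂iidKernel C n P
        ∂(π : Measure (ProbabilityMeasure C)) := by
  classical
  set ϖ := (π : Measure (ProbabilityMeasure C))
  set M₁ : Measure ((Fin n → C) × C) :=
    (ENNReal.ofReal α + n) • ((iidKernel C n ×ₖ evalKernel C) ∘ₘ ϖ) with hM₁
  set M₂ : Measure ((Fin n → C) × C) := (iidKernel C n ∘ₘ ϖ) ⊗ₘ urnKernel Q α n with hM₂
  have hfin : IsFiniteMeasure M₁ := Measure.smul_finite _ (by finiteness)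
  have heq : M₁ = M₂ := by
    refine ext_of_fibers fun ψ hψ t s => ?_
    have hms : ∀ s, MeasurableSet (ψ ⁻¹' {s}) := fun s => hψ (measurableSet_singleton s)
    have hmt : MeasurableSet (univ.pi fun i => ψ ⁻¹' {t i}) :=
      MeasurableSet.univ_pi fun i => hms (t i)
    have hiid : ∀ P : ProbabilityMeasure C, iidKernel C n P (univ.pi fun i => ψ ⁻¹' {t i}) =
        ((List.ofFn t).map fun t => (P : Measure C) (ψ ⁻¹' {t})).prod := by
      intro P
      rw [iidKernel_apply, Measure.pi_pi, List.map_ofFn, List.prod_ofFn]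
      rfl
    have hurn := h.lintegral_fibers hα hψ s (List.ofFn t)
    rw [hM₁, hM₂, Measure.smul_apply, Measure.bind_apply (hmt.prod (hms s))
      (Kernel.aemeasurable _), Measure.compProd_apply_prod hmt (hms s), smul_eq_mul]
    have h1 : ∀ P : ProbabilityMeasure C, (iidKernel C n ×ₖ evalKernel C) P
        ((univ.pi fun i => ψ ⁻¹' {t i}) ×ˢ (ψ ⁻¹' {s})) =
        ((s :: List.ofFn t).map fun t => (P : Measure C) (ψ ⁻¹' {t})).prod := by
      intro P
      rw [Kernel.prod_apply_prod, hiid, evalKernel_apply, List.map_cons, List.prod_cons, mul_comm]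
    rw [lintegral_congr h1]
    rw [List.length_ofFn, count_ofFn] at hurn
    rw [hurn]
    have h2 : ∀ c ∈ univ.pi fun i => ψ ⁻¹' {t i}, urnKernel Q α n c (ψ ⁻¹' {s}) =
        ENNReal.ofReal α * (Q : Measure C) (ψ ⁻¹' {s}) +
          (Finset.univ.filter fun i => t i = s).card := by
      intro c hc
      have hc' : ∀ i, ψ (c i) = t i := fun i => hc i (mem_univ i)
      rw [urnKernel_apply, Measure.add_apply, Measure.smul_apply, Measure.finsetSum_apply]
      simp only [Measure.dirac_apply' _ (hms s), indicator, mem_preimage, hc', mem_singleton_iff,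
        Pi.one_apply, smul_eq_mul]
      rw [Finset.sum_boole]
    rw [setLIntegral_congr_fun hmt h2, setLIntegral_const,
      Measure.bind_apply hmt (Kernel.aemeasurable _), lintegral_congr hiid]
  have hl := congrArg (fun M : Measure ((Fin n → C) × C) => ∫⁻ p, G p ∂M) heq
  simp only [hM₁, hM₂] at hl
  rw [lintegral_smul_measure, Measure.lintegral_bind (Kernel.aemeasurable _) hG.aemeasurable,
    Measure.lintegral_compProd hG, Measure.lintegral_bind (Kernel.aemeasurable _)
      hG.lintegral_kernel_prod_right'.aemeasurable] at hl
  simpa only [Kernel.lintegral_prod _ _ _ hG, smul_eq_mul, evalKernel_apply] using hl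

end Urn

/-! ### Moments of masses of sets that depend on the sample -/

section ConditionalMoments

variable {C : Type u} [MeasurableSpace C]

/-- The number of the observations `c_1, …, c_n` that fall into the `c`-dependent set `E`. -/
def hits {n : ℕ} (E : Set ((Fin n → C) × C)) (c : Fin n → C) : ℝ≥0∞ :=
  ∑ i, E.indicator 1 (c, c i)

/-- The product of the `P`-probabilities of `c`-dependent sets, over a list of such sets. -/
def massProd {n : ℕ} {τ : Type*} (E : τ → Set ((Fin n → C) × C)) (L : List τ)
    (P : ProbabilityMeasure C) (c : Fin n → C) : ℝ≥0∞ :=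
  (L.map fun t => (P : Measure C) (Prod.mk c ⁻¹' E t)).prod

lemma measurable_massProd {n : ℕ} {τ : Type*} {E : τ → Set ((Fin n → C) × C)}
    (hE : ∀ t, MeasurableSet (E t)) (L : List τ) (P : ProbabilityMeasure C) :
    Measurable (massProd E L P) := by
  induction L with
  | nil => exact measurable_const
  | cons t L ih =>
    exact (measurable_measure_prodMk_left (hE t)).mul ih

lemma measurable_hits {n : ℕ} {E : Set ((Fin n → C) × C)} (hE : MeasurableSet E) :
    Measurable (hits E) :=
  Finset.measurable_sum _ fun i _ => (measurable_one.indicator hE).comp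
    (measurable_id.prodMk (measurable_pi_apply i))

/-- A factor `P (E c)` is the probability that one further observation falls into `E c`. -/
lemma lintegral_mul_mass_eq {n : ℕ} (P : ProbabilityMeasure C) {E : Set ((Fin n → C) × C)}
    (hE : MeasurableSet E) {g : (Fin (n + 1) → C) → ℝ≥0∞} (hg : Measurable g)
    {g' : (Fin n → C) → ℝ≥0∞}
    (hgg' : ∀ c y, (c, y) ∈ E → g (Fin.cons y c) = g' c) :
    ∫⁻ c, g' c * (P : Measure C) (Prod.mk c ⁻¹' E) ∂iidKernel C n P =
      ∫⁻ c, E.indicator 1 (Fin.tail c, c 0) * g c ∂iidKernel C (n + 1) P := by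
  have hmeas : Measurable fun c : Fin (n + 1) → C =>
      E.indicator (1 : (Fin n → C) × C → ℝ≥0∞) (Fin.tail c, c 0) :=
    (measurable_one.indicator hE).comp ((measurable_pi_iff.2 fun i =>
      measurable_pi_apply _).prodMk (measurable_pi_apply 0))
  rw [iidKernel_apply, iidKernel_apply, lintegral_pi_insertNth _ 0
    (f := fun c => E.indicator 1 (Fin.tail c, c 0) * g c) (hmeas.mul hg)]
  refine lintegral_congr fun c => ?_
  have h : ∀ y : C, E.indicator (1 : (Fin n → C) × C → ℝ≥0∞)
      (Fin.tail ((0 : Fin (n + 1)).insertNth (α := fun _ => C) y c),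
        (0 : Fin (n + 1)).insertNth (α := fun _ => C) y c 0) *
      g ((0 : Fin (n + 1)).insertNth (α := fun _ => C) y c) =
      g' c * (Prod.mk c ⁻¹' E).indicator 1 y := by
    intro y
    rw [Fin.insertNth_zero']
    simp only [Fin.tail_cons, Fin.cons_zero]
    by_cases hy : (c, y) ∈ E
    · rw [hgg' c y hy, indicator_of_mem hy, indicator_of_mem (show y ∈ Prod.mk c ⁻¹' E from hy)]
      simp
    · rw [indicator_of_notMem hy, indicator_of_notMem (show y ∉ Prod.mk c ⁻¹' E from hy)]
      simp
  rw [lintegral_congr h, lintegral_const_mul _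
    (measurable_one.indicator (measurable_prodMk_left hE)),
    lintegral_indicator_one (measurable_prodMk_left hE)]

/-- One step of the Pólya urn, under the size biasing by a product of probabilities of pairwise
disjoint sets, which may depend on the observations. -/
lemma IsDirichletProcess.lintegral_mass_mul_massProd {Q : ProbabilityMeasure C} {α : ℝ}
    (hα : 0 < α) {π : ProbabilityMeasure (ProbabilityMeasure C)} (h : IsDirichletProcess Q α π)
    {τ : Type*} [DecidableEq τ] (L : List τ) {n : ℕ} {E : τ → Set ((Fin n → C) × C)}
    (hE : ∀ t, MeasurableSet (E t)) {f : (Fin n → C) → ℝ≥0∞} (hf : Measurable f)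
    (hdisj : ∀ c, f c ≠ 0 → Pairwise fun t t' => Disjoint (Prod.mk c ⁻¹' E t) (Prod.mk c ⁻¹' E t'))
    (s : τ) :
    (ENNReal.ofReal α + n + L.length) * ∫⁻ P, ∫⁻ c, f c * massProd E L P c *
        (P : Measure C) (Prod.mk c ⁻¹' E s) ∂iidKernel C n P ∂(π : Measure (ProbabilityMeasure C)) =
      ∫⁻ P, ∫⁻ c, f c * massProd E L P c *
        (ENNReal.ofReal α * (Q : Measure C) (Prod.mk c ⁻¹' E s) + hits (E s) c + L.count s)
          ∂iidKernel C n P ∂(π : Measure (ProbabilityMeasure C)) := by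
  induction L generalizing n with
  | nil =>
    have hG : Measurable fun p : (Fin n → C) × C => f p.1 * (E s).indicator 1 p :=
      (hf.comp measurable_fst).mul (measurable_one.indicator (hE s))
    have key := h.lintegral_urn hα hG
    have h1 : ∀ (μ : Measure C) (c : Fin n → C), ∫⁻ y, f c * (E s).indicator 1 (c, y) ∂μ =
        f c * μ (Prod.mk c ⁻¹' E s) := by
      intro μ c
      rw [lintegral_const_mul (f := fun y => (E s).indicator 1 (c, y)) _
        ((measurable_one.indicator (hE s)).comp measurable_prodMk_left)]
      congr 1
      exact lintegral_indicator_one (measurable_prodMk_left (hE s))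
    simp only [h1] at key
    simp only [massProd, List.map_nil, List.prod_nil, mul_one, List.length_nil, Nat.cast_zero,
      add_zero, List.count_nil]
    rw [key]
    refine lintegral_congr fun P => lintegral_congr fun c => ?_
    congr 1
    rw [urnKernel_apply, Measure.add_apply, Measure.smul_apply, Measure.finsetSum_apply, hits]
    simp only [Measure.dirac_apply' _ (measurable_prodMk_left (hE s)), smul_eq_mul]
    rfl
  | cons t L ih =>
    have htail : Measurable (Fin.tail : (Fin (n + 1) → C) → Fin n → C) :=
      measurable_pi_iff.2 fun i => measurable_pi_apply _
    set E' : τ → Set ((Fin (n + 1) → C) × C) :=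
      fun t => (fun p => (Fin.tail p.1, p.2)) ⁻¹' E t with hE'def
    have hE' : ∀ t, MeasurableSet (E' t) := fun t =>
      (htail.comp measurable_fst |>.prodMk measurable_snd) (hE t)
    set f' : (Fin (n + 1) → C) → ℝ≥0∞ :=
      fun c => (E t).indicator 1 (Fin.tail c, c 0) * f (Fin.tail c) with hf'def
    have hf' : Measurable f' := ((measurable_one.indicator (hE t)).comp
      (htail.prodMk (measurable_pi_apply 0))).mul (hf.comp htail)
    have hdisj' : ∀ c, f' c ≠ 0 →
        Pairwise fun t t' => Disjoint (Prod.mk c ⁻¹' E' t) (Prod.mk c ⁻¹' E' t') :=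
      fun c hc => hdisj (Fin.tail c) (right_ne_zero_of_mul hc)
    have key := ih hE' hf' hdisj'
    have hmass : ∀ P c, massProd E' L P c = massProd E L P (Fin.tail c) := fun P c => rfl
    have habs : ∀ (P : ProbabilityMeasure C) {g : (Fin (n + 1) → C) → ℝ≥0∞}
        {g' : (Fin n → C) → ℝ≥0∞}, Measurable g →
        (∀ c y, f c ≠ 0 → (c, y) ∈ E t → g (Fin.cons y c) = g' c) →
        ∫⁻ c, f c * massProd E (t :: L) P c * g' c ∂iidKernel C n P =
          ∫⁻ c, f' c * massProd E' L P c * g c ∂iidKernel C (n + 1) P := by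
      intro P g g' hg hgg'
      have h1 : ∀ c, f c * massProd E (t :: L) P c * g' c =
          f c * massProd E L P c * g' c * (P : Measure C) (Prod.mk c ⁻¹' E t) := by
        intro c
        rw [massProd, massProd, List.map_cons, List.prod_cons]
        ring
      rw [lintegral_congr h1, lintegral_mul_mass_eq P (hE t)
        (g := fun c => f (Fin.tail c) * massProd E L P (Fin.tail c) * g c)
        (((hf.comp htail).mul ((measurable_massProd hE L P).comp htail)).mul hg)]
      · refine lintegral_congr fun c => ?_
        rw [hmass]
        simp only [hf'def]
        ring
      · intro c y hcy
        simp only [Fin.tail_cons]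
        rcases eq_or_ne (f c) 0 with h0 | h0
        · simp [h0]
        · rw [hgg' c y h0 hcy]
    have hlhs : ∀ P : ProbabilityMeasure C, ∫⁻ c, f c * massProd E (t :: L) P c *
        (P : Measure C) (Prod.mk c ⁻¹' E s) ∂iidKernel C n P =
        ∫⁻ c, f' c * massProd E' L P c *
          (P : Measure C) (Prod.mk c ⁻¹' E' s) ∂iidKernel C (n + 1) P :=
      fun P => habs P (measurable_measure_prodMk_left (hE' s)) fun c y _ _ => rfl
    have hrhs : ∀ P : ProbabilityMeasure C, ∫⁻ c, f c * massProd E (t :: L) P c *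
        (ENNReal.ofReal α * (Q : Measure C) (Prod.mk c ⁻¹' E s) + hits (E s) c +
          (t :: L).count s) ∂iidKernel C n P =
        ∫⁻ c, f' c * massProd E' L P c *
          (ENNReal.ofReal α * (Q : Measure C) (Prod.mk c ⁻¹' E' s) + hits (E' s) c + L.count s)
          ∂iidKernel C (n + 1) P := by
      refine fun P => habs P (((measurable_measure_prodMk_left (hE' s)).const_mul _).add
        (measurable_hits (hE' s)) |>.add_const _) fun c y hc hcy => ?_
      -- the new observation lies in `E t c`, so that it is counted by `E s c` only if `s = t`
      have hh : hits (E' s) (Fin.cons y c : Fin (n + 1) → C) =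
          (if t = s then 1 else 0) + hits (E s) c := by
        simp only [hits, Fin.sum_univ_succ, Fin.cons_zero, Fin.cons_succ]
        congr 1
        have hmem : ((Fin.cons y c : Fin (n + 1) → C), y) ∈ E' s ↔ (c, y) ∈ E s := by
          simp [hE'def]
        by_cases hts : t = s
        · rw [if_pos hts, indicator_of_mem (hmem.2 (hts ▸ hcy)), Pi.one_apply]
        · rw [if_neg hts, indicator_of_notMem]
          exact fun hs => Set.disjoint_left.1 (hdisj c hc hts) hcy (hmem.1 hs)
      have hQ : Prod.mk (Fin.cons y c : Fin (n + 1) → C) ⁻¹' E' s = Prod.mk c ⁻¹' E s := by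
        ext z
        simp [hE'def]
      rw [hh, hQ, List.count_cons]
      simp only [beq_iff_eq]
      push_cast
      ring
    rw [lintegral_congr hlhs, lintegral_congr hrhs, ← key, List.length_cons]
    push_cast
    ring

/-- The conditional moment, given `c_1, …, c_n`, of the product of the probabilities of the sets
`E_t c` over a list of indices. -/
def urnMoment {n : ℕ} {τ : Type*} [DecidableEq τ] (Q : ProbabilityMeasure C) (α : ℝ)
    (E : τ → Set ((Fin n → C) × C)) : List τ → (Fin n → C) → ℝ≥0∞
  | [], _ => 1
  | s :: L, c => (ENNReal.ofReal α * (Q : Measure C) (Prod.mk c ⁻¹' E s) + hits (E s) c +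
      L.count s) / (ENNReal.ofReal α + n + L.length) * urnMoment Q α E L c

lemma IsDirichletProcess.lintegral_massProd {Q : ProbabilityMeasure C} {α : ℝ}
    (hα : 0 < α) {π : ProbabilityMeasure (ProbabilityMeasure C)} (h : IsDirichletProcess Q α π)
    {τ : Type*} [DecidableEq τ] (L : List τ) {n : ℕ} {E : τ → Set ((Fin n → C) × C)}
    (hE : ∀ t, MeasurableSet (E t)) {f : (Fin n → C) → ℝ≥0∞} (hf : Measurable f)
    (hdisj : ∀ c, f c ≠ 0 →
      Pairwise fun t t' => Disjoint (Prod.mk c ⁻¹' E t) (Prod.mk c ⁻¹' E t')) :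
    ∫⁻ P, ∫⁻ c, f c * massProd E L P c ∂iidKernel C n P ∂(π : Measure (ProbabilityMeasure C)) =
      ∫⁻ P, ∫⁻ c, f c * urnMoment Q α E L c ∂iidKernel C n P
        ∂(π : Measure (ProbabilityMeasure C)) := by
  induction L generalizing f with
  | nil => rfl
  | cons s L ih =>
    set a := ENNReal.ofReal α + n + L.length with ha
    have ha0 : a ≠ 0 := by
      have : ENNReal.ofReal α ≠ 0 := by simpa using hα
      simp [ha, this]
    have hat : a ≠ ⊤ := by finiteness
    set k : (Fin n → C) → ℝ≥0∞ := fun c =>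
      ENNReal.ofReal α * (Q : Measure C) (Prod.mk c ⁻¹' E s) + hits (E s) c + L.count s
    have hk : Measurable k := (((measurable_measure_prodMk_left (hE s)).const_mul _).add
      (measurable_hits (hE s))).add_const _
    have step := h.lintegral_mass_mul_massProd hα L hE hf hdisj s
    have h1 : ∀ P : ProbabilityMeasure C, ∫⁻ c, f c * massProd E (s :: L) P c ∂iidKernel C n P =
        ∫⁻ c, f c * massProd E L P c * (P : Measure C) (Prod.mk c ⁻¹' E s) ∂iidKernel C n P := by
      refine fun P => lintegral_congr fun c => ?_
      rw [massProd, massProd, List.map_cons, List.prod_cons]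
      ring
    have h2 : ∀ P : ProbabilityMeasure C, ∫⁻ c, f c * massProd E L P c * k c ∂iidKernel C n P =
        a * ∫⁻ c, f c * (k c / a) * massProd E L P c ∂iidKernel C n P := by
      intro P
      rw [← lintegral_const_mul (f := fun c => f c * (k c / a) * massProd E L P c) _
        ((hf.mul (hk.div_const _)).mul (measurable_massProd hE L P))]
      refine lintegral_congr fun c => ?_
      rw [mul_comm (f c) (k c / a), ← mul_assoc, ← mul_assoc, ENNReal.mul_div_cancel ha0 hat]
      ring
    rw [lintegral_congr h1, ← ENNReal.mul_right_inj ha0 hat, step, lintegral_congr h2,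
      lintegral_const_mul' _ _ hat, ih (f := fun c => f c * (k c / a)) (hf.mul (hk.div_const _))
        fun c hc => hdisj c (left_ne_zero_of_mul hc)]
    congr 1
    refine lintegral_congr fun P => lintegral_congr fun c => ?_
    rw [urnMoment, mul_assoc]

end ConditionalMoments

/-! ### Conditional laws and a link function that reveals the latent values -/

section Disintegration

lemma ext_of_lintegral_moments {R : ℕ} {μ ν : Measure (Fin R → ℝ)} [IsFiniteMeasure μ]
    [IsFiniteMeasure ν] (hμ : ∀ᵐ w ∂μ, w ∈ cube (Fin R)) (hν : ∀ᵐ w ∂ν, w ∈ cube (Fin R))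
    (h : ∀ L : List (Fin R),
      ∫⁻ w, ENNReal.ofReal (mono L w) ∂μ = ∫⁻ w, ENNReal.ofReal (mono L w) ∂ν) : μ = ν := by
  refine ext_of_moments hμ hν fun L => ?_
  rw [integral_eq_lintegral_of_nonneg_ae (hμ.mono fun w hw => (mono_mem_Icc hw L).1)
      (continuous_mono L).aestronglyMeasurable, h L,
    integral_eq_lintegral_of_nonneg_ae (hν.mono fun w hw => (mono_mem_Icc hw L).1)
      (continuous_mono L).aestronglyMeasurable]

lemma measurableSet_cube (R : ℕ) : MeasurableSet (cube (Fin R)) :=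
  MeasurableSet.univ_pi fun _ => measurableSet_Icc

/-- A conditional law on the cube is identified by its moments. -/
lemma condDistrib_ae_eq_of_moments {Ω D : Type*} [MeasurableSpace Ω] [MeasurableSpace D] {R : ℕ}
    {J : Measure Ω} [IsFiniteMeasure J] {X : Ω → D} (hX : Measurable X) {V : Ω → Fin R → ℝ}
    (hV : Measurable V) (hVc : ∀ᵐ ω ∂J, V ω ∈ cube (Fin R)) {κ : Kernel D (Fin R → ℝ)}
    [IsMarkovKernel κ] (hκ : ∀ x, ∀ᵐ w ∂κ x, w ∈ cube (Fin R))
    (h : ∀ S, MeasurableSet S → ∀ L : List (Fin R),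
      ∫⁻ ω in X ⁻¹' S, ENNReal.ofReal (mono L (V ω)) ∂J =
        ∫⁻ ω in X ⁻¹' S, ∫⁻ w, ENNReal.ofReal (mono L w) ∂κ (X ω) ∂J) :
    condDistrib V X J =ᵐ[J.map X] κ := by
  refine condDistrib_ae_eq_of_measure_eq_compProd X hV.aemeasurable ?_
  refine Measure.ext_prod fun {S T} hS hT => ?_
  have hmono : ∀ L : List (Fin R), Measurable fun w => ENNReal.ofReal (mono L w) :=
    fun L => (continuous_mono L).measurable.ennreal_ofReal
  have key : (J.restrict (X ⁻¹' S)).map V = κ ∘ₘ ((J.map X).restrict S) := by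
    refine ext_of_lintegral_moments ?_ ?_ fun L => ?_
    · exact (ae_map_iff hV.aemeasurable (p := fun w => w ∈ cube (Fin R))
        (measurableSet_cube R)).2 (ae_restrict_of_ae hVc)
    · exact Measure.ae_comp_of_ae_ae (measurableSet_cube R) (ae_of_all _ hκ)
    · rw [lintegral_map (hmono L) hV, h S hS L,
        Measure.lintegral_bind (Kernel.aemeasurable _) (hmono L).aemeasurable,
        Measure.restrict_map hX hS, lintegral_map ((hmono L).lintegral_kernel) hX]
  have hT' := congrArg (fun m : Measure (Fin R → ℝ) => m T) key
  rw [Measure.map_apply hV hT, Measure.restrict_apply (hV hT),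
    Measure.bind_apply hT (Kernel.aemeasurable _)] at hT'
  rw [Measure.map_apply (hX.prodMk hV) (hS.prod hT), Measure.compProd_apply_prod hS hT, ← hT']
  congr 1
  ext ω
  simp [and_comm]

end Disintegration

section CoordinateLink

variable {C : Type u} {X : Type v} [MeasurableSpace C] [MeasurableSpace X]

/-- The deterministic link function `h(c, c') = e(c)`, as a prior. -/
def coordLink (e : C → X) (he : Measurable e) : LinkPrior.{u, v, w} C X where
  H := PUnit.{w + 1}
  mH := ⊤
  law := ⟨Measure.dirac PUnit.unit, inferInstance⟩
  h _ c _ := e c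
  measurable_h := he.comp (measurable_fst.comp measurable_snd)

variable {e : C → X} (he : Measurable e)

lemma jointLaw_univ (η : LinkPrior.{u, v, w} C X) (π : ProbabilityMeasure (ProbabilityMeasure C))
    (n : ℕ) : jointLaw Set.univ η π n = (η.law : Measure η.H).prod
      ((π : Measure (ProbabilityMeasure C)) ⊗ₘ iidKernel C n) := by
  have : allDefined Set.univ η n = Set.univ := by ext; simp [allDefined]
  rw [jointLaw, this, cond_univ]

lemma lintegral_jointLaw_coordLink (π : ProbabilityMeasure (ProbabilityMeasure C)) (n : ℕ)
    {F : Sample (coordLink.{u, v, w} e he) n → ℝ≥0∞} (hF : Measurable F) :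
    ∫⁻ ω, F ω ∂jointLaw Set.univ (coordLink.{u, v, w} e he) π n =
      ∫⁻ P, ∫⁻ c, F (PUnit.unit, P, c) ∂iidKernel C n P
        ∂(π : Measure (ProbabilityMeasure C)) := by
  rw [jointLaw_univ, lintegral_prod _ hF.aemeasurable]
  refine (lintegral_dirac' (PUnit.unit : (coordLink.{u, v, w} e he).H)
    (Measurable.lintegral_prod_right' hF)).trans ?_
  exact Measure.lintegral_compProd (hF.comp measurable_prodMk_left)

lemma pairLaw_coordLink (P : ProbabilityMeasure C) :
    pairLaw Set.univ ((coordLink.{u, v, w} e he).h PUnit.unit) P = (P : Measure C).map e := by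
  have h : ((P : Measure C).prod (P : Measure C)).map Prod.fst = (P : Measure C) := by
    rw [← Measure.fst, Measure.fst_prod]
  rw [pairLaw, cond_univ]
  nth_rewrite 3 [← h]
  rw [Measure.map_map he measurable_fst]
  rfl

/-- The vector `(P_{X_ij}(B_1), …, P_{X_ij}(B_R))` under the link `h(c, c') = e(c)`. -/
lemma pairLaw_coordLink_real {R : ℕ} {B : Fin R → Set X} (hB : ∀ r, MeasurableSet (B r))
    (ω : PUnit.{w + 1}) (P : ProbabilityMeasure C) :
    (fun r => (pairLaw Set.univ ((coordLink.{u, v, w} e he).h ω) P).real (B r)) =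
      evalVec (fun r => e ⁻¹' B r) P := by
  ext r
  rw [pairLaw_coordLink he P, evalVec, map_measureReal_apply he (hB r)]

lemma IsPartition.preimage (he : Measurable e) {R : ℕ} {B : Fin R → Set X} (hB : IsPartition B) :
    IsPartition fun r => e ⁻¹' B r where
  measurable r := he (hB.measurable r)
  disjoint r s hrs := (hB.disjoint hrs).preimage e
  cover := by rw [← preimage_iUnion, hB.cover, preimage_univ]

lemma measurable_observe (η : LinkPrior.{u, v, w} C X) (n : ℕ) : Measurable (observe η n) := by
  refine measurable_pi_iff.2 fun p => ?_
  have h : ∀ k : Fin n, Measurable fun ω : Sample η n => ω.2.2 k :=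
    fun k => (measurable_pi_apply k).comp (measurable_snd.comp measurable_snd)
  exact η.measurable_h.comp (measurable_fst.prodMk ((h p.1.1).prodMk (h p.1.2)))

instance isFiniteMeasure_jointLaw (D : Set (C × C)) (η : LinkPrior.{u, v, w} C X)
    (π : ProbabilityMeasure (ProbabilityMeasure C)) (n : ℕ) :
    IsFiniteMeasure (jointLaw D η π n) := by unfold jointLaw; infer_instance

lemma posterior_coordLink (π : ProbabilityMeasure (ProbabilityMeasure C)) (n : ℕ) {R : ℕ}
    {B : Fin R → Set X} (hB : ∀ r, MeasurableSet (B r)) (x : Data n X) :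
    posterior Set.univ (coordLink.{u, v, w} e he) π n B x =
      condDistrib
        (fun ω : Sample (coordLink.{u, v, w} e he) n => evalVec (fun r => e ⁻¹' B r) ω.2.1)
        (observe (coordLink.{u, v, w} e he) n)
        (jointLaw Set.univ (coordLink.{u, v, w} e he) π n) x := by
  rw [posterior]
  congr 2
  ext1 ω
  exact pairLaw_coordLink_real he hB ω.1 ω.2.1

end CoordinateLink

/-! ### The posterior under a Dirichlet process -/

section CoordinateLink

variable {C : Type u} {X : Type v} [MeasurableSpace C] [MeasurableSpace X]

lemma lintegral_mono_cons_dirichletLaw {R : ℕ} {a : Fin R → ℝ} (ha : ∀ r, 0 ≤ a r)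
    (hs : 0 < ∑ r, a r) (s : Fin R) (L : List (Fin R)) :
    (ENNReal.ofReal (∑ r, a r) + L.length) *
        ∫⁻ w, ENNReal.ofReal (mono (s :: L) w) ∂dirichletLaw a =
      (ENNReal.ofReal (a s) + L.count s) * ∫⁻ w, ENNReal.ofReal (mono L w) ∂dirichletLaw a := by
  have := isProbabilityMeasure_dirichletLaw ha
  have hc := ae_dirichletLaw_mem_cube ha hs
  have h : ∀ L : List (Fin R), ∫⁻ w, ENNReal.ofReal (mono L w) ∂dirichletLaw a =
      ENNReal.ofReal (∫ w, mono L w ∂dirichletLaw a) := fun L =>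
    (ofReal_integral_eq_lintegral_ofReal (integrable_of_cube hc (continuous_mono L))
      (hc.mono fun w hw => (mono_mem_Icc hw L).1)).symm
  rw [h, h, ← ENNReal.ofReal_natCast, ← ENNReal.ofReal_natCast,
    ← ENNReal.ofReal_add hs.le (by positivity), ← ENNReal.ofReal_add (ha s) (by positivity),
    ← ENNReal.ofReal_mul (by positivity),
    ← ENNReal.ofReal_mul (add_nonneg (ha s) (Nat.cast_nonneg _)),
    integral_mono_cons_dirichletLaw ha hs]

/-- The array of the membership indicators of the observations in the cells of a partition. -/
def indicators {n R : ℕ} (B : Fin R → Set X) (x : Data n X) :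
    {p : Fin n × Fin n // p.1 ≠ p.2} → Fin R → Prop := fun p r => x p ∈ B r

lemma measurable_indicators {n R : ℕ} {B : Fin R → Set X} (hB : ∀ r, MeasurableSet (B r)) :
    Measurable (indicators (n := n) B) :=
  measurable_pi_iff.2 fun p => measurable_pi_iff.2 fun r =>
    (measurableSet_setOfPred.1 (hB r)).comp (measurable_pi_apply p)

/-- The array observed under the link `h(c, c') = e(c)`. -/
def coordArray (e : C → X) (n : ℕ) (c : Fin n → C) : Data n X := fun p => e (c p.1.1)

lemma measurable_coordArray {e : C → X} (he : Measurable e) (n : ℕ) :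
    Measurable (coordArray e n) :=
  measurable_pi_iff.2 fun _ => he.comp (measurable_pi_apply _)

/-- With at least two units, every unit is the first one of some pair. -/
lemma exists_pair {n : ℕ} (hn : 2 ≤ n) :
    ∃ σ : Fin n → {p : Fin n × Fin n // p.1 ≠ p.2}, ∀ k, (σ k).1.1 = k := by
  have : Nontrivial (Fin n) := Fin.nontrivial_iff_two_le.2 hn
  choose l hl using fun k : Fin n => exists_ne k
  exact ⟨fun k => ⟨(k, l k), (hl k).symm⟩, fun _ => rfl⟩

lemma lintegral_observe_coordLink {e : C → X} (he : Measurable e)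
    (π : ProbabilityMeasure (ProbabilityMeasure C)) (n : ℕ) {S : Set (Data n X)}
    (hS : MeasurableSet S) {F : ProbabilityMeasure C → (Fin n → C) → ℝ≥0∞}
    (hF : Measurable (Function.uncurry F)) :
    ∫⁻ ω in observe (coordLink.{u, v, w} e he) n ⁻¹' S, F ω.2.1 ω.2.2
        ∂jointLaw Set.univ (coordLink.{u, v, w} e he) π n =
      ∫⁻ P, ∫⁻ c, (coordArray e n ⁻¹' S).indicator 1 c * F P c ∂iidKernel C n P
        ∂(π : Measure (ProbabilityMeasure C)) := by
  have hS' := measurable_observe (coordLink.{u, v, w} e he) n hS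
  have hF' : Measurable fun ω : Sample (coordLink.{u, v, w} e he) n => F ω.2.1 ω.2.2 :=
    hF.comp measurable_snd
  rw [← lintegral_indicator hS', lintegral_jointLaw_coordLink he π n (hF'.indicator hS')]
  refine lintegral_congr fun P => lintegral_congr fun c => ?_
  by_cases hc : c ∈ coordArray e n ⁻¹' S
  · rw [indicator_of_mem hc, indicator_of_mem (show ((PUnit.unit, P, c) :
      Sample (coordLink.{u, v, w} e he) n) ∈ observe (coordLink.{u, v, w} e he) n ⁻¹' S from hc)]
    simp
  · rw [indicator_of_notMem hc, indicator_of_notMem (show ((PUnit.unit, P, c) :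
      Sample (coordLink.{u, v, w} e he) n) ∉ observe (coordLink.{u, v, w} e he) n ⁻¹' S from hc)]
    simp

/-- Dirichlet process priors do not smooth across events under the link `h(c, c') = e(c)`: the
posterior of `(P(A_1), …, P(A_R))` is the Dirichlet law whose parameters are updated by the cell
counts. -/
lemma IsDirichletProcess.doesNotSmooth {Q : ProbabilityMeasure C} {α : ℝ} (hα : 0 < α)
    {π : ProbabilityMeasure (ProbabilityMeasure C)} (h : IsDirichletProcess Q α π)
    {e : C → X} (he : Measurable e) {n : ℕ} (hn : 2 ≤ n) :
    DoesNotSmooth (dataLaw Set.univ (coordLink.{u, v, w} e he) π n)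
      (posterior Set.univ (coordLink.{u, v, w} e he) π n) := by
  classical
  intro R B hB
  obtain ⟨σ, hσ⟩ := exists_pair hn
  set A : Fin R → Set C := fun r => e ⁻¹' B r with hA
  have hAp : IsPartition A := hB.preimage he
  set N : ({p : Fin n × Fin n // p.1 ≠ p.2} → Fin R → Prop) → Fin R → ℝ :=
    fun τ r => ∑ k, if τ (σ k) r then 1 else 0 with hN
  have hN0 : ∀ τ r, 0 ≤ N τ r := fun τ r => Finset.sum_nonneg fun k _ => by split_ifs <;> simp
  set a : ({p : Fin n × Fin n // p.1 ≠ p.2} → Fin R → Prop) → Fin R → ℝ :=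
    fun τ r => α * evalVec A Q r + N τ r with ha
  have ha0 : ∀ τ r, 0 ≤ a τ r := fun τ r =>
    add_nonneg (mul_nonneg hα.le measureReal_nonneg) (hN0 τ r)
  have hasum : ∀ τ, ∑ r, a τ r = α + ∑ r, N τ r := fun τ => by
    rw [Finset.sum_add_distrib, ← Finset.mul_sum, hAp.sum_evalVec, mul_one]
  have has : ∀ τ, 0 < ∑ r, a τ r := fun τ => by
    rw [hasum]
    exact add_pos_of_pos_of_nonneg hα (Finset.sum_nonneg fun r _ => hN0 τ r)
  set G : Kernel ({p : Fin n × Fin n // p.1 ≠ p.2} → Fin R → Prop) (Fin R → ℝ) :=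
    ⟨fun τ => dirichletLaw (a τ), measurable_of_finite _⟩ with hG
  have : IsMarkovKernel G := ⟨fun τ => isProbabilityMeasure_dirichletLaw (ha0 τ)⟩
  set κ : Kernel (Data n X) (Fin R → ℝ) :=
    G.comap (indicators B) (measurable_indicators hB.measurable) with hκ
  refine ⟨fun τ => G τ, ?_⟩
  simp only [posterior_coordLink he π n hB.measurable]
  refine condDistrib_ae_eq_of_moments (κ := κ) (measurable_observe _ n)
    ((measurable_evalVec hAp.measurable).comp (measurable_fst.comp measurable_snd))
    (ae_of_all _ fun ω => evalVec_mem_cube _ _)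
    (fun x => ae_dirichletLaw_mem_cube (ha0 _) (has _)) fun S hS L => ?_
  have hmono : Measurable fun w : Fin R → ℝ => ENNReal.ofReal (mono L w) :=
    (continuous_mono L).measurable.ennreal_ofReal
  have hl := lintegral_observe_coordLink.{u, v, w} he π n hS
    (F := fun P _ => ENNReal.ofReal (mono L (evalVec A P)))
    (hmono.comp ((measurable_evalVec hAp.measurable).comp measurable_fst))
  have hr := lintegral_observe_coordLink.{u, v, w} he π n hS
    (F := fun _ c => ∫⁻ w, ENNReal.ofReal (mono L w) ∂κ (coordArray e n c))
    ((hmono.lintegral_kernel (κ := κ)).comp ((measurable_coordArray he n).comp measurable_snd))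
  refine hl.trans (Eq.trans ?_ hr.symm)
  -- the sets whose probabilities are estimated do not depend on the observations
  set E : Fin R → Set ((Fin n → C) × C) := fun r => Prod.snd ⁻¹' A r with hE
  have hEm : ∀ r, MeasurableSet (E r) := fun r => measurable_snd (hAp.measurable r)
  have hf : Measurable ((coordArray e n ⁻¹' S).indicator (1 : (Fin n → C) → ℝ≥0∞)) :=
    measurable_one.indicator (measurable_coordArray he n hS)
  have hmass : ∀ P c, ENNReal.ofReal (mono L (evalVec A P)) = massProd E L P c := by
    intro P c
    have := prod_measure_eq_ofReal_mono (Equiv.refl (Fin R)) A P L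
    simp only [Equiv.coe_refl, List.map_id_fun, id_eq, Equiv.refl_symm] at this
    exact this.symm
  have hurn : ∀ L c, ∫⁻ w, ENNReal.ofReal (mono L w) ∂κ (coordArray e n c) =
      urnMoment Q α E L c := by
    intro L c
    set τ := indicators B (coordArray e n c) with hτ
    change ∫⁻ w, ENNReal.ofReal (mono L w) ∂dirichletLaw (a τ) = _
    have hprob := isProbabilityMeasure_dirichletLaw (ha0 τ)
    have hmem : ∀ k r, τ (σ k) r ↔ c k ∈ A r := fun k r => by
      simp only [hτ, indicators, coordArray, hσ, hA]; rfl
    have hNsum : ∑ r, N τ r = n := by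
      simp only [hN, hmem]
      rw [Finset.sum_comm]
      have : ∀ k, ∑ r, (if c k ∈ A r then (1 : ℝ) else 0) = 1 := by
        intro k
        obtain ⟨r, hr⟩ := mem_iUnion.1 (hAp.cover.symm ▸ mem_univ (c k) : c k ∈ ⋃ r, A r)
        rw [Finset.sum_eq_single r]
        · simp [hr]
        · intro s _ hs
          rw [if_neg fun h => Set.disjoint_left.1 (hAp.disjoint hs) h hr]
        · simp
      simp [this]
    have hhits : ∀ r, hits (E r) c = ENNReal.ofReal (N τ r) := by
      intro r
      simp only [hits, hN]
      rw [ENNReal.ofReal_sum_of_nonneg fun k _ => by split_ifs <;> simp]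
      refine Finset.sum_congr rfl fun k _ => ?_
      simp only [indicator_apply, hmem, hE, mem_preimage]
      split_ifs <;> simp
    have hupd : ∀ r, ENNReal.ofReal (a τ r) =
        ENNReal.ofReal α * (Q : Measure C) (Prod.mk c ⁻¹' E r) + hits (E r) c := by
      intro r
      have hQ : ENNReal.ofReal (evalVec A Q r) = (Q : Measure C) (Prod.mk c ⁻¹' E r) :=
        ENNReal.ofReal_toReal (measure_ne_top _ _)
      have hq : 0 ≤ α * evalVec A Q r := mul_nonneg hα.le measureReal_nonneg
      rw [hhits, ← hQ, ← ENNReal.ofReal_mul hα.le, ← ENNReal.ofReal_add hq (hN0 τ r)]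
    clear hmono hl hr hmass
    induction L with
    | nil => simp [urnMoment]
    | cons s L ih =>
      have hrec := lintegral_mono_cons_dirichletLaw (ha0 τ) (has τ) s L
      rw [hasum, hNsum, ENNReal.ofReal_add hα.le (Nat.cast_nonneg _), ENNReal.ofReal_natCast,
        hupd, ih] at hrec
      have hd0 : ENNReal.ofReal α + n + L.length ≠ 0 := by
        have : ENNReal.ofReal α ≠ 0 := by simpa using hα
        simp [this]
      have hdt : ENNReal.ofReal α + n + L.length ≠ ⊤ := by finiteness
      rw [urnMoment, ← ENNReal.mul_right_inj hd0 hdt, hrec, ← mul_assoc,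
        ENNReal.mul_div_cancel hd0 hdt]
  have key := h.lintegral_massProd hα L hEm hf fun c _ r s hrs => hAp.disjoint hrs
  simp only [hurn, ← key]
  exact lintegral_congr fun P => lintegral_congr fun c => by rw [hmass P c]

end CoordinateLink

/-! ### The posterior under a trivial process -/

section TrivialProcesses

variable {C : Type u} {X : Type v} [MeasurableSpace C] [MeasurableSpace X]

lemma measurable_pointMass : Measurable (pointMass : C → ProbabilityMeasure C) :=
  Measure.measurable_dirac.subtype_mk

lemma twoPointMix_apply (a b : C) (z : unitInterval) :
    (twoPointMix a b z : Measure C) =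
      ENNReal.ofReal (z : ℝ) • Measure.dirac a + ENNReal.ofReal (1 - (z : ℝ)) • Measure.dirac b :=
  rfl

lemma measurable_twoPointMix (a b : C) : Measurable (twoPointMix a b) := by
  refine Measurable.subtype_mk (Measure.measurable_of_measurable_coe _ fun s hs => ?_)
  simp only [Measure.add_apply, Measure.smul_apply, smul_eq_mul]
  fun_prop

/-- Almost sure statements about `(P_C, C_1, …, C_n)` under the coordinate link. -/
lemma ae_jointLaw_coordLink {e : C → X} (he : Measurable e)
    {π : ProbabilityMeasure (ProbabilityMeasure C)} {n : ℕ}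
    {s : Set (ProbabilityMeasure C × (Fin n → C))} (hs : MeasurableSet s)
    {Y : Type*} [MeasurableSpace Y] {ν : Measure Y} {φ : Y → ProbabilityMeasure C}
    (hφ : Measurable φ) (hπ : (π : Measure (ProbabilityMeasure C)) = ν.map φ)
    (h : ∀ y, ∀ᵐ c ∂iidKernel C n (φ y), (φ y, c) ∈ s) :
    ∀ᵐ ω ∂jointLaw Set.univ (coordLink.{u, v, w} e he) π n, ω.2 ∈ s := by
  have hm : MeasurableSet
      ((fun ω : Sample (coordLink.{u, v, w} e he) n => ω.2) ⁻¹' sᶜ) := measurable_snd hs.compl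
  change jointLaw Set.univ (coordLink.{u, v, w} e he) π n
    ((fun ω : Sample (coordLink.{u, v, w} e he) n => ω.2) ⁻¹' sᶜ) = 0
  rw [← lintegral_indicator_one hm, lintegral_jointLaw_coordLink he π n
    (measurable_one.indicator hm), hπ]
  have hF : ∀ P : ProbabilityMeasure C, ∫⁻ c, ((fun ω : Sample (coordLink.{u, v, w} e he) n =>
      ω.2) ⁻¹' sᶜ).indicator
      (1 : Sample (coordLink.{u, v, w} e he) n → ℝ≥0∞) (PUnit.unit, P, c) ∂iidKernel C n P =
      iidKernel C n P (Prod.mk P ⁻¹' sᶜ) := fun P =>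
    lintegral_indicator_one (measurable_prodMk_left hs.compl)
  rw [lintegral_congr hF, lintegral_map (Kernel.measurable_kernel_prodMk_left hs.compl) hφ]
  have h0 : ∀ y, iidKernel C n (φ y) (Prod.mk (φ y) ⁻¹' sᶜ) = 0 := fun y => h y
  simp only [h0, lintegral_zero]

/-- If the vector of probabilities is a function of the indicators, then so is its posterior. -/
lemma exists_posterior_of_ae_eq {e : C → X} (he : Measurable e)
    (π : ProbabilityMeasure (ProbabilityMeasure C)) {n R : ℕ} {B : Fin R → Set X}
    (hB : IsPartition B)
    (Ψ : ({p : Fin n × Fin n // p.1 ≠ p.2} → Fin R → Prop) → Fin R → ℝ)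
    (h : ∀ᵐ ω ∂jointLaw Set.univ (coordLink.{u, v, w} e he) π n,
      evalVec (fun r => e ⁻¹' B r) ω.2.1 = Ψ (indicators B (coordArray e n ω.2.2))) :
    ∃ g : ({p : Fin n × Fin n // p.1 ≠ p.2} → Fin R → Prop) → Measure (Fin R → ℝ),
      ∀ᵐ x ∂dataLaw Set.univ (coordLink.{u, v, w} e he) π n,
        posterior Set.univ (coordLink.{u, v, w} e he) π n B x = g fun p r => x p ∈ B r := by
  have hf : Measurable fun x : Data n X => Ψ (indicators B x) :=
    (measurable_of_finite Ψ).comp (measurable_indicators hB.measurable)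
  refine ⟨fun τ => Measure.dirac (Ψ τ), ?_⟩
  simp only [posterior_coordLink he π n hB.measurable]
  have hV : (fun ω : Sample (coordLink.{u, v, w} e he) n =>
      evalVec (fun r => e ⁻¹' B r) ω.2.1) =ᵐ[jointLaw Set.univ (coordLink.{u, v, w} e he) π n]
      (fun x => Ψ (indicators B x)) ∘ observe (coordLink.{u, v, w} e he) n := h
  rw [condDistrib_congr_left hV]
  filter_upwards [condDistrib_comp_self (μ := jointLaw Set.univ (coordLink.{u, v, w} e he) π n)
    (observe (coordLink.{u, v, w} e he) n) hf] with x hx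
  rw [hx, Kernel.deterministic_apply]
  rfl

/-- The trivial processes do not smooth across events under the link `h(c, c') = e(c)`. -/
lemma IsTrivialProcess.doesNotSmooth [StandardBorelSpace C] [StandardBorelSpace X]
    {π : ProbabilityMeasure (ProbabilityMeasure C)} (h : IsTrivialProcess π) {e : C → X}
    (he : Measurable e) {n : ℕ} (hn : 2 ≤ n) :
    DoesNotSmooth (dataLaw Set.univ (coordLink.{u, v, w} e he) π n)
      (posterior Set.univ (coordLink.{u, v, w} e he) π n) := by
  classical
  intro R B hB
  obtain ⟨σ, hσ⟩ := exists_pair hn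
  have hA : IsPartition fun r => e ⁻¹' B r := hB.preimage he
  have hev := measurable_evalVec hA.measurable
  rcases h with ⟨ρ, hρ⟩ | ⟨ρ, hρ⟩ | ⟨a, b, ζ, hζ⟩
  · refine exists_posterior_of_ae_eq he π hB (fun _ => evalVec (fun r => e ⁻¹' B r) ρ) ?_
    refine ae_jointLaw_coordLink he (s := {p | evalVec (fun r => e ⁻¹' B r) p.1 =
      evalVec (fun r => e ⁻¹' B r) ρ}) ((hev.comp measurable_fst) (measurableSet_singleton _))
      (ν := Measure.dirac ()) (φ := fun _ => ρ) measurable_const (by simpa using hρ)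
      fun _ => ae_of_all _ fun c => rfl
  · -- all observations are equal, and determine `P_C`
    refine exists_posterior_of_ae_eq he π hB
      (fun τ r => if τ (σ ⟨0, by omega⟩) r then 1 else 0) ?_
    refine ae_jointLaw_coordLink he (s := {p | evalVec (fun r => e ⁻¹' B r) p.1 =
      fun r => if indicators B (coordArray e n p.2) (σ ⟨0, by omega⟩) r then 1 else 0}) ?_
      measurable_pointMass hρ fun y => ?_
    · refine measurableSet_eq_fun (hev.comp measurable_fst) ?_
      exact (measurable_of_finite fun (τ : {p : Fin n × Fin n // p.1 ≠ p.2} → Fin R → Prop) r =>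
        if τ (σ ⟨0, by omega⟩) r then (1 : ℝ) else 0).comp
          ((measurable_indicators hB.measurable).comp
            ((measurable_coordArray he n).comp measurable_snd))
    · have hy : ∀ᵐ c ∂iidKernel C n (pointMass y), c ⟨0, by omega⟩ = y := by
        have h1 : ∀ᵐ z ∂(pointMass y : Measure C), z = y := by
          change ∀ᵐ z ∂Measure.dirac y, z = y
          rw [ae_dirac_eq]; rfl
        exact (Measure.tendsto_eval_ae_ae (μ := fun _ : Fin n => (pointMass y : Measure C))
          (i := ⟨0, by omega⟩)).eventually h1
      filter_upwards [hy] with c hc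
      ext r
      have hmem : indicators B (coordArray e n c) (σ ⟨0, by omega⟩) r ↔ y ∈ e ⁻¹' B r := by
        simp only [indicators, coordArray, hσ, hc, mem_preimage]
      simp only [hmem]
      change (Measure.dirac y).real (e ⁻¹' B r) = _
      rw [Measure.real, Measure.dirac_apply' _ (hA.measurable r)]
      by_cases hyr : y ∈ e ⁻¹' B r <;> simp [hyr]
  · obtain ⟨r₀, hr₀⟩ := mem_iUnion.1 (hA.cover.symm ▸ mem_univ a : a ∈ ⋃ r, e ⁻¹' B r)
    by_cases hb : b ∈ e ⁻¹' B r₀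
    · -- both atoms lie in the same cell, so that the vector of probabilities is deterministic
      refine exists_posterior_of_ae_eq he π hB (fun _ r => if r = r₀ then 1 else 0) ?_
      refine ae_jointLaw_coordLink he (s := {p | evalVec (fun r => e ⁻¹' B r) p.1 =
        fun r => if r = r₀ then 1 else 0}) ((hev.comp measurable_fst) (measurableSet_singleton _))
        (measurable_twoPointMix a b) hζ fun z => ae_of_all _ fun c => ?_
      change evalVec (fun r => e ⁻¹' B r) (twoPointMix a b z) = _
      ext r
      have h0 : 0 ≤ 1 - (z : ℝ) := sub_nonneg.2 z.2.2
      have hz : ((twoPointMix a b z : Measure C)).real (e ⁻¹' B r) =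
          z * (e ⁻¹' B r).indicator 1 a + (1 - z) * (e ⁻¹' B r).indicator 1 b := by
        rw [twoPointMix_apply, Measure.real, Measure.add_apply, Measure.smul_apply,
          Measure.smul_apply, Measure.dirac_apply' _ (hA.measurable r),
          Measure.dirac_apply' _ (hA.measurable r), smul_eq_mul, smul_eq_mul,
          ENNReal.toReal_add (by simp [indicator_apply]; split_ifs <;> simp)
            (by simp [indicator_apply]; split_ifs <;> simp), ENNReal.toReal_mul,
          ENNReal.toReal_mul, ENNReal.toReal_ofReal z.2.1, ENNReal.toReal_ofReal h0]
        by_cases h1 : a ∈ e ⁻¹' B r <;> by_cases h2 : b ∈ e ⁻¹' B r <;> simp [h1, h2]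
      rw [evalVec, hz]
      by_cases hr : r = r₀
      · subst hr
        rw [indicator_of_mem hr₀, indicator_of_mem hb]
        simp
      · rw [indicator_of_notMem fun h => Set.disjoint_left.1 (hA.disjoint hr) h hr₀,
          indicator_of_notMem fun h => Set.disjoint_left.1 (hA.disjoint hr) h hb]
        simp [hr]
    · -- the atoms lie in different cells, so that the indicators determine the data
      refine ⟨fun τ => posterior Set.univ (coordLink.{u, v, w} e he) π n B
        fun p => if τ p r₀ then e a else e b, ?_⟩
      have hW : MeasurableSet {x : Data n X | ∀ p, x p ∈ ({e a, e b} : Set X)} := by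
        rw [show {x : Data n X | ∀ p, x p ∈ ({e a, e b} : Set X)} =
          ⋂ p, (fun x : Data n X => x p) ⁻¹' {e a, e b} by ext; simp]
        exact MeasurableSet.iInter fun p =>
          measurable_pi_apply p (Set.toFinite ({e a, e b} : Set X)).measurableSet
      have hae : ∀ᵐ x ∂dataLaw Set.univ (coordLink.{u, v, w} e he) π n,
          x ∈ {x : Data n X | ∀ p, x p ∈ ({e a, e b} : Set X)} := by
        refine (ae_map_iff (measurable_observe _ n).aemeasurable
          (p := fun x => x ∈ {x : Data n X | ∀ p, x p ∈ ({e a, e b} : Set X)}) hW).2 ?_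
        refine ae_jointLaw_coordLink he (s := {p | coordArray e n p.2 ∈
          {x : Data n X | ∀ p, x p ∈ ({e a, e b} : Set X)}})
          (((measurable_coordArray he n).comp measurable_snd) hW)
          (measurable_twoPointMix a b) hζ fun z => ?_
        have h1 : ∀ᵐ y ∂(twoPointMix a b z : Measure C), y ∈ ({a, b} : Set C) := by
          change (twoPointMix a b z : Measure C) ({a, b} : Set C)ᶜ = 0
          have hab : MeasurableSet ({a, b} : Set C)ᶜ :=
            (Set.toFinite ({a, b} : Set C)).measurableSet.compl
          rw [twoPointMix_apply, Measure.add_apply, Measure.smul_apply, Measure.smul_apply,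
            Measure.dirac_apply' _ hab, Measure.dirac_apply' _ hab]
          simp
        have h2 : ∀ᵐ c ∂iidKernel C n (twoPointMix a b z), ∀ i, c i ∈ ({a, b} : Set C) :=
          ae_all_iff.2 fun i => (Measure.tendsto_eval_ae_ae
            (μ := fun _ : Fin n => (twoPointMix a b z : Measure C)) (i := i)).eventually h1
        filter_upwards [h2] with c hc p
        rcases hc p.1.1 with h | h
        · exact Or.inl (by rw [coordArray, h])
        · exact Or.inr (by rw [coordArray, h]; rfl)
      filter_upwards [hae] with x hx
      congr 1
      ext p
      rcases hx p with h | h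
      · have hm : x p ∈ B r₀ := h ▸ hr₀
        rw [if_pos hm, h]
      · have hm : x p ∉ B r₀ := fun hm => hb (show e b ∈ B r₀ from (show x p = e b from h) ▸ hm)
        rw [if_neg hm]
        exact h

end TrivialProcesses

/-! ### Predictive probabilities without smoothing -/

section Predictive

variable {C : Type u} {X : Type v} [MeasurableSpace C] [MeasurableSpace X]

/-- The mixed moment `E[P(S_1) ⋯ P(S_n)]` of the prior, over a list of sets. -/
def moment (π : ProbabilityMeasure (ProbabilityMeasure C)) (L : List (Set C)) : ℝ :=
  ∫ P, (L.map fun S => (P : Measure C).real S).prod ∂(π : Measure (ProbabilityMeasure C))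

lemma list_prod_real_mem_Icc (P : ProbabilityMeasure C) (L : List (Set C)) :
    (L.map fun S => (P : Measure C).real S).prod ∈ Set.Icc (0 : ℝ) 1 := by
  induction L with
  | nil => simp
  | cons S L ih =>
    rw [List.map_cons, List.prod_cons]
    exact ⟨mul_nonneg measureReal_nonneg ih.1, mul_le_one₀ measureReal_le_one ih.1 ih.2⟩

lemma measurable_measureReal {S : Set C} (hS : MeasurableSet S) :
    Measurable fun P : ProbabilityMeasure C => (P : Measure C).real S :=
  ((Measure.measurable_coe hS).comp measurable_subtype_coe).ennreal_toReal

lemma measurable_list_prod_real {L : List (Set C)} (hL : ∀ S ∈ L, MeasurableSet S) :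
    Measurable fun P : ProbabilityMeasure C => (L.map fun S => (P : Measure C).real S).prod := by
  induction L with
  | nil => exact measurable_const
  | cons S L ih =>
    exact (measurable_measureReal (hL S (by simp))).mul (ih fun T hT => hL T (by simp [hT]))

lemma integrable_list_prod_real (π : ProbabilityMeasure (ProbabilityMeasure C)) {L : List (Set C)}
    (hL : ∀ S ∈ L, MeasurableSet S) :
    Integrable (fun P : ProbabilityMeasure C => (L.map fun S => (P : Measure C).real S).prod)
      (π : Measure (ProbabilityMeasure C)) := by
  refine Integrable.of_bound (measurable_list_prod_real hL).aestronglyMeasurable 1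
    (ae_of_all _ fun P => ?_)
  rw [Real.norm_eq_abs, abs_of_nonneg (list_prod_real_mem_Icc P L).1]
  exact (list_prod_real_mem_Icc P L).2

lemma ofReal_moment (π : ProbabilityMeasure (ProbabilityMeasure C)) {L : List (Set C)}
    (hL : ∀ S ∈ L, MeasurableSet S) :
    ENNReal.ofReal (moment π L) = ∫⁻ P, (L.map fun S => (P : Measure C) S).prod
      ∂(π : Measure (ProbabilityMeasure C)) := by
  rw [moment, ofReal_integral_eq_lintegral_ofReal (integrable_list_prod_real π hL)
    (ae_of_all _ fun P => (list_prod_real_mem_Icc P L).1)]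
  refine lintegral_congr fun P => ?_
  clear hL
  induction L with
  | nil => simp
  | cons S L ih =>
    rw [List.map_cons, List.prod_cons, ENNReal.ofReal_mul measureReal_nonneg, ih,
      ofReal_measureReal, List.map_cons, List.prod_cons]

lemma moment_nonneg (π : ProbabilityMeasure (ProbabilityMeasure C)) (L : List (Set C)) :
    0 ≤ moment π L := integral_nonneg fun P => (list_prod_real_mem_Icc P L).1

lemma lintegral_indicator_pi {n : ℕ} (P : ProbabilityMeasure C) {S : Fin n → Set C}
    (hS : ∀ i, MeasurableSet (S i)) (a : ℝ≥0∞) :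
    ∫⁻ c, (univ.pi S).indicator 1 c * a ∂iidKernel C n P = a * ∏ i, (P : Measure C) (S i) := by
  have hm : MeasurableSet (univ.pi S) := MeasurableSet.univ_pi hS
  rw [lintegral_mul_const _ (measurable_one.indicator hm), lintegral_indicator_one hm,
    iidKernel_apply, Measure.pi_pi, mul_comm]

/-- If the posterior of `P(A)` depends only on the indicators of `A`, then so does the predictive
probability of `A`. -/
lemma exists_predictive_fin [StandardBorelSpace C] [StandardBorelSpace X]
    {π : ProbabilityMeasure (ProbabilityMeasure C)} {e : C → X} (he : Measurable e)
    (hinj : Function.Injective e) {n : ℕ} (hn : 2 ≤ n)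
    (h : DoesNotSmooth (dataLaw Set.univ (coordLink.{u, v, w} e he) π n)
      (posterior Set.univ (coordLink.{u, v, w} e he) π n)) {A : Set C} (hA : MeasurableSet A) :
    ∃ γ : (Fin n → Prop) → ℝ≥0∞, ∀ (τ : Fin n → Prop) (S : Fin n → Set C),
      (∀ i, MeasurableSet (S i)) → (∀ i, τ i → S i ⊆ A) → (∀ i, ¬ τ i → S i ⊆ Aᶜ) →
      ∫⁻ P, (P : Measure C) A * ∏ i, (P : Measure C) (S i)
          ∂(π : Measure (ProbabilityMeasure C)) =
        γ τ * ∫⁻ P, ∏ i, (P : Measure C) (S i) ∂(π : Measure (ProbabilityMeasure C)) := by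
  classical
  obtain ⟨σ, hσ⟩ := exists_pair hn
  have hemb : MeasurableEmbedding e := he.measurableEmbedding hinj
  have himg : ∀ {S : Set C}, MeasurableSet S → MeasurableSet (e '' S) :=
    fun hS => hemb.measurableSet_image.2 hS
  set B : Fin 2 → Set X := ![e '' A, (e '' A)ᶜ] with hBdef
  have hB : IsPartition B := by
    refine ⟨fun r => ?_, fun r s hrs => ?_, ?_⟩
    · fin_cases r
      · exact himg hA
      · exact (himg hA).compl
    · fin_cases r <;> fin_cases s
      · exact absurd rfl hrs
      · exact disjoint_compl_right
      · exact disjoint_compl_left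
      · exact absurd rfl hrs
    · ext x
      by_cases hx : x ∈ e '' A
      · exact iff_of_true (mem_iUnion.2 ⟨0, hx⟩) trivial
      · exact iff_of_true (mem_iUnion.2 ⟨1, hx⟩) trivial
  obtain ⟨g, hg⟩ := h 2 B hB
  simp only [posterior_coordLink he π n hB.measurable] at hg
  set J := jointLaw Set.univ (coordLink.{u, v, w} e he) π n with hJ
  set V : Sample (coordLink.{u, v, w} e he) n → Fin 2 → ℝ :=
    fun ω => evalVec (fun r => e ⁻¹' B r) ω.2.1 with hV
  have hVm : Measurable V := (measurable_evalVec fun r => he (hB.measurable r)).comp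
    (measurable_fst.comp measurable_snd)
  set O : Sample (coordLink.{u, v, w} e he) n → Data n X :=
    observe (coordLink.{u, v, w} e he) n with hO
  have hXm : Measurable O := measurable_observe (coordLink.{u, v, w} e he) n
  have hPA : ∀ P : ProbabilityMeasure C,
      ENNReal.ofReal (evalVec (fun r => e ⁻¹' B r) P 0) = (P : Measure C) A := by
    intro P
    have : e ⁻¹' B 0 = A := hinj.preimage_image A
    rw [evalVec, ofReal_measureReal, this]
  refine ⟨fun τ => ∫⁻ y, ENNReal.ofReal (y 0)
    ∂g fun p r => if r = 0 then τ p.1.1 else ¬ τ p.1.1, fun τ S hS hτ hτ' => ?_⟩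
  set S' : Set (Data n X) := {x | ∀ p, x p ∈ e '' S p.1.1} with hS'def
  have hS' : MeasurableSet S' := by
    rw [show S' = ⋂ p : {p : Fin n × Fin n // p.1 ≠ p.2},
      (fun x : Data n X => x p) ⁻¹' (e '' S p.1.1) by ext; simp [S']]
    exact MeasurableSet.iInter fun p => measurable_pi_apply p (himg (hS _))
  have hpre : coordArray e n ⁻¹' S' = univ.pi S := by
    ext c
    simp only [S', coordArray, mem_preimage, mem_ofPred_eq, hinj.mem_set_image, mem_univ_pi]
    exact ⟨fun hc k => by simpa [hσ] using hc (σ k), fun hc p => hc _⟩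
  -- on `S'` the indicators are those prescribed by `τ`
  have hind : ∀ x ∈ S', (fun p r => x p ∈ B r) =
      fun (p : {p : Fin n × Fin n // p.1 ≠ p.2}) (r : Fin 2) =>
        if r = 0 then τ p.1.1 else ¬ τ p.1.1 := by
    intro x hx
    ext p r
    obtain ⟨c, hc, hxc⟩ := hx p
    have hcA : x p ∈ e '' A ↔ τ p.1.1 := by
      rw [← hxc, hinj.mem_set_image]
      exact ⟨fun h' => by_contra fun h'' => hτ' _ h'' hc h', fun h' => hτ _ h' hc⟩
    fin_cases r
    · simpa [B] using hcA
    · simpa [B] using not_congr hcA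
  have hm0 : Measurable fun y : Fin 2 → ℝ => ENNReal.ofReal (y 0) :=
    (measurable_pi_apply 0).ennreal_ofReal
  have hfm : Measurable fun q : Data n X × (Fin 2 → ℝ) =>
      S'.indicator (1 : Data n X → ℝ≥0∞) q.1 * ENNReal.ofReal (q.2 0) :=
    ((measurable_one.indicator hS').comp measurable_fst).mul (hm0.comp measurable_snd)
  have hdis : ∫⁻ x, ∫⁻ y, S'.indicator (1 : Data n X → ℝ≥0∞) x * ENNReal.ofReal (y 0)
      ∂condDistrib V O J x ∂J.map O =
      ∫⁻ ω, S'.indicator (1 : Data n X → ℝ≥0∞) (O ω) * ENNReal.ofReal (V ω 0) ∂J := by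
    rw [← Measure.lintegral_compProd hfm, compProd_map_condDistrib hVm.aemeasurable,
      lintegral_map hfm (hXm.prodMk hVm)]
  have h1 : ∫⁻ ω, S'.indicator (1 : Data n X → ℝ≥0∞) (O ω) *
      ENNReal.ofReal (V ω 0) ∂J =
      ∫⁻ P, (P : Measure C) A * ∏ i, (P : Measure C) (S i)
        ∂(π : Measure (ProbabilityMeasure C)) := by
    have := lintegral_jointLaw_coordLink.{u, v, w} he π n (hfm.comp (hXm.prodMk hVm))
    refine this.trans (lintegral_congr fun P => ?_)
    rw [← lintegral_indicator_pi P hS, ← hpre, ← hPA]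
    rfl
  have h2 : ∫⁻ x, ∫⁻ y, S'.indicator (1 : Data n X → ℝ≥0∞) x * ENNReal.ofReal (y 0)
      ∂condDistrib V O J x ∂J.map O =
      (∫⁻ y, ENNReal.ofReal (y 0) ∂g fun p r => if r = 0 then τ p.1.1 else ¬ τ p.1.1) *
        ∫⁻ P, ∏ i, (P : Measure C) (S i) ∂(π : Measure (ProbabilityMeasure C)) := by
    set a := ∫⁻ y, ENNReal.ofReal (y 0) ∂g fun p r => if r = 0 then τ p.1.1 else ¬ τ p.1.1
    have h3 : ∀ᵐ x ∂J.map O, ∫⁻ y, S'.indicator (1 : Data n X → ℝ≥0∞) x *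
        ENNReal.ofReal (y 0) ∂condDistrib V O J x = S'.indicator 1 x * a := by
      filter_upwards [hg] with x hx
      rw [lintegral_const_mul _ hm0]
      by_cases hxS : x ∈ S'
      · rw [hx, hind x hxS]
      · simp [hxS]
    rw [lintegral_congr_ae h3, lintegral_map ((measurable_one.indicator hS').mul_const _) hXm]
    have := lintegral_jointLaw_coordLink.{u, v, w} he π n
      (((measurable_one.indicator hS').mul_const a).comp hXm)
    refine this.trans ?_
    have hprod : Measurable fun P : ProbabilityMeasure C => ∏ i, (P : Measure C) (S i) :=
      Finset.measurable_prod _ fun i _ =>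
        (Measure.measurable_coe (hS i)).comp measurable_subtype_coe
    rw [← lintegral_const_mul _ hprod]
    refine lintegral_congr fun P => ?_
    rw [← lintegral_indicator_pi P hS, ← hpre]
    rfl
  rw [← h1, ← h2]
  exact hdis.symm

/-- The predictive probability of `A`, given that the first `k` observations fall into prescribed
subsets of `A` and the other `l` into prescribed subsets of the complement, is a function of `k`
and `l`. -/
lemma exists_predictive [StandardBorelSpace C] [StandardBorelSpace X]
    {π : ProbabilityMeasure (ProbabilityMeasure C)} {e : C → X} (he : Measurable e)
    (hinj : Function.Injective e)
    (h : ∀ n, 2 ≤ n → DoesNotSmooth (dataLaw Set.univ (coordLink.{u, v, w} e he) π n)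
      (posterior Set.univ (coordLink.{u, v, w} e he) π n)) {A : Set C} (hA : MeasurableSet A) :
    ∃ γ : ℕ → ℕ → ℝ, ∀ L₁ L₂ : List (Set C), (∀ S ∈ L₁, MeasurableSet S ∧ S ⊆ A) →
      (∀ S ∈ L₂, MeasurableSet S ∧ S ⊆ Aᶜ) → 2 ≤ L₁.length + L₂.length →
      moment π (A :: (L₁ ++ L₂)) = γ L₁.length L₂.length * moment π (L₁ ++ L₂) := by
  classical
  have hex : ∀ n, ∃ γ : (Fin n → Prop) → ℝ≥0∞, 2 ≤ n → ∀ (τ : Fin n → Prop) (S : Fin n → Set C),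
      (∀ i, MeasurableSet (S i)) → (∀ i, τ i → S i ⊆ A) → (∀ i, ¬ τ i → S i ⊆ Aᶜ) →
      ∫⁻ P, (P : Measure C) A * ∏ i, (P : Measure C) (S i)
          ∂(π : Measure (ProbabilityMeasure C)) =
        γ τ * ∫⁻ P, ∏ i, (P : Measure C) (S i) ∂(π : Measure (ProbabilityMeasure C)) := by
    intro n
    by_cases hn : 2 ≤ n
    · obtain ⟨γ, hγ⟩ := exists_predictive_fin he hinj hn (h n hn) hA
      exact ⟨γ, fun _ => hγ⟩
    · exact ⟨fun _ => 0, fun h => absurd h hn⟩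
  choose γ hγ using hex
  refine ⟨fun k l => (γ (k + l) fun i => (i : ℕ) < k).toReal, fun L₁ L₂ h₁ h₂ hn => ?_⟩
  have hm : ∀ S ∈ L₁ ++ L₂, MeasurableSet S := by
    intro S hS
    rcases List.mem_append.1 hS with h | h
    exacts [(h₁ S h).1, (h₂ S h).1]
  have hlen : (L₁ ++ L₂).length = L₁.length + L₂.length := List.length_append
  have key := hγ (L₁.length + L₂.length) hn (fun i => (i : ℕ) < L₁.length)
    (fun i => (L₁ ++ L₂)[(i : ℕ)]) (fun i => hm _ (List.getElem_mem _))
    (fun i hi => by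
      simp only [List.getElem_append_left hi]
      exact (h₁ _ (List.getElem_mem _)).2)
    (fun i hi => by
      simp only [List.getElem_append_right (not_lt.1 hi)]
      exact (h₂ _ (List.getElem_mem _)).2)
  have hprod : ∀ P : ProbabilityMeasure C, ∏ i : Fin (L₁.length + L₂.length),
      (P : Measure C) (L₁ ++ L₂)[(i : ℕ)] =
      ((L₁ ++ L₂).map fun S => (P : Measure C) S).prod := by
    intro P
    rw [← Fin.prod_univ_fun_getElem]
    exact (Fintype.prod_equiv (finCongr hlen) _ _ fun i => rfl).symm
  simp only [hprod] at key
  rw [← ofReal_moment π hm] at key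
  have hm' : ∀ S ∈ A :: (L₁ ++ L₂), MeasurableSet S := by
    intro S hS
    rcases List.mem_cons.1 hS with rfl | h
    exacts [hA, hm S h]
  have hA' := ofReal_moment π hm'
  simp only [List.map_cons, List.prod_cons] at hA'
  rw [← hA'] at key
  have := congrArg ENNReal.toReal key
  rwa [ENNReal.toReal_mul, ENNReal.toReal_ofReal (moment_nonneg _ _),
    ENNReal.toReal_ofReal (moment_nonneg _ _)] at this

end Predictive

/-! ### Identification of the urn from three colours -/

section Urn

/-- One-colour half of the urn identification: if the predictive probability `a n k` of a colour
is affine in its count `k` with slope `L n`, then consistency of the array `e` of probabilities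
forces the dependence on `n` to be that of a Pólya urn. -/
lemma urn_of_affine {e : ℕ → ℕ → ℕ → ℝ} (he : ∀ k l m, e k l m ≠ 0)
    (hsum : ∀ k l m, e (k + 1) l m + e k (l + 1) m + e k l (m + 1) = e k l m)
    (h0 : e 0 0 0 = 1) {a : ℕ → ℕ → ℝ}
    (ha : ∀ k l m, 2 ≤ k + l + m → e (k + 1) l m = a (k + l + m) k * e k l m) {L : ℕ → ℝ}
    (hL : ∀ n, 2 ≤ n → ∀ k, k ≤ n → a n k = a n 0 + k * L n) {n : ℕ} (hn : 2 ≤ n) {k : ℕ}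
    (hk : k ≤ n) :
    (1 + ((n : ℝ) - 1) * (L 2 / (1 - L 2))) * a n k =
      (1 - L 2 / (1 - L 2)) * e 1 0 0 + k * (L 2 / (1 - L 2)) := by
  have down : ∀ k l m, 1 ≤ k + l + m →
      (1 - L (k + l + m + 1)) * e (k + 1) l m = a (k + l + m + 1) k * e k l m := by
    intro k l m h
    have h1 := ha (k + 1) l m (by omega)
    have h2 := ha k (l + 1) m (by omega)
    have h3 := ha k l (m + 1) (by omega)
    rw [show k + 1 + l + m = k + l + m + 1 by ring] at h1
    rw [show k + (l + 1) + m = k + l + m + 1 by ring] at h2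
    rw [show k + l + (m + 1) = k + l + m + 1 by ring] at h3
    have h4 := hL (k + l + m + 1) (by omega) (k + 1) (by omega)
    have h5 := hL (k + l + m + 1) (by omega) k (by omega)
    have h6 := hsum (k + 1) l m
    have h7 := hsum k l m
    push_cast at h4
    rw [h1, h2, h3, h4] at h6
    rw [h5] at h6 ⊢
    rw [← h7]
    linear_combination -h6
  have down' : ∀ n, 2 ≤ n → ∀ k, k ≤ n → (1 - L (n + 1)) * a n k = a (n + 1) k := by
    intro n hn k hk
    obtain ⟨l, rfl⟩ := Nat.exists_eq_add_of_le hk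
    have h1 := down k l 0 (by omega)
    have h2 := ha k l 0 (by omega)
    rw [add_zero] at h1 h2
    rw [h2, ← mul_assoc] at h1
    exact mul_right_cancel₀ (he k l 0) h1
  have hL2 : 1 - L 2 ≠ 0 := by
    intro h
    have h1 := down 0 1 0 (by omega)
    have h2 := down 1 0 0 (by omega)
    norm_num at h1 h2
    rw [h, zero_mul, eq_comm, mul_eq_zero, or_iff_left (he _ _ _)] at h1 h2
    have := hL 2 le_rfl 1 (by omega)
    rw [h1, h2] at this
    norm_num at this
    rw [← this] at h
    norm_num at h
  set t := L 2 / (1 - L 2) with ht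
  have ht2 : L 2 = (1 - L 2) * t := by rw [ht]; field_simp
  have hbase : a 2 0 = (1 - L 2) * ((1 - t) * e 1 0 0) := by
    have h1 := down 1 0 0 (by omega)
    have h2 := down 0 1 0 (by omega)
    have h3 := down 0 0 1 (by omega)
    norm_num at h1 h2 h3
    have h4 := hsum 1 0 0
    have h5 := hsum 0 0 0
    have h6 := hL 2 le_rfl 1 (by omega)
    rw [h6] at h1
    norm_num at h1 h4 h5
    rw [h0] at h5
    linear_combination (-a 2 0) * h5 - h1 - h2 - h3 + (1 - L 2) * h4 - e 1 0 0 * ht2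
  have main : ∀ n : ℕ, 2 ≤ n → (1 + ((n : ℝ) - 1) * t) * L n = t ∧
      (1 + ((n : ℝ) - 1) * t) * a n 0 = (1 - t) * e 1 0 0 := by
    intro n hn
    induction n, hn using Nat.le_induction with
    | base =>
      push_cast
      constructor
      · linear_combination ht2
      · rw [hbase]
        linear_combination -((1 - t) * e 1 0 0) * ht2
    | succ n hn ih =>
      have h1 := down' n hn 0 (by omega)
      have h2 := down' n hn 1 (by omega)
      have h3 : L (n + 1) = (1 - L (n + 1)) * L n := by
        have h4 := hL n hn 1 (by omega)
        have h5 := hL (n + 1) (by omega) 1 (by omega)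
        push_cast at h4 h5
        linear_combination (1 - L (n + 1)) * h4 - h5 + h1 - h2
      have h4 : 1 + ((n : ℝ) + 1 - 1) * t = (1 + ((n : ℝ) - 1) * t) * (1 + L n) := by
        linear_combination -ih.1
      have h5 : (1 + L n) * (1 - L (n + 1)) = 1 := by linear_combination -h3
      push_cast
      rw [h4]
      constructor
      · rw [h3]
        linear_combination ih.1 + (1 + ((n : ℝ) - 1) * t) * L n * h5
      · rw [← h1]
        linear_combination ih.2 + (1 + ((n : ℝ) - 1) * t) * a n 0 * h5
  obtain ⟨h1, h2⟩ := main n hn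
  rw [hL n hn k hk]
  linear_combination h2 + k * h1

/-- With three colours, predictive probabilities that depend only on the sample size and on the
count of the colour in question are those of a Pólya urn: since they sum to one in every
configuration, moving one observation from one colour to another shows that all the increments
agree. -/
lemma exists_urn_of_three {e : ℕ → ℕ → ℕ → ℝ} (he : ∀ k l m, e k l m ≠ 0)
    (hsum : ∀ k l m, e (k + 1) l m + e k (l + 1) m + e k l (m + 1) = e k l m)
    (h0 : e 0 0 0 = 1) {a b d : ℕ → ℕ → ℝ}
    (ha : ∀ k l m, 2 ≤ k + l + m → e (k + 1) l m = a (k + l + m) k * e k l m)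
    (hb : ∀ k l m, 2 ≤ k + l + m → e k (l + 1) m = b (k + l + m) l * e k l m)
    (hd : ∀ k l m, 2 ≤ k + l + m → e k l (m + 1) = d (k + l + m) m * e k l m) :
    ∃ t : ℝ, ∀ n : ℕ, 2 ≤ n → ∀ k : ℕ, k ≤ n →
      (1 + ((n : ℝ) - 1) * t) * a n k = (1 - t) * e 1 0 0 + k * t ∧
      (1 + ((n : ℝ) - 1) * t) * b n k = (1 - t) * e 0 1 0 + k * t := by
  have one : ∀ k l m, 2 ≤ k + l + m →
      a (k + l + m) k + b (k + l + m) l + d (k + l + m) m = 1 := by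
    intro k l m h
    have h1 := hsum k l m
    rw [ha k l m h, hb k l m h, hd k l m h, ← add_mul, ← add_mul] at h1
    exact mul_right_cancel₀ (he k l m) (h1.trans (one_mul _).symm)
  have incr : ∀ n, 2 ≤ n → ∀ k l, k + l + 1 ≤ n → a n (k + 1) - a n k = b n (l + 1) - b n l := by
    intro n hn k l h
    obtain ⟨m, rfl⟩ := Nat.exists_eq_add_of_le h
    have h1 := one (k + 1) l m (by omega)
    have h2 := one k (l + 1) m (by omega)
    rw [show k + 1 + l + m = k + l + 1 + m by ring] at h1
    rw [show k + (l + 1) + m = k + l + 1 + m by ring] at h2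
    linarith
  set L : ℕ → ℝ := fun n => a n 1 - a n 0 with hLdef
  have hLa : ∀ n, 2 ≤ n → ∀ k, k ≤ n → a n k = a n 0 + k * L n := by
    intro n hn k
    induction k with
    | zero => simp
    | succ k ih =>
      intro hk
      have h1 := incr n hn k 0 (by omega)
      have h2 := incr n hn 0 0 (by omega)
      simp only [hLdef] at ih ⊢
      have h3 := ih (by omega)
      push_cast
      norm_num at h1 h2
      linarith
  have hLb : ∀ n, 2 ≤ n → ∀ k, k ≤ n → b n k = b n 0 + k * L n := by
    intro n hn k
    induction k with
    | zero => simp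
    | succ k ih =>
      intro hk
      have h1 := incr n hn 0 k (by omega)
      simp only [hLdef] at ih ⊢
      have h3 := ih (by omega)
      push_cast
      norm_num at h1
      linarith
  refine ⟨L 2 / (1 - L 2), fun n hn k hk => ⟨urn_of_affine he hsum h0 ha hLa hn hk, ?_⟩⟩
  refine urn_of_affine (e := fun k l m => e l k m) (fun k l m => he l k m) (fun k l m => ?_) h0
    (fun k l m h => ?_) hLb hn hk
  · have := hsum l k m
    linarith
  · have := hb l k m (by omega)
    rwa [show l + k + m = k + l + m by ring] at this

end Urn

/-! ### Mixed moments of count-predictive priors -/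

section Moments

variable {C : Type u} [MeasurableSpace C] {π : ProbabilityMeasure (ProbabilityMeasure C)}

lemma moment_perm {L L' : List (Set C)} (h : L.Perm L') : moment π L = moment π L' :=
  integral_congr_ae (ae_of_all _ fun _ => (h.map _).prod_eq)

@[simp] lemma moment_nil : moment π [] = 1 := by simp [moment]

lemma moment_eq_zero_iff {L : List (Set C)} (hL : ∀ S ∈ L, MeasurableSet S) :
    moment π L = 0 ↔ ∀ᵐ P : ProbabilityMeasure C ∂(π : Measure (ProbabilityMeasure C)),
      ∃ S ∈ L, (P : Measure C).real S = 0 := by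
  rw [moment, integral_eq_zero_iff_of_nonneg (fun P => (list_prod_real_mem_Icc P L).1)
    (integrable_list_prod_real π hL)]
  refine eventually_congr (ae_of_all _ fun P => ?_)
  simp [List.prod_eq_zero_iff]

/-- Positivity of a mixed moment only depends on the sets that occur in it, and passes to larger
sets. -/
lemma moment_ne_zero_of_subset {L L' : List (Set C)} (hL : ∀ S ∈ L, MeasurableSet S)
    (hL' : ∀ S ∈ L', MeasurableSet S) (h : ∀ S ∈ L', ∃ T ∈ L, T ⊆ S) (h0 : moment π L ≠ 0) :
    moment π L' ≠ 0 := by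
  refine mt (fun h1 => ?_) h0
  rw [moment_eq_zero_iff hL'] at h1
  rw [moment_eq_zero_iff hL]
  filter_upwards [h1] with P ⟨S, hS, hP⟩
  obtain ⟨T, hT, hTS⟩ := h S hS
  exact ⟨T, hT, le_antisymm (hP ▸ measureReal_mono hTS) measureReal_nonneg⟩

lemma moment_cons_congr_add {S T U : Set C} {L : List (Set C)} (hS : MeasurableSet S)
    (hT : MeasurableSet T) (hL : ∀ S ∈ L, MeasurableSet S) (hd : Disjoint S T) (hU : S ∪ T = U) :
    moment π (S :: L) + moment π (T :: L) = moment π (U :: L) := by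
  have h1 : ∀ V ∈ S :: L, MeasurableSet V := List.forall_mem_cons.2 ⟨hS, hL⟩
  have h2 : ∀ V ∈ T :: L, MeasurableSet V := List.forall_mem_cons.2 ⟨hT, hL⟩
  rw [moment, moment, ← integral_add (integrable_list_prod_real π h1)
    (integrable_list_prod_real π h2), moment]
  refine integral_congr_ae (ae_of_all _ fun P => ?_)
  simp only [List.map_cons, List.prod_cons, ← hU, measureReal_union (μ := (P : Measure C)) hd hT,
    add_mul]

lemma moment_univ_cons (L : List (Set C)) : moment π (univ :: L) = moment π L :=
  integral_congr_ae (ae_of_all _ fun P => by simp)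

lemma moment_add_compl {A : Set C} {L : List (Set C)} (hA : MeasurableSet A)
    (hL : ∀ S ∈ L, MeasurableSet S) :
    moment π (A :: L) + moment π (Aᶜ :: L) = moment π L := by
  rw [moment_cons_congr_add hA hA.compl hL disjoint_compl_right (union_compl_self A),
    moment_univ_cons]

/-- The predictive probability of every set, given at least two observations each of which is
known to lie in some set inside it or inside its complement, depends only on the numbers of
observations on either side. -/
def CountPredictive (π : ProbabilityMeasure (ProbabilityMeasure C)) : Prop :=
  ∀ A : Set C, MeasurableSet A → ∃ γ : ℕ → ℕ → ℝ, ∀ L₁ L₂ : List (Set C),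
    (∀ S ∈ L₁, MeasurableSet S ∧ S ⊆ A) → (∀ S ∈ L₂, MeasurableSet S ∧ S ⊆ Aᶜ) →
    2 ≤ L₁.length + L₂.length →
    moment π (A :: (L₁ ++ L₂)) = γ L₁.length L₂.length * moment π (L₁ ++ L₂)

/-- If `P(B)` and `P(Bᶜ)` are both positive with positive probability, then the predictive
probability of `B` after two observations outside `B` is positive. -/
lemma CountPredictive.moment_cons_ne_zero (h : CountPredictive π) {B S T : Set C}
    (hB : MeasurableSet B) (hBn : moment π [B, Bᶜ] ≠ 0) (hS : MeasurableSet S)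
    (hT : MeasurableSet T) (hSB : Disjoint S B) (hTB : Disjoint T B) (h0 : moment π [S, T] ≠ 0) :
    moment π [B, S, T] ≠ 0 := by
  obtain ⟨γ, hγ⟩ := h B hB
  have h1 := hγ [] [Bᶜ, Bᶜ] (by simp) (by simp [hB.compl]) (by simp)
  have h2 := hγ [] [S, T] (by simp)
    (by simp [hS, hT, subset_compl_iff_disjoint_right, hSB, hTB]) (by simp)
  have h3 : moment π [B, Bᶜ, Bᶜ] ≠ 0 :=
    moment_ne_zero_of_subset (L := [B, Bᶜ]) (by simp [hB, hB.compl]) (by simp [hB, hB.compl])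
      (by simp) hBn
  simp only [List.nil_append, List.length_nil, List.length_cons] at h1 h2
  rw [h1] at h3
  rw [h2]
  exact mul_ne_zero (left_ne_zero_of_mul h3) h0

lemma CountPredictive.moment_pair_ne_zero (h : CountPredictive π) {B S : Set C}
    (hB : MeasurableSet B) (hBn : moment π [B, Bᶜ] ≠ 0) (hS : MeasurableSet S)
    (hSB : Disjoint S B) (h0 : moment π [S] ≠ 0) : moment π [B, S] ≠ 0 := by
  have h1 : moment π [S, S] ≠ 0 :=
    moment_ne_zero_of_subset (L := [S]) (by simp [hS]) (by simp [hS]) (by simp) h0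
  exact moment_ne_zero_of_subset (L := [B, S, S]) (by simp [hS, hB]) (by simp [hS, hB]) (by simp)
    (h.moment_cons_ne_zero hB hBn hS hS hSB hSB h1)

/-- As soon as some `P(B)` is strictly between zero and one with positive probability, this holds
for all sets whose mean mass is. -/
lemma CountPredictive.nontrivial (h : CountPredictive π) {B E : Set C}
    (hB : MeasurableSet B) (hBn : moment π [B, Bᶜ] ≠ 0) (hE : MeasurableSet E)
    (h1 : moment π [E] ≠ 0) (h2 : moment π [Eᶜ] ≠ 0) : moment π [E, Eᶜ] ≠ 0 := by
  have hEc := hE.compl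
  have hBc := hB.compl
  by_contra hcon
  -- split `B` and `Bᶜ` by `E`: one of them meets `E` or `Eᶜ` in a set that is not trivial
  have hsplit : moment π [B ∩ E, Bᶜ ∩ E] ≠ 0 ∨ moment π [B ∩ Eᶜ, Bᶜ ∩ Eᶜ] ≠ 0 := by
    by_contra! hz
    refine hBn ?_
    have hz3 : moment π [B ∩ E, Bᶜ ∩ Eᶜ] = 0 := by
      by_contra hne
      exact moment_ne_zero_of_subset (L' := [E, Eᶜ]) (by simp [hB, hE]) (by simp [hE])
        (by simp) hne hcon
    have hz4 : moment π [B ∩ Eᶜ, Bᶜ ∩ E] = 0 := by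
      by_contra hne
      exact moment_ne_zero_of_subset (L' := [E, Eᶜ]) (by simp [hB, hE]) (by simp [hE])
        (by simp) hne hcon
    have hd : ∀ U : Set C, Disjoint (U ∩ E) (U ∩ Eᶜ) := fun U =>
      disjoint_compl_right.mono inter_subset_right inter_subset_right
    have e1 := moment_cons_congr_add (π := π) (L := [Bᶜ]) (hB.inter hE) (hB.inter hEc)
      (by simp [hB]) (hd B) (inter_union_compl B E)
    have e2 := moment_cons_congr_add (π := π) (L := [B ∩ E]) (hBc.inter hE) (hBc.inter hEc)
      (by simp [hB, hE]) (hd Bᶜ) (inter_union_compl Bᶜ E)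
    have e3 := moment_cons_congr_add (π := π) (L := [B ∩ Eᶜ]) (hBc.inter hE) (hBc.inter hEc)
      (by simp [hB, hE]) (hd Bᶜ) (inter_union_compl Bᶜ E)
    have sw : ∀ U V : Set C, moment π [U, V] = moment π [V, U] :=
      fun U V => moment_perm (List.Perm.swap _ _ _)
    rw [← e1, sw (B ∩ E) Bᶜ, sw (B ∩ Eᶜ) Bᶜ, ← e2, ← e3, sw _ (B ∩ E), sw _ (B ∩ E),
      sw _ (B ∩ Eᶜ), sw _ (B ∩ Eᶜ), hz.1, hz.2, hz3, hz4]
    norm_num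
  rcases hsplit with h3 | h3
  · have hn : moment π [B ∩ E, (B ∩ E)ᶜ] ≠ 0 :=
      moment_ne_zero_of_subset (L := [B ∩ E, Bᶜ ∩ E]) (by simp [hB, hE]) (by simp [hB, hE])
        (by simp; right; exact fun x hx hx' => hx.1 hx'.1) h3
    have h4 := h.moment_pair_ne_zero (hB.inter hE) hn hEc
      (disjoint_compl_left.mono_right inter_subset_right) h2
    exact moment_ne_zero_of_subset (L' := [E, Eᶜ]) (by simp [hB, hE]) (by simp [hE])
      (by simp) h4 hcon
  · have hn : moment π [B ∩ Eᶜ, (B ∩ Eᶜ)ᶜ] ≠ 0 :=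
      moment_ne_zero_of_subset (L := [B ∩ Eᶜ, Bᶜ ∩ Eᶜ]) (by simp [hB, hE]) (by simp [hB, hE])
        (by simp only [List.mem_cons, List.not_mem_nil, or_false, forall_eq_or_imp, forall_eq]
            exact ⟨⟨_, Or.inl rfl, subset_rfl⟩, _, Or.inr rfl, fun x hx hx' => hx.1 hx'.1⟩) h3
    have h4 := h.moment_pair_ne_zero (hB.inter hEc) hn hE
      (disjoint_compl_right.mono_right inter_subset_right) h1
    exact moment_ne_zero_of_subset (L' := [E, Eᶜ]) (by simp [hB, hE]) (by simp [hE])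
      (by simp) h4 hcon

/-- The predictive probabilities of `E` are those of a Pólya urn with correlation `t`, the
precision being `(1 - t) / t`. -/
def UrnLaw (π : ProbabilityMeasure (ProbabilityMeasure C)) (E : Set C) (t : ℝ) : Prop :=
  ∀ L₁ L₂ : List (Set C), (∀ S ∈ L₁, MeasurableSet S ∧ S ⊆ E) →
    (∀ S ∈ L₂, MeasurableSet S ∧ S ⊆ Eᶜ) →
    (1 + ((L₁.length : ℝ) + L₂.length - 1) * t) * moment π (E :: (L₁ ++ L₂)) =
      ((1 - t) * moment π [E] + L₁.length * t) * moment π (L₁ ++ L₂)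

lemma measurableSet_of_mem_append {L₁ L₂ : List (Set C)} {E F : Set C}
    (h₁ : ∀ S ∈ L₁, MeasurableSet S ∧ S ⊆ E) (h₂ : ∀ S ∈ L₂, MeasurableSet S ∧ S ⊆ F) :
    ∀ S ∈ L₁ ++ L₂, MeasurableSet S := by
  intro S hS
  rcases List.mem_append.1 hS with h | h
  exacts [(h₁ S h).1, (h₂ S h).1]

lemma UrnLaw.compl {E : Set C} {t : ℝ} (h : UrnLaw π E t) (hE : MeasurableSet E) :
    UrnLaw π Eᶜ t := by
  intro L₁ L₂ h₁ h₂
  have hm := measurableSet_of_mem_append h₁ h₂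
  have h3 := h L₂ L₁ (by simpa using h₂) h₁
  have hp : moment π (L₂ ++ L₁) = moment π (L₁ ++ L₂) := moment_perm List.perm_append_comm
  have hp' : moment π (E :: (L₂ ++ L₁)) = moment π (E :: (L₁ ++ L₂)) :=
    moment_perm (List.perm_append_comm.cons _)
  have h4 := moment_add_compl (π := π) hE hm
  have h5 := moment_add_compl (π := π) (L := []) hE (by simp)
  rw [moment_nil] at h5
  rw [hp, hp'] at h3
  rw [← eq_sub_iff_add_eq'] at h4 h5
  rw [h4, h5]
  linear_combination -h3

/-- It suffices to know the predictive probabilities after at least two observations. -/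
lemma urnLaw_of_two_le {E : Set C} {t : ℝ} (hE : MeasurableSet E)
    (h : ∀ L₁ L₂ : List (Set C), (∀ S ∈ L₁, MeasurableSet S ∧ S ⊆ E) →
      (∀ S ∈ L₂, MeasurableSet S ∧ S ⊆ Eᶜ) → 2 ≤ L₁.length + L₂.length →
      (1 + ((L₁.length : ℝ) + L₂.length - 1) * t) * moment π (E :: (L₁ ++ L₂)) =
        ((1 - t) * moment π [E] + L₁.length * t) * moment π (L₁ ++ L₂)) : UrnLaw π E t := by
  have step : ∀ j : ℕ, j ≤ 2 → ∀ L₁ L₂ : List (Set C), (∀ S ∈ L₁, MeasurableSet S ∧ S ⊆ E) →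
      (∀ S ∈ L₂, MeasurableSet S ∧ S ⊆ Eᶜ) → 2 ≤ L₁.length + L₂.length + j →
      (1 + ((L₁.length : ℝ) + L₂.length - 1) * t) * moment π (E :: (L₁ ++ L₂)) =
        ((1 - t) * moment π [E] + L₁.length * t) * moment π (L₁ ++ L₂) := by
    intro j
    induction j with
    | zero => exact fun _ L₁ L₂ h₁ h₂ hn => h L₁ L₂ h₁ h₂ hn
    | succ j ih =>
      intro hj L₁ L₂ h₁ h₂ hn
      have hm := measurableSet_of_mem_append h₁ h₂
      have e1 := ih (by omega) (E :: L₁) L₂ (List.forall_mem_cons.2 ⟨⟨hE, subset_rfl⟩, h₁⟩) h₂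
        (by simp; omega)
      have e2 := ih (by omega) L₁ (Eᶜ :: L₂) h₁
        (List.forall_mem_cons.2 ⟨⟨hE.compl, subset_rfl⟩, h₂⟩) (by simp; omega)
      have hp : moment π (L₁ ++ Eᶜ :: L₂) = moment π (Eᶜ :: (L₁ ++ L₂)) :=
        moment_perm List.perm_middle
      have hp' : moment π (E :: (L₁ ++ Eᶜ :: L₂)) = moment π (Eᶜ :: E :: (L₁ ++ L₂)) :=
        moment_perm ((List.perm_middle.cons _).trans (List.Perm.swap _ _ _))
      have a1 := moment_add_compl (π := π) (L := E :: (L₁ ++ L₂)) hE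
        (List.forall_mem_cons.2 ⟨hE, hm⟩)
      have a2 := moment_add_compl (π := π) hE hm
      rw [hp, hp'] at e2
      simp only [List.cons_append, List.length_cons] at e1 e2
      push_cast at e1 e2
      linear_combination e1 + e2 - (1 + ((L₁.length : ℝ) + L₂.length) * t) * a1 +
        ((1 - t) * moment π [E] + L₁.length * t) * a2
  exact fun L₁ L₂ h₁ h₂ => step 2 le_rfl L₁ L₂ h₁ h₂ (by omega)

lemma moment_cons_eq_zero {E : Set C} (hE : MeasurableSet E) (h0 : moment π [E] = 0)
    {L : List (Set C)} (hL : ∀ S ∈ L, MeasurableSet S) : moment π (E :: L) = 0 := by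
  by_contra h
  exact moment_ne_zero_of_subset (L := E :: L) (L' := [E]) (List.forall_mem_cons.2 ⟨hE, hL⟩)
    (by simp [hE]) (by simp only [List.mem_singleton, forall_eq]
                       exact ⟨E, List.mem_cons_self, subset_rfl⟩) h h0

lemma urnLaw_of_null {E : Set C} (hE : MeasurableSet E) (h0 : moment π [E] = 0) (t : ℝ) :
    UrnLaw π E t := by
  intro L₁ L₂ h₁ h₂
  have hm := measurableSet_of_mem_append h₁ h₂
  rw [moment_cons_eq_zero hE h0 hm, h0]
  cases L₁ with
  | nil => simp
  | cons S L₁ =>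
    have hS := h₁ S (by simp)
    have : moment π [S] = 0 := by
      by_contra h
      exact moment_ne_zero_of_subset (L := [S]) (L' := [E]) (by simp [hS.1]) (by simp [hE])
        (by simp [hS.2]) h h0
    rw [List.cons_append, moment_cons_eq_zero hS.1 this fun T hT => hm T (by simp [hT])]
    simp

lemma UrnLaw.moment_self {E : Set C} {t : ℝ} (h : UrnLaw π E t) (hE : MeasurableSet E) :
    moment π [E, E] = ((1 - t) * moment π [E] + t) * moment π [E] := by
  have := h [E] [] (by simp [hE]) (by simp)
  simpa using this

lemma moment_compl {E : Set C} (hE : MeasurableSet E) : moment π [Eᶜ] = 1 - moment π [E] := by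
  have h5 := moment_add_compl (π := π) (L := []) hE (by simp)
  rw [moment_nil] at h5
  linarith

lemma eq_of_moment_self {ρ m s t : ℝ} (h1 : ρ ≠ 0) (h2 : 1 - ρ ≠ 0)
    (hs : m = ((1 - s) * ρ + s) * ρ) (ht : m = ((1 - t) * ρ + t) * ρ) : s = t := by
  refine mul_right_cancel₀ (mul_ne_zero h1 h2) ?_
  linear_combination ht - hs

lemma UrnLaw.unique {E : Set C} {s t : ℝ} (hE : MeasurableSet E) (h1 : moment π [E] ≠ 0)
    (h2 : moment π [Eᶜ] ≠ 0) (hs : UrnLaw π E s) (ht : UrnLaw π E t) : s = t :=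
  eq_of_moment_self h1 (moment_compl hE ▸ h2) (hs.moment_self hE) (ht.moment_self hE)

/-- Three disjoint sets of positive mean mass behave as the colours of one and the same urn. -/
lemma CountPredictive.exists_urnLaw_of_disjoint (h : CountPredictive π) {B₀ : Set C}
    (hB₀ : MeasurableSet B₀) (hB₀n : moment π [B₀, B₀ᶜ] ≠ 0) {A B : Set C}
    (hA : MeasurableSet A) (hB : MeasurableSet B) (hAB : Disjoint A B) (hA0 : moment π [A] ≠ 0)
    (hB0 : moment π [B] ≠ 0) (hD0 : moment π [(A ∪ B)ᶜ] ≠ 0) :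
    ∃ t, UrnLaw π A t ∧ UrnLaw π B t := by
  set D := (A ∪ B)ᶜ with hDdef
  have hD : MeasurableSet D := (hA.union hB).compl
  have hDA : Disjoint D A := (disjoint_compl_left (a := A ∪ B)).mono_right subset_union_left
  have hDB : Disjoint D B := (disjoint_compl_left (a := A ∪ B)).mono_right subset_union_right
  have hADc : A ⊆ Dᶜ := subset_compl_iff_disjoint_left.2 hDA
  have hBDc : B ⊆ Dᶜ := subset_compl_iff_disjoint_left.2 hDB
  have hABc : A ⊆ Bᶜ := subset_compl_iff_disjoint_right.2 hAB
  have hBAc : B ⊆ Aᶜ := subset_compl_iff_disjoint_left.2 hAB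
  have hDAc : D ⊆ Aᶜ := subset_compl_iff_disjoint_right.2 hDA
  have hDBc : D ⊆ Bᶜ := subset_compl_iff_disjoint_right.2 hDB
  have hAc0 : moment π [Aᶜ] ≠ 0 := moment_ne_zero_of_subset (L := [B]) (by simp [hB])
    (by simp [hA]) (by simp [hBAc]) hB0
  have hDc0 : moment π [Dᶜ] ≠ 0 := moment_ne_zero_of_subset (L := [A]) (by simp [hA])
    (by simp [hD]) (by simp [hADc]) hA0
  have hAB0 : moment π [A, B] ≠ 0 := h.moment_pair_ne_zero hA
    (h.nontrivial hB₀ hB₀n hA hA0 hAc0) hB hAB.symm hB0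
  have h3 : moment π [D, A, B] ≠ 0 := h.moment_cons_ne_zero hD
    (h.nontrivial hB₀ hB₀n hD hD0 hDc0) hA hB hDA.symm hDB.symm hAB0
  obtain ⟨a, ha⟩ := h A hA
  obtain ⟨b, hb⟩ := h B hB
  obtain ⟨d, hd⟩ := h D hD
  set e : ℕ → ℕ → ℕ → ℝ := fun k l m => moment π
    (List.replicate k A ++ (List.replicate l B ++ List.replicate m D)) with he
  have hrep : ∀ (k : ℕ) (S T : Set C), MeasurableSet S → S ⊆ T →
      ∀ U ∈ List.replicate k S, MeasurableSet U ∧ U ⊆ T := by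
    intro k S T hS hST U hU
    rw [List.eq_of_mem_replicate hU]
    exact ⟨hS, hST⟩
  have happ : ∀ {L L' : List (Set C)} {T : Set C}, (∀ U ∈ L, MeasurableSet U ∧ U ⊆ T) →
      (∀ U ∈ L', MeasurableSet U ∧ U ⊆ T) → ∀ U ∈ L ++ L', MeasurableSet U ∧ U ⊆ T := by
    intro L L' T h1 h2 U hU
    rcases List.mem_append.1 hU with h | h
    exacts [h1 U h, h2 U h]
  have hmeas : ∀ k l m, ∀ U ∈ List.replicate k A ++ (List.replicate l B ++ List.replicate m D),
      MeasurableSet U := fun k l m U hU =>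
    (happ (hrep k A univ hA (subset_univ _)) (happ (hrep l B univ hB (subset_univ _))
      (hrep m D univ hD (subset_univ _))) U hU).1
  have hA1 : ∀ k l m, e (k + 1) l m = moment π (A :: (List.replicate k A ++
      (List.replicate l B ++ List.replicate m D))) := by
    intro k l m
    simp only [he, List.replicate_succ, List.cons_append]
  have hB1 : ∀ k l m, e k (l + 1) m = moment π (B :: (List.replicate k A ++
      (List.replicate l B ++ List.replicate m D))) := by
    intro k l m
    simp only [he, List.replicate_succ, List.cons_append]
    exact moment_perm List.perm_middle
  have hD1 : ∀ k l m, e k l (m + 1) = moment π (D :: (List.replicate k A ++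
      (List.replicate l B ++ List.replicate m D))) := by
    intro k l m
    simp only [he, List.replicate_succ]
    exact moment_perm ((List.perm_middle.append_left _).trans List.perm_middle)
  have hpos : ∀ k l m, e k l m ≠ 0 := by
    intro k l m
    refine moment_ne_zero_of_subset (L := [D, A, B]) (by simp [hA, hB, hD]) (hmeas k l m) ?_ h3
    intro S hS
    refine ⟨S, ?_, subset_rfl⟩
    simp only [List.mem_append, List.mem_replicate] at hS
    simp only [List.mem_cons, List.not_mem_nil, or_false]
    tauto
  have hsum : ∀ k l m, e (k + 1) l m + e k (l + 1) m + e k l (m + 1) = e k l m := by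
    intro k l m
    rw [hA1, hB1, hD1, moment_cons_congr_add hA hB (hmeas k l m) hAB rfl,
      moment_add_compl (hA.union hB) (hmeas k l m)]
  have h000 : e 0 0 0 = 1 := by simp [he]
  obtain ⟨t, ht⟩ := exists_urn_of_three hpos hsum h000 (a := fun n k => a k (n - k))
    (b := fun n k => b k (n - k)) (d := fun n k => d k (n - k))
    (fun k l m hn => by
      have := ha (List.replicate k A) (List.replicate l B ++ List.replicate m D)
        (hrep _ _ _ hA subset_rfl) (happ (hrep _ _ _ hB hBAc) (hrep _ _ _ hD hDAc))
        (by simp; omega)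
      rw [hA1, this]
      simp [add_assoc, he])
    (fun k l m hn => by
      have := hb (List.replicate l B) (List.replicate k A ++ List.replicate m D)
        (hrep _ _ _ hB subset_rfl) (happ (hrep _ _ _ hA hABc) (hrep _ _ _ hD hDBc))
        (by simp; omega)
      have hp : (List.replicate l B ++ (List.replicate k A ++ List.replicate m D)).Perm
          (List.replicate k A ++ (List.replicate l B ++ List.replicate m D)) := by
        rw [← List.append_assoc, ← List.append_assoc]
        exact List.perm_append_comm.append_right _
      rw [moment_perm hp, moment_perm (hp.cons B), ← hB1] at this
      rw [this]
      simp [he, show k + l + m - l = k + m by omega])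
    (fun k l m hn => by
      have := hd (List.replicate m D) (List.replicate k A ++ List.replicate l B)
        (hrep _ _ _ hD subset_rfl) (happ (hrep _ _ _ hA hADc) (hrep _ _ _ hB hBDc))
        (by simp; omega)
      have hp : (List.replicate m D ++ (List.replicate k A ++ List.replicate l B)).Perm
          (List.replicate k A ++ (List.replicate l B ++ List.replicate m D)) := by
        rw [← List.append_assoc (List.replicate k A)]
        exact List.perm_append_comm
      rw [moment_perm hp, moment_perm (hp.cons D), ← hD1] at this
      rw [this]
      simp [he])
  have e100 : e 1 0 0 = moment π [A] := by simp [he]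
  have e010 : e 0 1 0 = moment π [B] := by simp [he]
  refine ⟨t, urnLaw_of_two_le hA fun L₁ L₂ h₁ h₂ hn => ?_,
    urnLaw_of_two_le hB fun L₁ L₂ h₁ h₂ hn => ?_⟩
  · have h4 := (ht _ hn L₁.length (by omega)).1
    rw [ha L₁ L₂ h₁ h₂ hn, ← mul_assoc]
    rw [e100, Nat.add_sub_cancel_left] at h4
    push_cast at h4
    rw [h4]
  · have h4 := (ht _ hn L₁.length (by omega)).2
    rw [hb L₁ L₂ h₁ h₂ hn, ← mul_assoc]
    rw [e010, Nat.add_sub_cancel_left] at h4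
    push_cast at h4
    rw [h4]

/-- Disjoint sets have the same correlation: either there is room for a third set, or the two
events are complementary. -/
lemma CountPredictive.urnLaw_eq_of_disjoint (h : CountPredictive π) {B₀ : Set C}
    (hB₀ : MeasurableSet B₀) (hB₀n : moment π [B₀, B₀ᶜ] ≠ 0) {E F : Set C}
    (hE : MeasurableSet E) (hF : MeasurableSet F) (hEF : Disjoint E F) (hE0 : moment π [E] ≠ 0)
    (hF0 : moment π [F] ≠ 0) {s t : ℝ} (hs : UrnLaw π E s) (ht : UrnLaw π F t) : s = t := by
  have hEc0 : moment π [Eᶜ] ≠ 0 := moment_ne_zero_of_subset (L := [F]) (by simp [hF])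
    (by simp [hE]) (by simpa using subset_compl_iff_disjoint_left.2 hEF) hF0
  have hFc0 : moment π [Fᶜ] ≠ 0 := moment_ne_zero_of_subset (L := [E]) (by simp [hE])
    (by simp [hF]) (by simpa using subset_compl_iff_disjoint_right.2 hEF) hE0
  by_cases hD : moment π [(E ∪ F)ᶜ] = 0
  · rw [moment_eq_zero_iff (by simp [hE, hF])] at hD
    have hP : ∀ᵐ P : ProbabilityMeasure C ∂(π : Measure (ProbabilityMeasure C)),
        (P : Measure C).real F = (P : Measure C).real Eᶜ := by
      filter_upwards [hD] with P hP
      simp only [List.mem_singleton, exists_eq_left, probReal_compl_eq_one_sub (hE.union hF),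
        measureReal_union (μ := (P : Measure C)) hEF hF] at hP
      rw [probReal_compl_eq_one_sub hE]
      linarith
    have m1 : moment π [F] = moment π [Eᶜ] := integral_congr_ae
      (by
      filter_upwards [hP] with P hP
      simp only [List.map_cons, List.map_nil, hP])
    have m2 : moment π [F, F] = moment π [Eᶜ, Eᶜ] := integral_congr_ae
      (by
      filter_upwards [hP] with P hP
      simp only [List.map_cons, List.map_nil, hP])
    have h1 := (hs.compl hE).moment_self hE.compl
    rw [← m1, ← m2] at h1
    exact eq_of_moment_self hF0 (moment_compl hF ▸ hFc0) h1 (ht.moment_self hF)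
  · obtain ⟨r, hr1, hr2⟩ := h.exists_urnLaw_of_disjoint hB₀ hB₀n hE hF hEF hE0 hF0 hD
    rw [hs.unique hE hE0 hEc0 hr1, ht.unique hF hF0 hFc0 hr2]

/-- If the space splits into three sets of positive mean mass, then all sets follow the law of one
and the same urn. -/
lemma CountPredictive.exists_urnLaw (h : CountPredictive π) {B₀ : Set C}
    (hB₀ : MeasurableSet B₀) (hB₀n : moment π [B₀, B₀ᶜ] ≠ 0) {A B : Set C}
    (hA : MeasurableSet A) (hB : MeasurableSet B) (hAB : Disjoint A B) (hA0 : moment π [A] ≠ 0)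
    (hB0 : moment π [B] ≠ 0) (hD0 : moment π [(A ∪ B)ᶜ] ≠ 0) :
    ∃ t, ∀ E : Set C, MeasurableSet E → UrnLaw π E t := by
  have hmono : ∀ {S T : Set C}, MeasurableSet S → MeasurableSet T → S ⊆ T → moment π [S] ≠ 0 →
      moment π [T] ≠ 0 := fun hS hT hST h0 =>
    moment_ne_zero_of_subset (L := [_]) (by simp [hS]) (by simp [hT]) (by simpa using hST) h0
  have hcut : ∀ {S E : Set C}, MeasurableSet S → MeasurableSet E → moment π [S] ≠ 0 →
      moment π [E ∩ S] ≠ 0 ∨ moment π [Eᶜ ∩ S] ≠ 0 := by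
    intro S E hS hE h0
    by_contra! hz
    refine h0 ?_
    rw [← moment_cons_congr_add (L := []) (hE.inter hS) (hE.compl.inter hS) (by simp)
      (disjoint_compl_right.mono inter_subset_left inter_subset_left)
      (by rw [← union_inter_distrib_right, union_compl_self, univ_inter]), hz.1, hz.2, add_zero]
  -- if two of three disjoint sets meet `E` in positive mean mass, then `E` splits
  have hsplit : ∀ {E S T : Set C}, MeasurableSet E → MeasurableSet S → MeasurableSet T →
      Disjoint S T → moment π [E ∩ S] ≠ 0 → moment π [E ∩ T] ≠ 0 → moment π [Eᶜ] ≠ 0 →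
      ∃ t, UrnLaw π E t := by
    intro E S T hE hS hT hST h1 h2 h3
    obtain ⟨t, ht, -⟩ := h.exists_urnLaw_of_disjoint hB₀ hB₀n hE.compl (hE.inter hS)
      (disjoint_compl_left.mono_right inter_subset_left) h3 h1
      (hmono (hE.inter hT) (hE.compl.union (hE.inter hS)).compl (by
        rintro x ⟨hx, hxT⟩ (hx' | hx')
        exacts [hx' hx, hST.le_bot ⟨hx'.2, hxT⟩]) h2)
    exact ⟨t, by simpa using ht.compl hE.compl⟩
  have hDA : Disjoint A (A ∪ B)ᶜ := (disjoint_compl_right (a := A ∪ B)).mono_left subset_union_left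
  have hDB : Disjoint B (A ∪ B)ᶜ :=
    (disjoint_compl_right (a := A ∪ B)).mono_left subset_union_right
  have hD : MeasurableSet (A ∪ B)ᶜ := (hA.union hB).compl
  have hex : ∀ E : Set C, MeasurableSet E → moment π [E] ≠ 0 → moment π [Eᶜ] ≠ 0 →
      ∃ t, UrnLaw π E t := by
    intro E hE h1 h2
    have hE2 : moment π [Eᶜᶜ] ≠ 0 := by rwa [compl_compl]
    have hcc : (∃ t, UrnLaw π Eᶜ t) → ∃ t, UrnLaw π E t :=
      fun ⟨t, ht⟩ => ⟨t, by simpa using ht.compl hE.compl⟩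
    rcases hcut hA hE hA0 with a | a <;> rcases hcut hB hE hB0 with b | b
    · exact hsplit hE hA hB hAB a b h2
    · rcases hcut hD hE hD0 with d | d
      · exact hsplit hE hA hD hDA a d h2
      · exact hcc (hsplit hE.compl hB hD hDB b d hE2)
    · rcases hcut hD hE hD0 with d | d
      · exact hsplit hE hB hD hDB b d h2
      · exact hcc (hsplit hE.compl hA hD hDA a d hE2)
    · exact hcc (hsplit hE.compl hA hB hAB a b hE2)
  have hAc0 : moment π [Aᶜ] ≠ 0 :=
    hmono hB hA.compl (subset_compl_iff_disjoint_left.2 hAB) hB0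
  obtain ⟨t, ht⟩ := hex A hA hA0 hAc0
  refine ⟨t, fun E hE => ?_⟩
  by_cases h1 : moment π [E] = 0
  · exact urnLaw_of_null hE h1 t
  by_cases h2 : moment π [Eᶜ] = 0
  · simpa using (urnLaw_of_null hE.compl h2 t).compl hE.compl
  obtain ⟨s, hs⟩ := hex E hE h1 h2
  suffices hst : s = t from hst ▸ hs
  -- a positive part of `A` inside `E` or `Eᶜ` is disjoint from `Aᶜ` and from `Eᶜ` or `E`
  rcases hcut hA hE hA0 with h3 | h3
  · have hG := hE.inter hA
    obtain ⟨r, hr⟩ := hex _ hG h3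
      (hmono hE.compl hG.compl (compl_subset_compl.2 inter_subset_left) h2)
    rw [← h.urnLaw_eq_of_disjoint hB₀ hB₀n hG hE.compl
      (disjoint_compl_right.mono_left inter_subset_left) h3 h2 hr (hs.compl hE)]
    exact h.urnLaw_eq_of_disjoint hB₀ hB₀n hG hA.compl
      (disjoint_compl_right.mono_left inter_subset_right) h3 hAc0 hr (ht.compl hA)
  · have hG := hE.compl.inter hA
    obtain ⟨r, hr⟩ := hex _ hG h3
      (hmono hE hG.compl (fun x hx hx' => hx'.1 hx) h1)
    rw [← h.urnLaw_eq_of_disjoint hB₀ hB₀n hG hE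
      (disjoint_compl_left.mono_left inter_subset_left) h3 h1 hr hs]
    exact h.urnLaw_eq_of_disjoint hB₀ hB₀n hG hA.compl
      (disjoint_compl_right.mono_left inter_subset_right) h3 hAc0 hr (ht.compl hA)

end Moments

/-! ### Characterization of the prior -/

section Characterization

variable {C : Type u} [MeasurableSpace C] {π : ProbabilityMeasure (ProbabilityMeasure C)}

/-- The mean measure `E[P(·)]` of a random probability measure. -/
def meanMeasure (π : ProbabilityMeasure (ProbabilityMeasure C)) : ProbabilityMeasure C :=
  ⟨evalKernel C ∘ₘ (π : Measure (ProbabilityMeasure C)), inferInstance⟩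

lemma meanMeasure_apply {E : Set C} (hE : MeasurableSet E) :
    (meanMeasure π : Measure C) E =
      ∫⁻ P : ProbabilityMeasure C, (P : Measure C) E ∂(π : Measure (ProbabilityMeasure C)) :=
  Measure.bind_apply hE (Kernel.aemeasurable _)

lemma meanMeasure_real {E : Set C} (hE : MeasurableSet E) :
    (meanMeasure π : Measure C).real E = moment π [E] := by
  have h := ofReal_moment π (L := [E]) (by simp [hE])
  simp only [List.map_cons, List.map_nil, List.prod_cons, List.prod_nil, mul_one] at h
  rw [Measure.real, meanMeasure_apply hE, ← h, ENNReal.toReal_ofReal (moment_nonneg _ _)]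

lemma ae_measure_eq_zero {E : Set C} (hE : MeasurableSet E)
    (h : (meanMeasure π : Measure C) E = 0) :
    ∀ᵐ P : ProbabilityMeasure C ∂(π : Measure (ProbabilityMeasure C)),
      (P : Measure C) E = 0 := by
  rw [meanMeasure_apply hE] at h
  exact (lintegral_eq_zero_iff ((Measure.measurable_coe hE).comp measurable_subtype_coe)).1 h

/-- In a standard Borel space, countably many measurable sets determine all probability
measures. -/
lemma exists_determining_sets (C : Type u) [MeasurableSpace C] [StandardBorelSpace C] :
    ∃ s : ℚ → Set C, (∀ q, MeasurableSet (s q)) ∧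
      ∀ P Q : ProbabilityMeasure C, (∀ q, (P : Measure C) (s q) = (Q : Measure C) (s q)) →
        P = Q := by
  have hφ := measurableEmbedding_embeddingReal C
  refine ⟨fun q => embeddingReal C ⁻¹' Iio (q : ℝ), fun q => hφ.measurable measurableSet_Iio,
    fun P Q h => ?_⟩
  have key : (P : Measure C).map (embeddingReal C) = (Q : Measure C).map (embeddingReal C) := by
    have := Measure.isProbabilityMeasure_map (μ := (P : Measure C)) hφ.measurable.aemeasurable
    refine ext_of_generate_finite _ (BorelSpace.measurable_eq.trans
      Real.borel_eq_generateFrom_Iio_rat) Real.isPiSystem_Iio_rat (fun t ht => ?_) ?_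
    · obtain ⟨q, rfl⟩ := mem_iUnion.1 ht
      rw [Measure.map_apply hφ.measurable measurableSet_Iio,
        Measure.map_apply hφ.measurable measurableSet_Iio, h q]
    · rw [Measure.map_apply hφ.measurable .univ, Measure.map_apply hφ.measurable .univ]
      simp
  refine Subtype.ext ?_
  have := congrArg (Measure.comap (embeddingReal C)) key
  rwa [hφ.comap_map, hφ.comap_map] at this

/-- If every `P(E)` is almost surely zero or one, then the random measure is a random point
mass. -/
lemma exists_map_pointMass [StandardBorelSpace C]
    (h : ∀ E : Set C, MeasurableSet E → moment π [E, Eᶜ] = 0) :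
    (π : Measure (ProbabilityMeasure C)) = (meanMeasure π : Measure C).map pointMass := by
  set s := MeasurableSpace.natGeneratingSequence C with hs
  have hsm : ∀ n, MeasurableSet (s n) := MeasurableSpace.measurableSet_natGeneratingSequence
  have hae : ∀ᵐ P : ProbabilityMeasure C ∂(π : Measure (ProbabilityMeasure C)), ∀ n,
      ∃ S ∈ [s n, (s n)ᶜ], (P : Measure C).real S = 0 :=
    ae_all_iff.2 fun n => (moment_eq_zero_iff (by simp [hsm])).1 (h (s n) (hsm n))
  have hdirac : ∀ᵐ P : ProbabilityMeasure C ∂(π : Measure (ProbabilityMeasure C)),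
      ∃ c, (P : Measure C) = Measure.dirac c := by
    filter_upwards [hae] with P hP
    have : IsZeroOneMeasure (P : Measure C) := by
      refine ⟨fun E hE => ?_⟩
      -- the sets of mass zero or one form a σ-algebra
      rw [← MeasurableSpace.generateFrom_natGeneratingSequence C] at hE
      induction E, hE using MeasurableSpace.generateFrom_induction with
      | hC t ht _ =>
        obtain ⟨n, rfl⟩ := ht
        obtain ⟨S, hS, hS0⟩ := hP n
        rw [measureReal_eq_zero_iff] at hS0
        rcases List.mem_pair.1 hS with rfl | rfl
        · exact Or.inl hS0
        · exact Or.inr ((prob_compl_eq_zero_iff (hsm n)).1 hS0)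
      | empty => simp
      | compl t ht ih =>
        rw [MeasurableSpace.generateFrom_natGeneratingSequence C] at ht
        rcases ih with ih | ih
        · exact Or.inr ((prob_compl_eq_one_iff ht).2 ih)
        · exact Or.inl ((prob_compl_eq_zero_iff ht).2 ih)
      | iUnion t _ ih =>
        by_cases h0 : ∀ n, (P : Measure C) (t n) = 0
        · exact Or.inl (measure_iUnion_null h0)
        · obtain ⟨n, hn⟩ := not_forall.1 h0
          exact Or.inr (le_antisymm prob_le_one
            (((ih n).resolve_left hn).ge.trans (measure_mono (subset_iUnion t n))))
    exact IsZeroOneMeasure.exists_eq_dirac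
  refine Measure.ext fun T hT => ?_
  rw [Measure.map_apply measurable_pointMass hT, meanMeasure_apply (measurable_pointMass hT),
    ← lintegral_indicator_one hT]
  refine lintegral_congr_ae ?_
  filter_upwards [hdirac] with P ⟨c, hc⟩
  have hPc : P = pointMass c := Subtype.ext hc
  rw [hc, Measure.dirac_apply' _ (measurable_pointMass hT), hPc]
  rfl

/-- A measure that cannot be split over a set is concentrated on at most one point of it. -/
lemma exists_atom_of_not_split [StandardBorelSpace C] {ρ : Measure C} [IsProbabilityMeasure ρ]
    {B : Set C} (hB : MeasurableSet B) (hB0 : ρ B ≠ 0)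
    (h : ∀ S, MeasurableSet S → ρ (B ∩ S) = 0 ∨ ρ (B ∩ Sᶜ) = 0) :
    ∃ a, ρ (B ∩ {a}ᶜ) = 0 := by
  have hp : IsProbabilityMeasure ρ[|B] := cond_isProbabilityMeasure hB0
  have h01 : IsZeroOneMeasure ρ[|B] := by
    refine ⟨fun S hS => ?_⟩
    rcases h S hS with h0 | h0
    · left
      rw [cond_apply hB, h0, mul_zero]
    · right
      rw [← prob_compl_eq_zero_iff hS, cond_apply hB, h0, mul_zero]
  obtain ⟨a, ha⟩ := IsZeroOneMeasure.exists_eq_dirac (μ := ρ[|B])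
  refine ⟨a, ?_⟩
  have h1 : ρ[|B] {a}ᶜ = 0 := by
    rw [ha]
    simp
  rw [cond_apply hB, mul_eq_zero] at h1
  exact h1.resolve_left (ENNReal.inv_ne_zero.2 (measure_ne_top _ _))

/-- If the mean measure lives on two points, the random measure is a random mixture of two fixed
point masses. -/
lemma exists_map_twoPointMix [StandardBorelSpace C] {a b : C}
    (h : (meanMeasure π : Measure C) ({a}ᶜ ∩ {b}ᶜ) = 0) :
    ∃ ζ : ProbabilityMeasure unitInterval,
      (π : Measure (ProbabilityMeasure C)) = (ζ : Measure unitInterval).map (twoPointMix a b) := by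
  have hma : MeasurableSet ({a} : Set C) := measurableSet_singleton a
  have hmb : MeasurableSet ({b} : Set C) := measurableSet_singleton b
  set z : ProbabilityMeasure C → unitInterval :=
    fun P => ⟨(P : Measure C).real {a}, measureReal_nonneg, measureReal_le_one⟩ with hz
  have hzm : Measurable z := (measurable_measureReal hma).subtype_mk
  refine ⟨⟨(π : Measure (ProbabilityMeasure C)).map z,
    Measure.isProbabilityMeasure_map hzm.aemeasurable⟩, ?_⟩
  have hP : ∀ᵐ P : ProbabilityMeasure C ∂(π : Measure (ProbabilityMeasure C)),
      twoPointMix a b (z P) = P := by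
    filter_upwards [ae_measure_eq_zero (hma.compl.inter hmb.compl) h] with P hP
    refine Subtype.ext (Measure.ext fun s hs => ?_)
    change (twoPointMix a b (z P) : Measure C) s = (P : Measure C) s
    rw [twoPointMix_apply]
    simp only [Measure.add_apply, Measure.smul_apply, smul_eq_mul, Measure.dirac_apply' _ hs, hz]
    have h1 : ENNReal.ofReal ((P : Measure C).real {a}) = (P : Measure C) {a} :=
      ofReal_measureReal
    have h2 : ENNReal.ofReal (1 - (P : Measure C).real {a}) = (P : Measure C) {a}ᶜ := by
      rw [← probReal_compl_eq_one_sub hma, ofReal_measureReal]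
    rw [h1, h2, ← measure_inter_add_sdiff s hma]
    congr 1
    · by_cases ha : a ∈ s
      · simp [ha, inter_eq_right.2 (singleton_subset_iff.2 ha)]
      · simp [ha, inter_singleton_eq_empty.2 ha]
    · -- off `a`, all the mass sits at `b`
      by_cases hb : b ∈ s
      · rw [indicator_of_mem hb, Pi.one_apply, mul_one]
        refine le_antisymm ?_ (measure_mono fun x hx => hx.2)
        refine (measure_mono (t := (s \ {a}) ∪ ({a}ᶜ ∩ {b}ᶜ)) fun x hx => ?_).trans
          ((measure_union_le _ _).trans (by rw [hP, add_zero]))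
        by_cases hxb : x = b
        · exact Or.inl ⟨hxb ▸ hb, hx⟩
        · exact Or.inr ⟨hx, hxb⟩
      · rw [indicator_of_notMem hb, mul_zero]
        have hsub : s \ {a} ⊆ {a}ᶜ ∩ {b}ᶜ := fun x hx => ⟨hx.2, fun hxb => hb ?_⟩
        · exact (measure_mono_null hsub hP).symm
        rw [← mem_singleton_iff.1 hxb]
        exact hx.1
  rw [ProbabilityMeasure.coe_mk, Measure.map_map (measurable_twoPointMix a b) hzm]
  conv_lhs => rw [← Measure.map_id (μ := (π : Measure (ProbabilityMeasure C)))]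
  exact Measure.map_congr (by filter_upwards [hP] with P hP using hP.symm)

/-- Without correlation the random measure is its mean: all `P(E)` have variance zero. -/
lemma eq_dirac_of_urnLaw_zero [StandardBorelSpace C]
    (h : ∀ E : Set C, MeasurableSet E → UrnLaw π E 0) :
    (π : Measure (ProbabilityMeasure C)) = Measure.dirac (meanMeasure π) := by
  obtain ⟨s, hs, hdet⟩ := exists_determining_sets C
  have hE : ∀ E : Set C, MeasurableSet E → ∀ᵐ P : ProbabilityMeasure C
      ∂(π : Measure (ProbabilityMeasure C)),
        (P : Measure C) E = (meanMeasure π : Measure C) E := by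
    intro E hE
    have h1 : moment π [E, E] = moment π [E] ^ 2 := by
      rw [(h E hE).moment_self hE]
      ring
    have i1 := integrable_list_prod_real π (L := [E]) (by simp [hE])
    have i2 := integrable_list_prod_real π (L := [E, E]) (by simp [hE])
    simp only [moment, List.map_cons, List.map_nil, List.prod_cons, List.prod_nil, mul_one]
      at h1 i1 i2
    set r := ∫ P : ProbabilityMeasure C, (P : Measure C).real E
      ∂(π : Measure (ProbabilityMeasure C)) with hr
    have hv : ∫ P : ProbabilityMeasure C, ((P : Measure C).real E - r) ^ 2
        ∂(π : Measure (ProbabilityMeasure C)) = 0 := by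
      have : ∀ P : ProbabilityMeasure C, ((P : Measure C).real E - r) ^ 2 =
          (P : Measure C).real E * (P : Measure C).real E - 2 * r * (P : Measure C).real E +
            r ^ 2 := fun P => by ring
      simp_rw [this]
      have i3 : Integrable (fun P : ProbabilityMeasure C => 2 * r * (P : Measure C).real E)
        (π : Measure (ProbabilityMeasure C)) := i1.const_mul _
      have i4 : Integrable (fun P : ProbabilityMeasure C => (P : Measure C).real E *
        (P : Measure C).real E - 2 * r * (P : Measure C).real E)
        (π : Measure (ProbabilityMeasure C)) := i2.sub i3
      rw [integral_add i4 (integrable_const _), integral_sub i2 i3, integral_const_mul, h1, ← hr]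
      simp
      ring
    have hi : Integrable (fun P : ProbabilityMeasure C => ((P : Measure C).real E - r) ^ 2)
        (π : Measure (ProbabilityMeasure C)) := by
      refine Integrable.of_bound (C := 1)
        (((measurable_measureReal hE).sub_const r).pow_const 2).aestronglyMeasurable
        (ae_of_all _ fun P => ?_)
      have hr0 : 0 ≤ r := integral_nonneg fun _ => measureReal_nonneg
      have hr1 : r ≤ 1 := (integral_mono i1 (integrable_const 1) fun _ =>
        measureReal_le_one).trans (by simp)
      have hp0 : 0 ≤ (P : Measure C).real E := measureReal_nonneg
      have hp1 : (P : Measure C).real E ≤ 1 := measureReal_le_one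
      rw [Real.norm_eq_abs, abs_of_nonneg (sq_nonneg _), sq_le_one_iff_abs_le_one, abs_le]
      constructor <;> linarith
    rw [integral_eq_zero_iff_of_nonneg (fun P => sq_nonneg _) hi] at hv
    filter_upwards [hv] with P hP
    have h2 : (P : Measure C).real E = r := by
      have : ((P : Measure C).real E - r) ^ 2 = 0 := hP
      nlinarith [pow_eq_zero_iff (two_ne_zero) |>.1 this]
    have h3 : (meanMeasure π : Measure C).real E = r := by
      rw [meanMeasure_real hE]
      simp [moment, hr]
    rw [← ofReal_measureReal (μ := (P : Measure C)) (s := E), h2, ← h3, ofReal_measureReal]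
  have hall : ∀ᵐ P : ProbabilityMeasure C ∂(π : Measure (ProbabilityMeasure C)),
      P = meanMeasure π := by
    filter_upwards [ae_all_iff.2 fun q => hE (s q) (hs q)] with P hP using hdet _ _ hP
  conv_lhs => rw [← Measure.map_id (μ := (π : Measure (ProbabilityMeasure C)))]
  rw [Measure.map_congr (g := fun _ => meanMeasure π) (by filter_upwards [hall] with P hP using hP),
    Measure.map_const]
  simp

/-- Urn predictive probabilities with positive correlation determine all the mixed moments, which
are those of the Dirichlet process. -/
lemma isDirichletProcess_of_urnLaw {t : ℝ} (ht0 : 0 < t) (ht1 : t < 1)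
    (h : ∀ E : Set C, MeasurableSet E → UrnLaw π E t) :
    IsDirichletProcess (meanMeasure π) ((1 - t) / t) π := by
  classical
  intro R A hA
  set α := (1 - t) / t with hα
  have hα0 : 0 < α := div_pos (by linarith) ht0
  set a : Fin R → ℝ := fun r => α * evalVec A (meanMeasure π) r with ha
  have ha0 : ∀ r, 0 ≤ a r := fun r => mul_nonneg hα0.le (evalVec_mem_cube A _ r (mem_univ r)).1
  have hsum : ∑ r, a r = α := by
    rw [ha, ← Finset.mul_sum, hA.sum_evalVec, mul_one]
  have hs0 : 0 < ∑ r, a r := hsum ▸ hα0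
  have hmeas := measurable_evalVec hA.measurable
  have := isProbabilityMeasure_dirichletLaw ha0
  have := Measure.isProbabilityMeasure_map (μ := (π : Measure (ProbabilityMeasure C)))
    hmeas.aemeasurable
  have hmono : ∀ L : List (Fin R), ∫ w, mono L w
      ∂(π : Measure (ProbabilityMeasure C)).map (evalVec A) = moment π (L.map A) := by
    intro L
    rw [integral_map hmeas.aemeasurable (continuous_mono L).aestronglyMeasurable, moment]
    refine integral_congr_ae (ae_of_all _ fun P => ?_)
    simp only [mono, List.map_map]
    rfl
  refine ext_of_moments ((ae_map_iff hmeas.aemeasurable (p := fun w => w ∈ cube (Fin R))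
    (measurableSet_cube R)).2
    (ae_of_all _ fun P => evalVec_mem_cube A P)) (ae_dirichletLaw_mem_cube ha0 hs0) fun L => ?_
  induction L with
  | nil => simp
  | cons s L ih =>
    have h1 := integral_mono_cons_dirichletLaw ha0 hs0 s L
    rw [hsum, ← ih, hmono] at h1
    set L₁ := L.filter (· == s) with hL₁
    set L₂ := L.filter (fun r => !(r == s)) with hL₂
    have hp : (L₁ ++ L₂).Perm L := List.filter_append_perm _ L
    have hc : L₁.length = L.count s := (List.count_eq_length_filter).symm
    have hl : (L₁.length : ℝ) + L₂.length = L.length := by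
      rw [← hp.length_eq, List.length_append]
      push_cast
      rfl
    have h2 := h (A s) (hA.measurable s) (L₁.map A) (L₂.map A)
      (by
        intro S hS
        obtain ⟨r, hr, rfl⟩ := List.mem_map.1 hS
        have : r = s := by simpa using (List.mem_filter.1 hr).2
        exact ⟨hA.measurable r, this ▸ subset_rfl⟩)
      (by
        intro S hS
        obtain ⟨r, hr, rfl⟩ := List.mem_map.1 hS
        have : r ≠ s := by simpa using (List.mem_filter.1 hr).2
        exact ⟨hA.measurable r, subset_compl_iff_disjoint_right.2 (hA.disjoint this)⟩)
    rw [← List.map_append, moment_perm ((hp.map A).cons (A s)), moment_perm (hp.map A),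
      List.length_map, List.length_map, hl, hc] at h2
    have h3 : a s = α * moment π [A s] := by
      rw [ha, ← meanMeasure_real (hA.measurable s)]
      rfl
    have h4 : 1 + ((L.length : ℝ) - 1) * t = t * (α + L.length) := by
      rw [hα]
      field_simp
      ring
    have h5 : (1 - t) * moment π [A s] + (L.count s : ℝ) * t = t * (a s + L.count s) := by
      rw [h3, hα]
      field_simp
    rw [h4, h5, mul_assoc, mul_assoc] at h2
    have h6 := mul_left_cancel₀ ht0.ne' h2
    rw [hmono, List.map_cons]
    have hpos : α + (L.length : ℝ) ≠ 0 := by positivity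
    exact mul_left_cancel₀ hpos (h6.trans h1.symm)

/-- A random measure whose predictive probabilities depend on counts only is a Dirichlet process
or one of the trivial processes. -/
theorem CountPredictive.isDirichletProcess_or_isTrivialProcess [StandardBorelSpace C]
    (h : CountPredictive π) :
    (∃ (Q : ProbabilityMeasure C) (α : ℝ), 0 < α ∧ IsDirichletProcess Q α π) ∨
      IsTrivialProcess π := by
  by_cases hn : ∀ E : Set C, MeasurableSet E → moment π [E, Eᶜ] = 0
  · exact Or.inr (Or.inr (Or.inl ⟨meanMeasure π, exists_map_pointMass hn⟩))
  push Not at hn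
  obtain ⟨B, hB, hBn⟩ := hn
  have hm0 : ∀ {S : Set C}, MeasurableSet S → (moment π [S] = 0 ↔
      (meanMeasure π : Measure C) S = 0) := by
    intro S hS
    rw [← meanMeasure_real hS, measureReal_eq_zero_iff]
  have hB1 : moment π [B] ≠ 0 := moment_ne_zero_of_subset (L := [B, Bᶜ]) (by simp [hB])
    (by simp [hB]) (by simp) hBn
  have hB2 : moment π [Bᶜ] ≠ 0 := moment_ne_zero_of_subset (L := [B, Bᶜ]) (by simp [hB])
    (by simp [hB]) (by simp) hBn
  by_cases h3 : ∃ A₁ A₂ : Set C, MeasurableSet A₁ ∧ MeasurableSet A₂ ∧ Disjoint A₁ A₂ ∧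
      moment π [A₁] ≠ 0 ∧ moment π [A₂] ≠ 0 ∧ moment π [(A₁ ∪ A₂)ᶜ] ≠ 0
  · obtain ⟨A₁, A₂, hA₁, hA₂, hd, h1, h2, h12⟩ := h3
    obtain ⟨t, ht⟩ := h.exists_urnLaw hB hBn hA₁ hA₂ hd h1 h2 h12
    have hself := (ht B hB).moment_self hB
    have hadd := moment_add_compl (π := π) (L := [B]) hB (by simp [hB])
    have hpm : moment π [Bᶜ, B] = moment π [B, Bᶜ] := moment_perm (List.Perm.swap _ _ _)
    have hBc := moment_compl (π := π) hB
    have hpos1 : 0 < moment π [B] := (moment_nonneg _ _).lt_of_ne' hB1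
    have hpos2 : 0 < 1 - moment π [B] := hBc ▸ (moment_nonneg _ _).lt_of_ne' hB2
    have hposn : 0 < moment π [B, Bᶜ] := (moment_nonneg _ _).lt_of_ne' hBn
    have hprod := mul_pos hpos1 hpos2
    have ht1 : t < 1 := by
      have : 0 < (1 - t) * (moment π [B] * (1 - moment π [B])) := by
        rw [hpm] at hadd
        linarith
      linarith [pos_of_mul_pos_left this hprod.le]
    have ht0 : 0 ≤ t := by
      -- the variance of `P(B)` is not negative
      have hvar : moment π [B] ^ 2 ≤ moment π [B, B] := by
        have := variance_nonneg (fun P : ProbabilityMeasure C => (P : Measure C).real B)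
          (π : Measure (ProbabilityMeasure C))
        rw [variance_eq_sub] at this
        · simp only [moment, List.map_cons, List.map_nil, List.prod_cons, List.prod_nil, mul_one]
          simp only [Pi.pow_apply, pow_two] at this ⊢
          linarith
        · exact MemLp.of_bound (measurable_measureReal hB).aestronglyMeasurable 1
            (ae_of_all _ fun P => by
              rw [Real.norm_eq_abs, abs_of_nonneg measureReal_nonneg]
              exact measureReal_le_one)
      have : 0 ≤ t * (moment π [B] * (1 - moment π [B])) := by
        rw [hself] at hvar
        linarith
      exact nonneg_of_mul_nonneg_left this hprod
    rcases ht0.eq_or_lt with rfl | ht0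
    · exact Or.inr (Or.inl ⟨meanMeasure π, eq_dirac_of_urnLaw_zero ht⟩)
    · exact Or.inl ⟨meanMeasure π, (1 - t) / t, div_pos (by linarith) ht0,
        isDirichletProcess_of_urnLaw ht0 ht1 ht⟩
  · -- neither `B` nor its complement can be split, so the mean measure lives on two points
    push Not at h3
    have hsplit : ∀ {D : Set C}, MeasurableSet D → moment π [Dᶜ] ≠ 0 → ∀ S, MeasurableSet S →
        (meanMeasure π : Measure C) (D ∩ S) = 0 ∨ (meanMeasure π : Measure C) (D ∩ Sᶜ) = 0 := by
      intro D hD hD0 S hS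
      by_contra! hcon
      rw [Ne, Ne, ← hm0 (hD.inter hS), ← hm0 (hD.inter hS.compl)] at hcon
      refine hD0 ?_
      have := h3 _ _ (hD.inter hS) (hD.inter hS.compl)
        (disjoint_compl_right.mono inter_subset_right inter_subset_right) hcon.1 hcon.2
      rwa [inter_union_compl] at this
    obtain ⟨a, ha⟩ := exists_atom_of_not_split hB (mt (hm0 hB).2 hB1) (hsplit hB hB2)
    obtain ⟨b, hb⟩ := exists_atom_of_not_split hB.compl (mt (hm0 hB.compl).2 hB2)
      (hsplit hB.compl (by rwa [compl_compl]))
    refine Or.inr (Or.inr (Or.inr ⟨a, b, exists_map_twoPointMix ?_⟩))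
    refine measure_mono_null (fun x hx => ?_) (measure_union_null ha hb)
    by_cases hxB : x ∈ B
    · exact Or.inl ⟨hxB, hx.1⟩
    · exact Or.inr ⟨hxB, hx.2⟩

/-- The link function that reveals the first latent value: its posterior does not smooth across
events exactly under the Dirichlet process and the trivial processes. -/
theorem doesNotSmooth_coordLink_iff {X : Type v} [MeasurableSpace X] [StandardBorelSpace C]
    [StandardBorelSpace X] {e : C → X} (he : Measurable e) (hinj : Function.Injective e) :
    (∀ n : ℕ, 2 ≤ n → DoesNotSmooth (dataLaw Set.univ (coordLink.{u, v, w} e he) π n)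
        (posterior Set.univ (coordLink.{u, v, w} e he) π n)) ↔
      ((∃ (Q : ProbabilityMeasure C) (α : ℝ), 0 < α ∧ IsDirichletProcess Q α π) ∨
        IsTrivialProcess π) := by
  constructor
  · intro h
    exact CountPredictive.isDirichletProcess_or_isTrivialProcess
      fun A hA => exists_predictive he hinj h hA
  · rintro (⟨Q, α, hα, h⟩ | h) n hn
    · exact h.doesNotSmooth hα he hn
    · exact h.doesNotSmooth he hn

end Characterization

/-! ### Convergence of ratios -/

section Ratio

lemma abs_mono_sub_mono_le {ι : Type*} {v u : ι → ℝ} (hv : v ∈ cube ι) (hu : u ∈ cube ι) {δ : ℝ}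
    (h : ∀ r, |v r - u r| ≤ δ) (L : List ι) : |mono L v - mono L u| ≤ L.length * δ := by
  induction L with
  | nil => simp
  | cons r L ih =>
    have h1 := mono_mem_Icc hv L
    have h2 := hu r (mem_univ r)
    have e : mono (r :: L) v - mono (r :: L) u =
        (v r - u r) * mono L v + u r * (mono L v - mono L u) := by
      rw [mono_cons, mono_cons]
      ring
    have hδ : 0 ≤ δ := (abs_nonneg _).trans (h r)
    have hL : 0 ≤ (L.length : ℝ) * δ := (abs_nonneg _).trans ih
    rw [e]
    refine (abs_add_le _ _).trans ?_
    rw [abs_mul, abs_mul, abs_of_nonneg h1.1, abs_of_nonneg h2.1, List.length_cons]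
    push_cast
    have h3 := mul_le_mul (h r) h1.2 h1.1 hδ
    have h4 := mul_le_mul h2.2 ih (abs_nonneg _) zero_le_one
    linarith

/-- Convergence of the moments of `v` when `v · d(w)` is close to `N(w)`: the slack `s(w)`
disappears in the limit, and the ratio `N / d` is replaced by the continuous function
`N / max(d, ε)`, which costs little as the limit law does not charge `d = 0`. -/
lemma tendsto_integral_mono_of_ratio {R n : ℕ} {κ : ℕ → Measure ((Fin R → ℝ) × (Fin n → ℝ))}
    [∀ m, IsProbabilityMeasure (κ m)] {ν : Measure (Fin n → ℝ)} [IsProbabilityMeasure ν]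
    {d s : (Fin n → ℝ) → ℝ} {N : Fin R → (Fin n → ℝ) → ℝ} (hd : Continuous d)
    (hs : Continuous s) (hN : ∀ r, Continuous (N r))
    (hκ : ∀ m, ∀ᵐ q ∂κ m, q.1 ∈ cube (Fin R) ∧ q.2 ∈ cube (Fin n) ∧
      ∀ r, |q.1 r * d q.2 - N r q.2| ≤ s q.2)
    (hdN : ∀ w ∈ cube (Fin n), 0 ≤ d w ∧ ∀ r, 0 ≤ N r w ∧ N r w ≤ d w)
    (hν : ∀ᵐ w ∂ν, w ∈ cube (Fin n) ∧ 0 < d w ∧ s w = 0)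
    (hconv : ∀ F : (Fin n → ℝ) → ℝ, Continuous F →
      Tendsto (fun m => ∫ q, F q.2 ∂κ m) atTop (𝓝 (∫ w, F w ∂ν))) (L : List (Fin R)) :
    Tendsto (fun m => ∫ q, mono L q.1 ∂κ m) atTop
      (𝓝 (∫ w, mono L (fun r => N r w / d w) ∂ν)) := by
  set E : ℝ → (Fin n → ℝ) → ℝ := fun ε w => (s w + max (ε - d w) 0) / ε with hE
  set g : ℝ → (Fin n → ℝ) → Fin R → ℝ := fun ε w r => N r w / max (d w) ε with hg
  have hEc : ∀ ε, Continuous (E ε) := fun ε => by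
    simp only [hE]
    fun_prop
  have hgc : ∀ ε, 0 < ε → Continuous (g ε) := fun ε hε => continuous_pi fun r =>
    (hN r).div (hd.max continuous_const) fun w => (hε.trans_le (le_max_right _ _)).ne'
  have hgcube : ∀ ε, 0 < ε → ∀ w ∈ cube (Fin n), g ε w ∈ cube (Fin R) := by
    intro ε hε w hw r _
    have h1 := (hdN w hw).2 r
    have h2 : 0 < max (d w) ε := hε.trans_le (le_max_right _ _)
    exact ⟨div_nonneg h1.1 h2.le, (div_le_one h2).2 (h1.2.trans (le_max_left _ _))⟩
  have hdist : ∀ ε, 0 < ε → ∀ w ∈ cube (Fin n), ∀ v ∈ cube (Fin R),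
      (∀ r, |v r * d w - N r w| ≤ s w) → ∀ r, |v r - g ε w r| ≤ E ε w := by
    intro ε hε w hw v hv h r
    have h2 : 0 < max (d w) ε := hε.trans_le (le_max_right _ _)
    have h3 : v r - g ε w r = (v r * max (d w) ε - N r w) / max (d w) ε := by
      simp only [hg]
      field_simp
    have h4 : max (d w) ε = d w + max (ε - d w) 0 := by
      rcases le_total ε (d w) with h | h
      · rw [max_eq_left h, max_eq_right (by linarith), add_zero]
      · rw [max_eq_right h, max_eq_left (by linarith)]
        ring
    have h5 : |v r * max (d w) ε - N r w| ≤ s w + max (ε - d w) 0 := by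
      have h6 : v r * max (d w) ε - N r w =
          (v r * d w - N r w) + v r * max (ε - d w) 0 := by
        rw [h4]
        ring
      rw [h6]
      refine (abs_add_le _ _).trans (add_le_add (h r) ?_)
      have hvr := hv r (mem_univ r)
      rw [abs_mul, abs_of_nonneg hvr.1, abs_of_nonneg (le_max_right _ _)]
      exact mul_le_of_le_one_left (le_max_right _ _) hvr.2
    rw [h3, abs_div, abs_of_pos h2]
    exact div_le_div₀ ((abs_nonneg _).trans h5) h5 hε (le_max_right _ _)
  have hint : ∀ m, ∀ F : (Fin n → ℝ) → ℝ, Continuous F → Integrable (fun q => F q.2) (κ m) := by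
    intro m F hF
    have hc : ∀ᵐ w ∂(κ m).map Prod.snd, w ∈ cube (Fin n) :=
      (ae_map_iff measurable_snd.aemeasurable (p := fun w => w ∈ cube (Fin n))
        (measurableSet_cube n)).2 ((hκ m).mono fun q hq => hq.2.1)
    exact (integrable_of_cube hc hF).comp_measurable measurable_snd
  have hint1 : ∀ m, Integrable (fun q : (Fin R → ℝ) × (Fin n → ℝ) => mono L q.1) (κ m) := by
    intro m
    have hc : ∀ᵐ w ∂(κ m).map Prod.fst, w ∈ cube (Fin R) :=
      (ae_map_iff measurable_fst.aemeasurable (p := fun w => w ∈ cube (Fin R))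
        (measurableSet_cube R)).2 ((hκ m).mono fun q hq => hq.1)
    exact (integrable_of_cube hc (continuous_mono L)).comp_measurable measurable_fst
  have hνc : ∀ᵐ w ∂ν, w ∈ cube (Fin n) := hν.mono fun w hw => hw.1
  have hratio : ∀ w ∈ cube (Fin n), 0 < d w → (fun r => N r w / d w) ∈ cube (Fin R) := by
    intro w hw h r _
    have h1 := (hdN w hw).2 r
    exact ⟨div_nonneg h1.1 h.le, (div_le_one h).2 h1.2⟩
  have hratio_int : Integrable (fun w => mono L fun r => N r w / d w) ν := by
    refine Integrable.of_bound (C := 1) ?_ ?_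
    · exact ((continuous_mono L).measurable.comp (measurable_pi_iff.2 fun r =>
        (hN r).measurable.div hd.measurable)).aestronglyMeasurable
    · filter_upwards [hν] with w hw
      have := mono_mem_Icc (hratio w hw.1 hw.2.1) L
      rw [Real.norm_eq_abs, abs_of_nonneg this.1]
      exact this.2
  set A := ∫ w, mono L (fun r => N r w / d w) ∂ν with hA
  set c : ℝ := (L.length : ℝ) with hc
  have bound : ∀ ε, 0 < ε → ∀ m, |∫ q, mono L q.1 ∂κ m - A| ≤ c * ∫ q, E ε q.2 ∂κ m +
      |∫ q, mono L (g ε q.2) ∂κ m - ∫ w, mono L (g ε w) ∂ν| + c * ∫ w, E ε w ∂ν := by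
    intro ε hε m
    have hgε : Continuous fun w => mono L (g ε w) := (continuous_mono L).comp (hgc ε hε)
    have b1 : |∫ q, mono L q.1 ∂κ m - ∫ q, mono L (g ε q.2) ∂κ m| ≤ c * ∫ q, E ε q.2 ∂κ m := by
      rw [← integral_sub (hint1 m) (hint m _ hgε), ← integral_const_mul, ← Real.norm_eq_abs]
      refine norm_integral_le_of_norm_le ((hint m _ (hEc ε)).const_mul c) ?_
      filter_upwards [hκ m] with q hq
      rw [Real.norm_eq_abs]
      exact abs_mono_sub_mono_le hq.1 (hgcube ε hε _ hq.2.1)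
        (hdist ε hε _ hq.2.1 _ hq.1 hq.2.2) L
    have b2 : |∫ w, mono L (g ε w) ∂ν - A| ≤ c * ∫ w, E ε w ∂ν := by
      rw [hA, ← integral_sub (integrable_of_cube hνc hgε) hratio_int, ← integral_const_mul,
        ← Real.norm_eq_abs]
      refine norm_integral_le_of_norm_le ((integrable_of_cube hνc (hEc ε)).const_mul c) ?_
      filter_upwards [hν] with w hw
      rw [Real.norm_eq_abs, abs_sub_comm]
      refine abs_mono_sub_mono_le (hratio w hw.1 hw.2.1) (hgcube ε hε _ hw.1)
        (hdist ε hε _ hw.1 _ (hratio w hw.1 hw.2.1) fun r => ?_) L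
      rw [div_mul_cancel₀ _ hw.2.1.ne', sub_self, abs_zero, hw.2.2]
    have b3 := abs_sub_le (∫ q, mono L q.1 ∂κ m) (∫ q, mono L (g ε q.2) ∂κ m) A
    have b4 := abs_sub_le (∫ q, mono L (g ε q.2) ∂κ m) (∫ w, mono L (g ε w) ∂ν) A
    linarith
  -- the cost of the truncation at `ε` tends to zero
  have hsmall : Tendsto (fun k : ℕ => ∫ w, E (1 / ((k : ℝ) + 1)) w ∂ν) atTop (𝓝 0) := by
    have : Tendsto (fun k : ℕ => ∫ w, E (1 / ((k : ℝ) + 1)) w ∂ν) atTop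
        (𝓝 (∫ _, (0 : ℝ) ∂ν)) := by
      refine tendsto_integral_of_dominated_convergence (fun _ => 1)
        (fun k => (hEc _).aestronglyMeasurable) (integrable_const _) (fun k => ?_) ?_
      · filter_upwards [hν] with w hw
        have hk : 0 < 1 / ((k : ℝ) + 1) := by positivity
        simp only [hE, hw.2.2, zero_add]
        rw [Real.norm_eq_abs, abs_of_nonneg (div_nonneg (le_max_right _ _) hk.le), div_le_one hk]
        exact max_le (by linarith [hw.2.1]) hk.le
      · filter_upwards [hν] with w hw
        refine tendsto_const_nhds.congr' ?_
        filter_upwards [(tendsto_one_div_add_atTop_nhds_zero_nat (𝕜 := ℝ)).eventually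
          (gt_mem_nhds hw.2.1)] with k hk
        simp only [hE, hw.2.2, zero_add]
        rw [max_eq_right (by linarith), zero_div]
    simpa using this
  rw [Metric.tendsto_atTop']
  intro δ hδ
  have h2 : Tendsto (fun k : ℕ => 2 * c * ∫ w, E (1 / ((k : ℝ) + 1)) w ∂ν) atTop (𝓝 0) := by
    simpa using hsmall.const_mul (2 * c)
  obtain ⟨k, hk⟩ := (h2.eventually (gt_mem_nhds hδ)).exists
  set ε := 1 / ((k : ℝ) + 1) with hε
  have hε0 : 0 < ε := by positivity
  have h3 : Tendsto (fun m => c * ∫ q, E ε q.2 ∂κ m +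
      |∫ q, mono L (g ε q.2) ∂κ m - ∫ w, mono L (g ε w) ∂ν| + c * ∫ w, E ε w ∂ν) atTop
      (𝓝 (c * ∫ w, E ε w ∂ν + |(0 : ℝ)| + c * ∫ w, E ε w ∂ν)) := by
    refine Tendsto.add_const _ (((hconv _ (hEc ε)).const_mul c).add (Tendsto.abs ?_))
    have := (hconv _ ((continuous_mono L).comp (hgc ε hε0))).sub_const
      (∫ w, mono L (g ε w) ∂ν)
    simpa using this
  rw [abs_zero, add_zero, ← two_mul, ← mul_assoc] at h3
  obtain ⟨M, hM⟩ := eventually_atTop.1 (h3.eventually (gt_mem_nhds hk))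
  exact ⟨M, fun m hm => (bound ε hε0 m).trans_lt (hM m hm.le)⟩

end Ratio

/-! ### Samples with distinct latent values -/

section Distinct

/-- The vectors of pairwise distinct latent values. -/
def distinct (C : Type u) (n : ℕ) : Set (Fin n → C) := {c | Function.Injective c}

lemma cons_mem_distinct {C : Type u} {n : ℕ} {y : C} {c : Fin n → C} :
    (Fin.cons y c : Fin (n + 1) → C) ∈ distinct C (n + 1) ↔
      y ∉ range c ∧ c ∈ distinct C n :=
  Fin.cons_injective_iff

variable {C : Type u} {X : Type v} [MeasurableSpace C] [MeasurableSpace X]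

lemma allDefined_offDiag (η : LinkPrior.{u, v, w} C X) (n : ℕ) :
    allDefined (offDiag C) η n = {ω | ω.2.2 ∈ distinct C n} := by
  ext ω
  exact ⟨fun h k l hkl => by_contra fun hne => h k l hne hkl, fun h k l hkl h' => hkl (h h')⟩

lemma measurable_array (η : LinkPrior.{u, v, w} C X) (n : ℕ) :
    Measurable fun q : η.H × (Fin n → C) =>
      (fun p => η.h q.1 (q.2 p.1.1) (q.2 p.1.2) : Data n X) := by
  refine measurable_pi_iff.2 fun p => ?_
  have h : ∀ k : Fin n, Measurable fun q : η.H × (Fin n → C) => q.2 k :=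
    fun k => (measurable_pi_apply k).comp measurable_snd
  exact η.measurable_h.comp (measurable_fst.prodMk ((h p.1.1).prodMk (h p.1.2)))

variable [StandardBorelSpace C]

lemma measurableSet_offDiag : MeasurableSet (offDiag C) :=
  (measurableSet_eq_fun measurable_fst measurable_snd).compl

lemma measurableSet_distinct (n : ℕ) : MeasurableSet (distinct C n) := by
  have h : distinct C n = ⋂ (k : Fin n) (l : Fin n) (_ : k ≠ l),
      (fun c : Fin n → C => (c k, c l)) ⁻¹' offDiag C := by
    ext c
    simp only [mem_iInter, mem_preimage]
    exact ⟨fun h k l hkl h' => hkl (h h'), fun h k l hkl => by_contra fun hne => h k l hne hkl⟩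
  rw [h]
  exact MeasurableSet.iInter fun k => MeasurableSet.iInter fun l => MeasurableSet.iInter fun _ =>
    ((measurable_pi_apply k).prodMk (measurable_pi_apply l)) measurableSet_offDiag

lemma measurableSet_allDefined_offDiag (η : LinkPrior.{u, v, w} C X) (n : ℕ) :
    MeasurableSet (allDefined (offDiag C) η n) := by
  rw [allDefined_offDiag]
  exact (measurable_snd.comp measurable_snd) (measurableSet_distinct n)

/-- Integrals over the part of the prior where the latent values are distinct. -/
def distinctIntegral (η : LinkPrior.{u, v, w} C X) (π : ProbabilityMeasure (ProbabilityMeasure C))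
    (n : ℕ) (F : Sample η n → ℝ≥0∞) : ℝ≥0∞ :=
  ∫⁻ θ, ∫⁻ P, ∫⁻ c, (distinct C n).indicator (fun c => F (θ, P, c)) c ∂iidKernel C n P
    ∂(π : Measure (ProbabilityMeasure C)) ∂(η.law : Measure η.H)

lemma exists_lintegral_jointLaw_offDiag (η : LinkPrior.{u, v, w} C X)
    (π : ProbabilityMeasure (ProbabilityMeasure C)) (n : ℕ) :
    ∃ Z : ℝ≥0∞, Z ≠ 0 ∧ ∀ F : Sample η n → ℝ≥0∞, Measurable F →
      ∫⁻ ω, F ω ∂jointLaw (offDiag C) η π n = Z * distinctIntegral η π n F := by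
  have hD := measurableSet_allDefined_offDiag η n
  refine ⟨_, ENNReal.inv_ne_zero.2 (measure_ne_top ((η.law : Measure η.H).prod
    ((π : Measure (ProbabilityMeasure C)) ⊗ₘ iidKernel C n)) (allDefined (offDiag C) η n)),
    fun F hF => ?_⟩
  rw [jointLaw, ProbabilityTheory.cond, lintegral_smul_measure, ← lintegral_indicator hD,
    lintegral_prod _ (hF.indicator hD).aemeasurable, smul_eq_mul, distinctIntegral]
  congr 1
  refine lintegral_congr fun θ => ?_
  refine (Measure.lintegral_compProd
    ((hF.indicator hD).comp measurable_prodMk_left)).trans ?_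
  refine lintegral_congr fun P => lintegral_congr fun c => ?_
  have h : (θ, P, c) ∈ allDefined (offDiag C) η n ↔ c ∈ distinct C n := by
    rw [allDefined_offDiag]
    rfl
  by_cases hc : c ∈ distinct C n
  · rw [Function.comp_apply, indicator_of_mem hc, indicator_of_mem (h.2 hc)]
  · rw [Function.comp_apply, indicator_of_notMem hc, indicator_of_notMem (mt h.1 hc)]

/-- Under a Dirichlet process the sample, restricted to distinct values, is a multiple of an
i.i.d. sample from the center measure: in the urn, new values are drawn from it. -/
theorem IsDirichletProcess.exists_lintegral_distinct {Q : ProbabilityMeasure C} {α : ℝ}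
    (hα : 0 < α) {π : ProbabilityMeasure (ProbabilityMeasure C)} (h : IsDirichletProcess Q α π)
    (n : ℕ) : ∃ K : ℝ≥0∞, K ≠ 0 ∧ ∀ f : (Fin n → C) → ℝ≥0∞, Measurable f →
      ∫⁻ P, ∫⁻ c, (distinct C n).indicator f c ∂iidKernel C n P
        ∂(π : Measure (ProbabilityMeasure C)) =
      K * ∫⁻ c, (distinct C n).indicator f c ∂Measure.pi fun _ => (Q : Measure C) := by
  induction n with
  | zero =>
    refine ⟨1, one_ne_zero, fun f _ => ?_⟩
    have hP : ∀ P : ProbabilityMeasure C, Measure.pi (fun _ : Fin 0 => (P : Measure C)) =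
        Measure.dirac isEmptyElim := fun P => Measure.pi_of_empty _ _
    simp only [iidKernel_apply, hP, lintegral_const, measure_univ, mul_one, one_mul]
  | succ n ih =>
    obtain ⟨K, hK0, hK⟩ := ih
    have hαn : ENNReal.ofReal α + n ≠ 0 := by
      simp [hα]
    have hαn' : ENNReal.ofReal α + n ≠ ∞ := by finiteness
    refine ⟨(ENNReal.ofReal α + n)⁻¹ * (ENNReal.ofReal α * K),
      mul_ne_zero (ENNReal.inv_ne_zero.2 hαn') (mul_ne_zero (by simp [hα]) hK0), fun f hf => ?_⟩
    set T := (distinct C (n + 1)).indicator f with hT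
    have hTm : Measurable T := hf.indicator (measurableSet_distinct _)
    set G : (Fin n → C) × C → ℝ≥0∞ := fun q => T (Fin.cons q.2 q.1) with hG
    have hcons : Measurable fun q : (Fin n → C) × C => (Fin.cons q.2 q.1 : Fin (n + 1) → C) := by
      refine measurable_pi_iff.2 fun i => ?_
      refine Fin.cases ?_ (fun j => ?_) i
      · exact measurable_snd
      · exact (measurable_pi_apply j).comp measurable_fst
    have hGm : Measurable G := hTm.comp hcons
    set f' : (Fin n → C) → ℝ≥0∞ := fun c => ∫⁻ y, G (c, y) ∂(Q : Measure C) with hf'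
    have hf'm : Measurable f' := hGm.lintegral_prod_right'
    have hf'T : (distinct C n).indicator f' = f' := by
      refine indicator_eq_self.2 fun c hc => ?_
      by_contra hcon
      refine hc ?_
      rw [hf']
      refine (lintegral_congr fun y => ?_).trans lintegral_zero
      exact indicator_of_notMem (fun h => hcon (cons_mem_distinct.1 h).2) f
    have hpi : ∀ P : ProbabilityMeasure C, ∫⁻ c, T c ∂(Measure.pi fun _ : Fin (n + 1) =>
        (P : Measure C)) = ∫⁻ c, ∫⁻ y, G (c, y) ∂(P : Measure C)
          ∂Measure.pi fun _ : Fin n => (P : Measure C) := by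
      intro P
      rw [lintegral_pi_insertNth _ 0 hTm]
      simp only [Fin.insertNth_zero', hG]
    have hurn := h.lintegral_urn hα hGm
    have hnew : ∀ c, ∫⁻ y, G (c, y) ∂urnKernel Q α n c = ENNReal.ofReal α * f' c := by
      intro c
      rw [urnKernel_apply, lintegral_add_measure, lintegral_smul_measure,
        lintegral_finsetSum_measure, Finset.sum_eq_zero, add_zero, smul_eq_mul]
      intro i _
      refine (lintegral_dirac' _ (hGm.comp measurable_prodMk_left)).trans ?_
      exact indicator_of_notMem (fun h => (cons_mem_distinct.1 h).1 ⟨i, rfl⟩) f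
    simp only [hnew] at hurn
    have hpull : ∀ P : ProbabilityMeasure C, ∫⁻ c, ENNReal.ofReal α * f' c ∂iidKernel C n P =
        ENNReal.ofReal α * ∫⁻ c, f' c ∂iidKernel C n P :=
      fun P => lintegral_const_mul _ hf'm
    simp only [hpull] at hurn
    rw [lintegral_const_mul _ (hf'm.lintegral_kernel)] at hurn
    have hIH := hK f' hf'm
    rw [hf'T] at hIH
    rw [hIH] at hurn
    have hl : ∫⁻ P, ∫⁻ c, T c ∂iidKernel C (n + 1) P ∂(π : Measure (ProbabilityMeasure C)) =
        ∫⁻ P : ProbabilityMeasure C, ∫⁻ c, ∫⁻ y, G (c, y) ∂(P : Measure C) ∂iidKernel C n P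
          ∂(π : Measure (ProbabilityMeasure C)) := by
      refine lintegral_congr fun P => ?_
      rw [iidKernel_apply, hpi P, iidKernel_apply]
    rw [hl, hpi Q, mul_assoc, mul_assoc, ← hurn, ← mul_assoc, ENNReal.inv_mul_cancel hαn hαn',
      one_mul]

/-- The null sets of the data do not depend on the precision. -/
lemma IsDirichletProcess.dataLaw_offDiag_absolutelyContinuous {Q : ProbabilityMeasure C}
    {α β : ℝ} (hα : 0 < α) (hβ : 0 < β) {π ϖ : ProbabilityMeasure (ProbabilityMeasure C)}
    (hπ : IsDirichletProcess Q α π) (hϖ : IsDirichletProcess Q β ϖ)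
    (η : LinkPrior.{u, v, w} C X) (n : ℕ) :
    dataLaw (offDiag C) η π n ≪ dataLaw (offDiag C) η ϖ n := by
  have key : ∀ {α : ℝ} (_ : 0 < α) {π : ProbabilityMeasure (ProbabilityMeasure C)}
      (_ : IsDirichletProcess Q α π), ∃ Z : ℝ≥0∞, Z ≠ 0 ∧ ∀ S : Set (Data n X),
        MeasurableSet S → dataLaw (offDiag C) η π n S = Z * ∫⁻ θ, ∫⁻ c, (distinct C n).indicator
          (fun c => S.indicator 1 fun p => η.h θ (c p.1.1) (c p.1.2)) c
            ∂Measure.pi (fun _ => (Q : Measure C)) ∂(η.law : Measure η.H) := by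
    intro α hα π hπ
    obtain ⟨Z, hZ0, hZ⟩ := exists_lintegral_jointLaw_offDiag η π n
    obtain ⟨K, hK0, hK⟩ := hπ.exists_lintegral_distinct hα n
    refine ⟨Z * K, mul_ne_zero hZ0 hK0, fun S hS => ?_⟩
    have hobs := measurable_observe η n
    have hFm : Measurable fun ω : Sample η n =>
        S.indicator (1 : Data n X → ℝ≥0∞) (observe η n ω) :=
      (measurable_one.indicator hS).comp hobs
    have h1 : dataLaw (offDiag C) η π n S = ∫⁻ ω, S.indicator 1 (observe η n ω)
        ∂jointLaw (offDiag C) η π n := by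
      rw [dataLaw, ← lintegral_indicator_one hS, lintegral_map (measurable_one.indicator hS) hobs]
    rw [h1, hZ _ hFm, distinctIntegral, mul_assoc]
    congr 1
    have hθ : ∀ θ : η.H, Measurable fun c : Fin n → C => S.indicator (1 : Data n X → ℝ≥0∞)
        fun p => η.h θ (c p.1.1) (c p.1.2) := fun θ =>
      (measurable_one.indicator hS).comp ((measurable_array η n).comp measurable_prodMk_left)
    have hm : Measurable fun θ : η.H => ∫⁻ c, (distinct C n).indicator
        (fun c => S.indicator (1 : Data n X → ℝ≥0∞) fun p => η.h θ (c p.1.1) (c p.1.2)) c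
          ∂Measure.pi (fun _ => (Q : Measure C)) := by
      have : Measurable fun q : η.H × (Fin n → C) => (Prod.snd ⁻¹' distinct C n).indicator
          (fun q => S.indicator (1 : Data n X → ℝ≥0∞)
            fun p => η.h q.1 (q.2 p.1.1) (q.2 p.1.2)) q := by
        exact ((measurable_one.indicator hS).comp (measurable_array η n)).indicator
          (measurable_snd (measurableSet_distinct n))
      exact this.lintegral_prod_right'
    rw [← lintegral_const_mul _ hm]
    exact lintegral_congr fun θ => hK _ (hθ θ)
  obtain ⟨Z₁, -, h₁⟩ := key hα hπ
  obtain ⟨Z₂, hZ₂, h₂⟩ := key hβ hϖ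
  refine Measure.AbsolutelyContinuous.mk fun S hS h0 => ?_
  rw [h₂ S hS, mul_eq_zero, or_iff_right hZ₂] at h0
  rw [h₁ S hS, h0, mul_zero]

end Distinct

/-! ### Masses of the latent values given the data -/

section AtomMass

/-- The pairs `(c, y)` with `y = c_i`. -/
def atomSet (C : Type u) (n : ℕ) (i : Fin n) : Set ((Fin n → C) × C) := {q | q.2 = q.1 i}

lemma preimage_atomSet {C : Type u} {n : ℕ} (c : Fin n → C) (i : Fin n) :
    Prod.mk c ⁻¹' atomSet C n i = {c i} := rfl

lemma hits_atomSet {C : Type u} {n : ℕ} {c : Fin n → C} (hc : c ∈ distinct C n) (i : Fin n) :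
    hits (atomSet C n i) c = 1 := by
  classical
  have : ∀ j, (atomSet C n i).indicator (1 : (Fin n → C) × C → ℝ≥0∞) (c, c j) =
      if j = i then 1 else 0 := by
    intro j
    by_cases h : j = i
    · rw [if_pos h, indicator_of_mem]
      · rfl
      · exact congrArg c h
    · rw [if_neg h, indicator_of_notMem]
      exact fun h' => h (hc h')
  simp [hits, this]

variable {C : Type u} {X : Type v} [MeasurableSpace C] [MeasurableSpace X]

/-- The probabilities of the points `c_i`. -/
def atomMass {n : ℕ} (P : ProbabilityMeasure C) (c : Fin n → C) : Fin n → ℝ :=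
  fun i => (P : Measure C).real {c i}

lemma atomMass_mem_cube {n : ℕ} (P : ProbabilityMeasure C) (c : Fin n → C) :
    atomMass P c ∈ cube (Fin n) := fun _ _ => ⟨measureReal_nonneg, measureReal_le_one⟩

lemma massProd_atomSet {n : ℕ} (L : List (Fin n)) (P : ProbabilityMeasure C) (c : Fin n → C) :
    massProd (atomSet C n) L P c = ENNReal.ofReal (mono L (atomMass P c)) := by
  induction L with
  | nil => simp [massProd]
  | cons i L ih =>
    rw [massProd, List.map_cons, List.prod_cons, ← massProd, ih, mono_cons,
      ENNReal.ofReal_mul (atomMass_mem_cube P c i (mem_univ i)).1, preimage_atomSet, atomMass,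
      ofReal_measureReal]

/-- Mixed moments of the atom masses if every new value adds `β` to the weight of each atom;
the true moments under precision `α` are between those for `β = 0` and `β = α`. -/
def atomMoment (n : ℕ) (α β : ℝ) : List (Fin n) → ℝ
  | [] => 1
  | i :: L => (β + 1 + L.count i) / (α + n + L.length) * atomMoment n α β L

lemma atomMoment_nonneg {n : ℕ} {α β : ℝ} (hα : 0 ≤ α) (hβ : 0 ≤ β) (L : List (Fin n)) :
    0 ≤ atomMoment n α β L := by
  induction L with
  | nil => exact zero_le_one
  | cons i L ih => exact mul_nonneg (by positivity) ih

lemma tendsto_atomMoment {n : ℕ} (hn : 0 < n) {α β : ℕ → ℝ} (hα : Tendsto α atTop (𝓝 0))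
    (hβ : Tendsto β atTop (𝓝 0)) (L : List (Fin n)) :
    Tendsto (fun m => atomMoment n (α m) (β m) L) atTop
      (𝓝 (∫ w, mono L w ∂dirichletLaw fun _ : Fin n => (1 : ℝ))) := by
  have ha : ∀ r : Fin n, (0 : ℝ) ≤ (fun _ => 1) r := fun _ => zero_le_one
  have hs : 0 < ∑ _r : Fin n, (1 : ℝ) := by simpa using hn
  have := isProbabilityMeasure_dirichletLaw ha
  induction L with
  | nil => simp [atomMoment]
  | cons i L ih =>
    have h1 := integral_mono_cons_dirichletLaw ha hs i L
    have hpos : (0 : ℝ) + n + L.length ≠ 0 := by positivity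
    have h2 : ∫ w, mono (i :: L) w ∂dirichletLaw (fun _ : Fin n => (1 : ℝ)) =
        (0 + 1 + L.count i) / (0 + n + L.length) *
          ∫ w, mono L w ∂dirichletLaw fun _ : Fin n => (1 : ℝ) := by
      rw [div_mul_eq_mul_div, eq_div_iff hpos, mul_comm]
      simpa using h1
    rw [h2]
    exact (((hβ.add_const _).add_const _).div ((hα.add_const _).add_const _) hpos).mul ih

lemma urnMoment_atomSet_le {n : ℕ} (hn : 0 < n) (Q : ProbabilityMeasure C) {α : ℝ} (hα : 0 < α)
    {c : Fin n → C} (hc : c ∈ distinct C n) (L : List (Fin n)) :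
    urnMoment Q α (atomSet C n) L c ≤ ENNReal.ofReal (atomMoment n α α L) := by
  induction L with
  | nil => simp [urnMoment, atomMoment]
  | cons i L ih =>
    rw [urnMoment, atomMoment, ENNReal.ofReal_mul (by positivity)]
    refine mul_le_mul' ?_ ih
    rw [ENNReal.ofReal_div_of_pos (by positivity), hits_atomSet hc,
      ENNReal.ofReal_add (by positivity) (by positivity),
      ENNReal.ofReal_add (by positivity) (by positivity),
      ENNReal.ofReal_add (by positivity) (by positivity),
      ENNReal.ofReal_add (by positivity) (by positivity), ENNReal.ofReal_one,
      ENNReal.ofReal_natCast, ENNReal.ofReal_natCast, ENNReal.ofReal_natCast]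
    gcongr
    exact mul_le_of_le_one_right' prob_le_one

lemma le_urnMoment_atomSet {n : ℕ} (hn : 0 < n) (Q : ProbabilityMeasure C) {α : ℝ} (hα : 0 < α)
    {c : Fin n → C} (hc : c ∈ distinct C n) (L : List (Fin n)) :
    ENNReal.ofReal (atomMoment n α 0 L) ≤ urnMoment Q α (atomSet C n) L c := by
  induction L with
  | nil => simp [urnMoment, atomMoment]
  | cons i L ih =>
    rw [urnMoment, atomMoment, ENNReal.ofReal_mul (by positivity)]
    refine mul_le_mul' ?_ ih
    rw [ENNReal.ofReal_div_of_pos (by positivity), hits_atomSet hc,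
      ENNReal.ofReal_add (by positivity) (by positivity),
      ENNReal.ofReal_add (by positivity) (by positivity),
      ENNReal.ofReal_add (by positivity) (by positivity),
      ENNReal.ofReal_add (by positivity) (by positivity), ENNReal.ofReal_one,
      ENNReal.ofReal_natCast, ENNReal.ofReal_natCast, ENNReal.ofReal_natCast, ENNReal.ofReal_zero]
    gcongr
    exact zero_le

variable [StandardBorelSpace C]

lemma measurableSet_atomSet (n : ℕ) (i : Fin n) : MeasurableSet (atomSet C n i) :=
  measurableSet_eq_fun measurable_snd ((measurable_pi_apply i).comp measurable_fst)

lemma measurable_atomMass (n : ℕ) :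
    Measurable fun q : ProbabilityMeasure C × (Fin n → C) => atomMass q.1 q.2 := by
  refine measurable_pi_iff.2 fun i => Measurable.ennreal_toReal ?_
  have h : MeasurableSet {t : (ProbabilityMeasure C × (Fin n → C)) × C | t.2 = t.1.2 i} :=
    measurableSet_eq_fun measurable_snd
      ((measurable_pi_apply i).comp (measurable_snd.comp measurable_fst))
  exact Kernel.measurable_kernel_prodMk_left
    (κ := (evalKernel C).comap (Prod.fst : ProbabilityMeasure C × (Fin n → C) → _)
      measurable_fst) h

/-- Given the data, the mixed moments of the atom masses are almost those of the uniform law on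
the simplex. -/
lemma IsDirichletProcess.setLIntegral_mono_atomMass {Q : ProbabilityMeasure C} {α : ℝ}
    (hα : 0 < α) {π : ProbabilityMeasure (ProbabilityMeasure C)} (h : IsDirichletProcess Q α π)
    (η : LinkPrior.{u, v, w} C X) {n : ℕ} (hn : 0 < n) (L : List (Fin n)) {S : Set (Data n X)}
    (hS : MeasurableSet S) :
    ENNReal.ofReal (atomMoment n α 0 L) * dataLaw (offDiag C) η π n S ≤
        ∫⁻ ω in observe η n ⁻¹' S, ENNReal.ofReal (mono L (atomMass ω.2.1 ω.2.2))
          ∂jointLaw (offDiag C) η π n ∧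
      ∫⁻ ω in observe η n ⁻¹' S, ENNReal.ofReal (mono L (atomMass ω.2.1 ω.2.2))
          ∂jointLaw (offDiag C) η π n ≤
        ENNReal.ofReal (atomMoment n α α L) * dataLaw (offDiag C) η π n S := by
  have hobs := measurable_observe η n
  have hS' := hobs hS
  obtain ⟨Z, -, hZ⟩ := exists_lintegral_jointLaw_offDiag η π n
  have hWm : Measurable fun ω : Sample η n =>
      ENNReal.ofReal (mono L (atomMass ω.2.1 ω.2.2)) :=
    ((continuous_mono L).measurable.comp
      ((measurable_atomMass n).comp measurable_snd)).ennreal_ofReal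
  set f : η.H → (Fin n → C) → ℝ≥0∞ := fun θ => (distinct C n).indicator
    fun c => S.indicator 1 fun p => η.h θ (c p.1.1) (c p.1.2) with hf
  have hfm : ∀ θ, Measurable (f θ) := fun θ => ((measurable_one.indicator hS).comp
    ((measurable_array η n).comp measurable_prodMk_left)).indicator (measurableSet_distinct n)
  have hF : ∀ (F : Sample η n → ℝ≥0∞), distinctIntegral η π n
      ((observe η n ⁻¹' S).indicator F) = ∫⁻ θ, ∫⁻ P, ∫⁻ c, f θ c * F (θ, P, c)
        ∂iidKernel C n P ∂(π : Measure (ProbabilityMeasure C)) ∂(η.law : Measure η.H) := by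
    intro F
    refine lintegral_congr fun θ => lintegral_congr fun P => lintegral_congr fun c => ?_
    by_cases hc : c ∈ distinct C n
    · rw [hf, indicator_of_mem hc]
      simp only [indicator_of_mem hc]
      by_cases hx : (fun p => η.h θ (c p.1.1) (c p.1.2) : Data n X) ∈ S
      · rw [indicator_of_mem hx, indicator_of_mem (show (θ, P, c) ∈ observe η n ⁻¹' S from hx),
          Pi.one_apply, one_mul]
      · rw [indicator_of_notMem hx,
          indicator_of_notMem (show (θ, P, c) ∉ observe η n ⁻¹' S from hx), zero_mul]
    · rw [hf, indicator_of_notMem hc]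
      simp only [indicator_of_notMem hc, zero_mul]
  have hconst : ∀ a : ℝ≥0∞, a * dataLaw (offDiag C) η π n S = Z * ∫⁻ θ, ∫⁻ P, ∫⁻ c, f θ c * a
      ∂iidKernel C n P ∂(π : Measure (ProbabilityMeasure C)) ∂(η.law : Measure η.H) := by
    intro a
    rw [← hF fun _ => a, ← hZ _ (measurable_const.indicator hS'), lintegral_indicator hS',
      setLIntegral_const, dataLaw, Measure.map_apply hobs hS]
  have hmain : ∫⁻ ω in observe η n ⁻¹' S, ENNReal.ofReal (mono L (atomMass ω.2.1 ω.2.2))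
      ∂jointLaw (offDiag C) η π n = Z * ∫⁻ θ, ∫⁻ P, ∫⁻ c, f θ c * urnMoment Q α (atomSet C n) L c
      ∂iidKernel C n P ∂(π : Measure (ProbabilityMeasure C)) ∂(η.law : Measure η.H) := by
    rw [← lintegral_indicator hS', hZ _ (hWm.indicator hS'), hF]
    congr 1
    refine lintegral_congr fun θ => ?_
    rw [← h.lintegral_massProd hα L (measurableSet_atomSet n) (hfm θ)]
    · simp only [massProd_atomSet]
    · intro c hc i j hij
      have hcd : c ∈ distinct C n := by
        by_contra hcon
        exact hc (indicator_of_notMem hcon _)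
      rw [preimage_atomSet, preimage_atomSet, disjoint_singleton]
      exact fun h' => hij (hcd h')
  have hdist : ∀ θ c, ∀ {a b : ℝ≥0∞}, (c ∈ distinct C n → a ≤ b) → f θ c * a ≤ f θ c * b := by
    intro θ c a b hab
    by_cases hc : c ∈ distinct C n
    · exact mul_le_mul_right (hab hc) _
    · simp only [hf, indicator_of_notMem hc, zero_mul, le_refl]
  rw [hmain, hconst, hconst]
  constructor
  · exact mul_le_mul_right (lintegral_mono fun θ => lintegral_mono fun P => lintegral_mono
      fun c => hdist θ c fun hc => le_urnMoment_atomSet hn Q hα hc L) Z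
  · exact mul_le_mul_right (lintegral_mono fun θ => lintegral_mono fun P => lintegral_mono
      fun c => hdist θ c fun hc => urnMoment_atomSet_le hn Q hα hc L) Z

end AtomMass

section ConditionalBounds

variable {Ω D Y : Type*} [MeasurableSpace Ω] [MeasurableSpace D] [MeasurableSpace Y]
  [StandardBorelSpace Y] [Nonempty Y] {J : Measure Ω} [IsFiniteMeasure J] {X : Ω → D} {V : Ω → Y}

lemma setLIntegral_condDistrib (hX : Measurable X) (hV : Measurable V) {φ : Y → ℝ≥0∞}
    (hφ : Measurable φ) {S : Set D} (hS : MeasurableSet S) :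
    ∫⁻ x in S, ∫⁻ y, φ y ∂condDistrib V X J x ∂J.map X = ∫⁻ ω in X ⁻¹' S, φ (V ω) ∂J := by
  have hm : Measurable fun q : D × Y => φ q.2 := hφ.comp measurable_snd
  have h1 := setLIntegral_map (μ := J) (f := fun q : D × Y => φ q.2) (hS.prod .univ) hm
    (hX.prodMk hV)
  rw [← compProd_map_condDistrib hV.aemeasurable,
    Measure.setLIntegral_compProd hm hS .univ] at h1
  simp only [Measure.restrict_univ] at h1
  rw [h1]
  congr 2
  ext ω
  simp

lemma condDistrib_le_of_setLIntegral_le (hX : Measurable X) (hV : Measurable V) {φ : Y → ℝ≥0∞}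
    (hφ : Measurable φ) {a : ℝ≥0∞}
    (h : ∀ S, MeasurableSet S → ∫⁻ ω in X ⁻¹' S, φ (V ω) ∂J ≤ a * J.map X S) :
    ∀ᵐ x ∂J.map X, ∫⁻ y, φ y ∂condDistrib V X J x ≤ a := by
  refine ae_le_of_forall_setLIntegral_le_of_sigmaFinite (g := fun _ => a) hφ.lintegral_kernel
    fun S hS _ => ?_
  rw [setLIntegral_condDistrib hX hV hφ hS, setLIntegral_const]
  exact h S hS

lemma le_condDistrib_of_le_setLIntegral (hX : Measurable X) (hV : Measurable V) {φ : Y → ℝ≥0∞}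
    (hφ : Measurable φ) {a : ℝ≥0∞}
    (h : ∀ S, MeasurableSet S → a * J.map X S ≤ ∫⁻ ω in X ⁻¹' S, φ (V ω) ∂J) :
    ∀ᵐ x ∂J.map X, a ≤ ∫⁻ y, φ y ∂condDistrib V X J x := by
  refine ae_le_of_forall_setLIntegral_le_of_sigmaFinite (f := fun _ => a) measurable_const
    fun S hS _ => ?_
  rw [setLIntegral_condDistrib hX hV hφ hS, setLIntegral_const]
  exact h S hS

end ConditionalBounds

/-! ### The limit of the posteriors -/

section Limit

/-- The mass `∑_{i ≠ j} w_i w_j`. -/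
def pairMass {n : ℕ} (w : Fin n → ℝ) : ℝ :=
  ∑ p : {p : Fin n × Fin n // p.1 ≠ p.2}, w p.1.1 * w p.1.2

open Classical in
/-- The part of the mass `∑_{i ≠ j} w_i w_j` carried by the pairs in `I`. -/
def cellMass {n : ℕ} (I : {p : Fin n × Fin n // p.1 ≠ p.2} → Prop) (w : Fin n → ℝ) : ℝ :=
  ∑ p, if I p then w p.1.1 * w p.1.2 else 0

lemma continuous_pairMass (n : ℕ) : Continuous (pairMass : (Fin n → ℝ) → ℝ) := by
  unfold pairMass
  fun_prop

lemma continuous_cellMass {n : ℕ} (I : {p : Fin n × Fin n // p.1 ≠ p.2} → Prop) :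
    Continuous (cellMass I) := by
  refine continuous_finsetSum _ fun p _ => ?_
  split_ifs
  · fun_prop
  · exact continuous_const

lemma pairMass_nonneg {n : ℕ} {w : Fin n → ℝ} (hw : ∀ i, 0 ≤ w i) : 0 ≤ pairMass w :=
  Finset.sum_nonneg fun _ _ => mul_nonneg (hw _) (hw _)

lemma cellMass_nonneg {n : ℕ} (I : {p : Fin n × Fin n // p.1 ≠ p.2} → Prop) {w : Fin n → ℝ}
    (hw : ∀ i, 0 ≤ w i) : 0 ≤ cellMass I w :=
  Finset.sum_nonneg fun p _ => by
    split_ifs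
    exacts [mul_nonneg (hw _) (hw _), le_rfl]

lemma cellMass_le_pairMass {n : ℕ} (I : {p : Fin n × Fin n // p.1 ≠ p.2} → Prop) {w : Fin n → ℝ}
    (hw : ∀ i, 0 ≤ w i) : cellMass I w ≤ pairMass w :=
  Finset.sum_le_sum fun p _ => by
    split_ifs
    exacts [le_rfl, mul_nonneg (hw _) (hw _)]

variable {C : Type u} {X : Type v} [MeasurableSpace C] [MeasurableSpace X]

section Estimate

variable [StandardBorelSpace C]

lemma pairLaw_offDiag_real {h : C → C → X} (hh : Measurable fun p : C × C => h p.1 p.2)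
    (P : ProbabilityMeasure C) {B : Set X} (hB : MeasurableSet B) :
    (pairLaw (offDiag C) h P).real B =
      ((P : Measure C).prod (P : Measure C)).real
          (offDiag C ∩ (fun p : C × C => h p.1 p.2) ⁻¹' B) /
        ((P : Measure C).prod (P : Measure C)).real (offDiag C) := by
  rw [pairLaw, map_measureReal_apply hh hB, Measure.real, cond_apply measurableSet_offDiag,
    ENNReal.toReal_mul, ENNReal.toReal_inv, div_eq_inv_mul]
  rfl

/-- If the observed points carry most of the mass of `P`, then the law of `h(C_i, C_j)` is close
to its restriction to the pairs of observed points. -/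
lemma abs_pairLaw_mul_sub_cellMass_le {n : ℕ} {h : C → C → X}
    (hh : Measurable fun p : C × C => h p.1 p.2) (P : ProbabilityMeasure C) {c : Fin n → C}
    (hc : c ∈ distinct C n) {B : Set X} (hB : MeasurableSet B) :
    |(pairLaw (offDiag C) h P).real B * pairMass (atomMass P c) -
        cellMass (fun p => h (c p.1.1) (c p.1.2) ∈ B) (atomMass P c)| ≤
      1 - (∑ i, atomMass P c i) ^ 2 := by
  classical
  set M := (P : Measure C).prod (P : Measure C) with hM
  set pt : {p : Fin n × Fin n // p.1 ≠ p.2} → Set (C × C) :=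
    fun p => {(c p.1.1, c p.1.2)} with hpt
  set U : Set (C × C) := ⋃ p, pt p with hU
  set G : Set (C × C) := offDiag C ∩ (fun p : C × C => h p.1 p.2) ⁻¹' B with hG
  have hO := measurableSet_offDiag (C := C)
  have hGm : MeasurableSet G := hO.inter (hh hB)
  have hptm : ∀ p, MeasurableSet (pt p) := fun p => measurableSet_singleton _
  have hUm : MeasurableSet U := MeasurableSet.iUnion hptm
  have hUO : U ⊆ offDiag C := iUnion_subset fun p => by
    rw [hpt, singleton_subset_iff]
    exact fun h' => p.2 (hc h')
  have hdisj : Pairwise fun p q => Disjoint (pt p) (pt q) := by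
    intro p q hpq
    rw [hpt, disjoint_singleton]
    intro h'
    refine hpq (Subtype.ext (Prod.ext (hc (congrArg Prod.fst h')) (hc (congrArg Prod.snd h'))))
  have hptM : ∀ p, M.real (pt p) = atomMass P c p.1.1 * atomMass P c p.1.2 := by
    intro p
    simp only [hpt, hM]
    rw [← singleton_prod_singleton, measureReal_prod_prod]
    rfl
  have hd : M.real U = pairMass (atomMass P c) := by
    rw [hU, measureReal_iUnion_fintype hdisj hptm, pairMass]
    exact Finset.sum_congr rfl fun p _ => hptM p
  have hN : M.real (U ∩ G) = cellMass (fun p => h (c p.1.1) (c p.1.2) ∈ B) (atomMass P c) := by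
    rw [hU, iUnion_inter, measureReal_iUnion_fintype
      (fun p q hpq => (hdisj hpq).mono inter_subset_left inter_subset_left)
      fun p => (hptm p).inter hGm, cellMass]
    refine Finset.sum_congr rfl fun p _ => ?_
    by_cases hp : h (c p.1.1) (c p.1.2) ∈ B
    · have : pt p ∩ G = pt p := inter_eq_left.2 (singleton_subset_iff.2
        ⟨hUO (mem_iUnion.2 ⟨p, rfl⟩), hp⟩)
      rw [if_pos hp, this, hptM]
    · have : pt p ∩ G = ∅ := singleton_inter_eq_empty.2 fun h' => hp h'.2
      rw [if_neg hp, this, measureReal_empty]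
  -- what is left of the off-diagonal pairs involves an unobserved point
  have hrest : M.real (offDiag C \ U) ≤ 1 - (∑ i, atomMass P c i) ^ 2 := by
    set A := range c with hA
    have hAm : MeasurableSet A := (finite_range c).measurableSet
    have hAP : (P : Measure C).real A = ∑ i, atomMass P c i := by
      rw [hA, ← iUnion_singleton_eq_range, measureReal_iUnion_fintype
        (fun i j hij => disjoint_singleton.2 fun h' => hij (hc h'))
        fun i => measurableSet_singleton _]
      rfl
    have hsub : offDiag C \ U ⊆ (A ×ˢ A)ᶜ := by
      rintro ⟨a, b⟩ ⟨hab, hnU⟩ ⟨⟨i, rfl⟩, ⟨j, rfl⟩⟩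
      exact hnU (mem_iUnion.2 ⟨⟨(i, j), fun hij => hab (congrArg c hij)⟩, rfl⟩)
    refine (measureReal_mono hsub).trans ?_
    rw [probReal_compl_eq_one_sub (hAm.prod hAm), hM, measureReal_prod_prod, hAP, sq]
  have hO' : M.real (offDiag C) = M.real U + M.real (offDiag C \ U) := by
    rw [← measureReal_inter_add_sdiff (s := offDiag C) hUm, inter_eq_right.2 hUO]
  have hG' : M.real G = M.real (U ∩ G) + M.real (G \ U) := by
    rw [← measureReal_inter_add_sdiff (s := G) hUm, inter_comm]
  have h1 : M.real (G \ U) ≤ M.real (offDiag C \ U) :=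
    measureReal_mono (sdiff_subset_sdiff_left inter_subset_left)
  have h2 : 0 ≤ M.real (G \ U) := measureReal_nonneg
  have h3 : 0 ≤ M.real (U ∩ G) := measureReal_nonneg
  have h4 : M.real (U ∩ G) ≤ M.real U := measureReal_mono inter_subset_left
  rw [pairLaw_offDiag_real hh P hB, ← hd, ← hN]
  refine le_trans ?_ hrest
  set o := M.real (offDiag C)
  set e := M.real (offDiag C \ U)
  set g := M.real G
  set g' := M.real (G \ U)
  set d := M.real U
  set N := M.real (U ∩ G)
  rcases (show 0 ≤ o by rw [hO']; linarith).eq_or_lt with h0 | h0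
  · have hd0 : d = 0 := by linarith
    have hN0 : N = 0 := by linarith
    rw [hd0, hN0, mul_zero, sub_zero, abs_zero]
    linarith
  · have h5 : g / o * d - N = g' - g / o * e := by
      have : g / o * o = g := div_mul_cancel₀ _ h0.ne'
      have h6 : g / o * o = g / o * d + g / o * e := by rw [← mul_add, ← hO']
      linarith
    have h6 : 0 ≤ g / o := div_nonneg (by linarith) h0.le
    have h7 : g / o ≤ 1 := (div_le_one h0).2 (by linarith)
    have h8 : 0 ≤ g / o * e := mul_nonneg h6 (by linarith)
    have h9 : g / o * e ≤ e := mul_le_of_le_one_left (by linarith) h7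
    rw [h5, abs_le]
    constructor <;> linarith

lemma measurable_pairLaw_offDiag_real (η : LinkPrior.{u, v, w} C X) (n : ℕ) {B : Set X}
    (hB : MeasurableSet B) :
    Measurable fun ω : Sample η n => (pairLaw (offDiag C) (η.h ω.1) ω.2.1).real B := by
  have hsec : ∀ θ, Measurable fun p : C × C => η.h θ p.1 p.2 :=
    fun θ => η.measurable_h.comp measurable_prodMk_left
  simp only [pairLaw_offDiag_real (hsec _) _ hB]
  have key : ∀ {t : Set (Sample η n × C × C)}, MeasurableSet t → Measurable fun ω : Sample η n =>
      ((ω.2.1 : Measure C).prod (ω.2.1 : Measure C)).real (Prod.mk ω ⁻¹' t) := by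
    intro t ht
    have hm : Measurable fun ω : Sample η n => ω.2.1 := measurable_fst.comp measurable_snd
    have := Kernel.measurable_kernel_prodMk_left
      (κ := (evalKernel C ×ₖ evalKernel C).comap _ hm) ht
    simp only [Kernel.comap_apply, Kernel.prod_apply, evalKernel_apply] at this
    exact this.ennreal_toReal
  have hO : MeasurableSet (Prod.snd ⁻¹' offDiag C : Set (Sample η n × C × C)) :=
    measurable_snd measurableSet_offDiag
  have hp : Measurable fun q : Sample η n × C × C => η.h q.1.1 q.2.1 q.2.2 :=
    η.measurable_h.comp ((measurable_fst.comp measurable_fst).prodMk measurable_snd)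
  exact (key (hO.inter (hp hB))).div (key hO)

end Estimate

section Mixture

variable {n : ℕ} (p₀ : {p : Fin n × Fin n // p.1 ≠ p.2})

open Classical in
/-- The weights `w_i w_j / ∑_{k ≠ l} w_k w_l` of the pairs. If these are not defined, all the weight
is put on the pair `p₀`. -/
def pairWeight (w : Fin n → ℝ) (p : {p : Fin n × Fin n // p.1 ≠ p.2}) : ℝ :=
  if (∀ i, 0 ≤ w i) ∧ 0 < pairMass w then w p.1.1 * w p.1.2 / pairMass w
  else if p = p₀ then 1 else 0

lemma pairWeight_nonneg (w : Fin n → ℝ) (p : {p : Fin n × Fin n // p.1 ≠ p.2}) :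
    0 ≤ pairWeight p₀ w p := by
  unfold pairWeight
  split_ifs with h
  exacts [div_nonneg (mul_nonneg (h.1 _) (h.1 _)) h.2.le, zero_le_one, le_rfl]

lemma sum_pairWeight (w : Fin n → ℝ) : ∑ p, pairWeight p₀ w p = 1 := by
  by_cases h : (∀ i, 0 ≤ w i) ∧ 0 < pairMass w
  · simp only [pairWeight, if_pos h]
    rw [← Finset.sum_div]
    exact div_self h.2.ne'
  · simp [pairWeight, if_neg h]

lemma measurable_pairWeight (p : {p : Fin n × Fin n // p.1 ≠ p.2}) :
    Measurable fun w => pairWeight p₀ w p := by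
  have hd := (continuous_pairMass n).measurable
  have hs : MeasurableSet {w : Fin n → ℝ | (∀ i, 0 ≤ w i) ∧ 0 < pairMass w} := by
    have h1 : {w : Fin n → ℝ | (∀ i, 0 ≤ w i) ∧ 0 < pairMass w} =
        (⋂ i, (fun w : Fin n → ℝ => w i) ⁻¹' Ici 0) ∩ pairMass ⁻¹' Ioi 0 := by
      ext w
      simp
    rw [h1]
    exact (MeasurableSet.iInter fun i => measurable_pi_apply i measurableSet_Ici).inter
      (hd measurableSet_Ioi)
  unfold pairWeight
  refine Measurable.ite hs ?_ measurable_const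
  exact Measurable.div (f := fun w : Fin n → ℝ => w p.1.1 * w p.1.2) (by fun_prop) hd

/-- The discrete law that gives to the observation `x_{ij}` the weight
`w_i w_j / ∑_{k ≠ l} w_k w_l`. -/
def pairMixture (x : Data n X) (w : Fin n → ℝ) : ProbabilityMeasure X :=
  ⟨∑ p, ENNReal.ofReal (pairWeight p₀ w p) • Measure.dirac (x p), by
    constructor
    simp only [Measure.finsetSum_apply, Measure.smul_apply, measure_univ, smul_eq_mul, mul_one]
    rw [← ENNReal.ofReal_sum_of_nonneg fun p _ => pairWeight_nonneg p₀ w p, sum_pairWeight,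
      ENNReal.ofReal_one]⟩

lemma measurable_pairMixture :
    Measurable fun q : Data n X × (Fin n → ℝ) => pairMixture p₀ q.1 q.2 := by
  refine Measurable.subtype_mk (Measure.measurable_of_measurable_coe _ fun s hs => ?_)
  simp only [Measure.finsetSum_apply, Measure.smul_apply, smul_eq_mul,
    Measure.dirac_apply' _ hs]
  refine Finset.measurable_sum _ fun p _ => Measurable.mul ?_ ?_
  · exact ((measurable_pairWeight p₀ p).comp measurable_snd).ennreal_ofReal
  · exact (measurable_one.indicator hs).comp ((measurable_pi_apply p).comp measurable_fst)

open Classical in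
lemma evalVec_pairMixture {R : ℕ} {B : Fin R → Set X} (hB : ∀ r, MeasurableSet (B r))
    (x : Data n X) (w : Fin n → ℝ) :
    evalVec B (pairMixture p₀ x w) =
      fun r => ∑ p, pairWeight p₀ w p * if x p ∈ B r then 1 else 0 := by
  ext r
  have h : ((pairMixture p₀ x w : ProbabilityMeasure X) : Measure X) =
      ∑ p, ENNReal.ofReal (pairWeight p₀ w p) • Measure.dirac (x p) := rfl
  rw [evalVec, h, measureReal_def, Measure.finsetSum_apply,
    ENNReal.toReal_sum fun p _ => by
      rw [Measure.smul_apply, smul_eq_mul]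
      finiteness]
  refine Finset.sum_congr rfl fun p _ => ?_
  rw [Measure.smul_apply, smul_eq_mul, ENNReal.toReal_mul,
    ENNReal.toReal_ofReal (pairWeight_nonneg p₀ w p), Measure.dirac_apply' _ (hB r)]
  by_cases hx : x p ∈ B r <;> simp [hx]

lemma evalVec_pairMixture_of_pos {R : ℕ} {B : Fin R → Set X} (hB : ∀ r, MeasurableSet (B r))
    (x : Data n X) {w : Fin n → ℝ} (hw : ∀ i, 0 ≤ w i) (hd : 0 < pairMass w) :
    evalVec B (pairMixture p₀ x w) = fun r => cellMass (fun p => x p ∈ B r) w / pairMass w := by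
  classical
  rw [evalVec_pairMixture p₀ hB]
  ext r
  rw [cellMass, Finset.sum_div]
  refine Finset.sum_congr rfl fun p _ => ?_
  rw [pairWeight, if_pos ⟨hw, hd⟩]
  split_ifs <;> simp

/-- The limit of the posteriors: the law of `∑_{i ≠ j} w_i w_j δ_{x_ij} / ∑_{i ≠ j} w_i w_j` when
`w` is uniform on the simplex. -/
def limitPosterior (X : Type v) [MeasurableSpace X] :
    Kernel (Data n X) (ProbabilityMeasure X) :=
  (Kernel.id ×ₖ Kernel.const (Data n X) (dirichletLaw fun _ : Fin n => (1 : ℝ))).map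
    fun q => pairMixture p₀ q.1 q.2

instance isProbabilityMeasure_dirichletLaw_one (n : ℕ) :
    IsProbabilityMeasure (dirichletLaw fun _ : Fin n => (1 : ℝ)) :=
  isProbabilityMeasure_dirichletLaw fun _ => zero_le_one

instance : IsMarkovKernel (limitPosterior p₀ X) :=
  Kernel.IsMarkovKernel.map _ (measurable_pairMixture p₀)

lemma limitPosterior_apply (x : Data n X) :
    limitPosterior p₀ X x =
      (dirichletLaw fun _ : Fin n => (1 : ℝ)).map (pairMixture p₀ x) := by
  rw [limitPosterior, Kernel.map_apply _ (measurable_pairMixture p₀), Kernel.prod_apply,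
    Kernel.id_apply, Kernel.const_apply, Measure.dirac_prod,
    Measure.map_map (measurable_pairMixture p₀) measurable_prodMk_left]
  rfl

lemma limitPosterior_map_evalVec {R : ℕ} {B : Fin R → Set X} (hB : ∀ r, MeasurableSet (B r))
    (x : Data n X) :
    (limitPosterior p₀ X x).map (evalVec B) = (dirichletLaw fun _ : Fin n => (1 : ℝ)).map
      fun w => evalVec B (pairMixture p₀ x w) := by
  have hm : Measurable (pairMixture p₀ x) :=
    Measurable.of_uncurry_left (f := pairMixture p₀) (measurable_pairMixture p₀)
  rw [limitPosterior_apply, Measure.map_map (measurable_evalVec hB) hm]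
  rfl

lemma limitPosterior_doesNotSmooth (m : Measure (Data n X)) :
    DoesNotSmooth m fun B x => (limitPosterior p₀ X x).map (evalVec B) := by
  classical
  intro R B hB
  refine ⟨fun I => (dirichletLaw fun _ : Fin n => (1 : ℝ)).map
    fun w r => ∑ p, pairWeight p₀ w p * if I p r then 1 else 0, ae_of_all _ fun x => ?_⟩
  refine (limitPosterior_map_evalVec p₀ hB.measurable x).trans ?_
  simp only [evalVec_pairMixture p₀ hB.measurable]

end Mixture

end Limit

/-! ### Convergence of the posteriors -/

section Convergence

variable {C : Type u} {X : Type v} [MeasurableSpace C] [MeasurableSpace X] [StandardBorelSpace C]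

/-- For a fixed precision, a disintegration of `(P_{X_ij}(B_r))_r` and of the atom masses over the
data, with what is needed about it to let the precision tend to zero. -/
lemma IsDirichletProcess.exists_condDistrib {Q : ProbabilityMeasure C} {α : ℝ} (hα : 0 < α)
    {π : ProbabilityMeasure (ProbabilityMeasure C)} (h : IsDirichletProcess Q α π)
    (η : LinkPrior.{u, v, w} C X) {n : ℕ} (hn : 0 < n) {R : ℕ} {B : Fin R → Set X}
    (hB : ∀ r, MeasurableSet (B r)) :
    ∃ κ : Kernel (Data n X) ((Fin R → ℝ) × (Fin n → ℝ)), IsMarkovKernel κ ∧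
      ∀ᵐ x ∂dataLaw (offDiag C) η π n,
        posterior (offDiag C) η π n B x = (κ x).map Prod.fst ∧
        (∀ᵐ q ∂κ x, q.1 ∈ cube (Fin R) ∧ q.2 ∈ cube (Fin n) ∧
          ∀ r, |q.1 r * pairMass q.2 - cellMass (fun p => x p ∈ B r) q.2| ≤
            1 - (∑ i, q.2 i) ^ 2) ∧
        ∀ L : List (Fin n), atomMoment n α 0 L ≤ ∫ q, mono L q.2 ∂κ x ∧
          ∫ q, mono L q.2 ∂κ x ≤ atomMoment n α α L := by
  classical
  set J := jointLaw (offDiag C) η π n with hJ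
  set O : Sample η n → Data n X := observe η n with hO
  have hOm : Measurable O := measurable_observe η n
  set V : Sample η n → Fin R → ℝ :=
    fun ω r => (pairLaw (offDiag C) (η.h ω.1) ω.2.1).real (B r) with hV
  have hVm : Measurable V :=
    measurable_pi_iff.2 fun r => measurable_pairLaw_offDiag_real η n (hB r)
  set W : Sample η n → Fin n → ℝ := fun ω => atomMass ω.2.1 ω.2.2 with hW
  have hWm : Measurable W := (measurable_atomMass n).comp measurable_snd
  have hVW : Measurable fun ω => (V ω, W ω) := hVm.prodMk hWm
  set κ := condDistrib (fun ω => (V ω, W ω)) O J with hκ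
  have hsec : ∀ θ, Measurable fun p : C × C => η.h θ p.1 p.2 :=
    fun θ => η.measurable_h.comp measurable_prodMk_left
  -- almost surely the latent values are distinct
  have hdist : ∀ᵐ ω ∂J, ω.2.2 ∈ distinct C n := by
    have := ae_cond_mem (μ := (η.law : Measure η.H).prod
      ((π : Measure (ProbabilityMeasure C)) ⊗ₘ iidKernel C n))
      (measurableSet_allDefined_offDiag η n)
    rw [allDefined_offDiag] at this
    rw [hJ, jointLaw, allDefined_offDiag]
    exact this
  set good : Set (Data n X × (Fin R → ℝ) × (Fin n → ℝ)) :=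
    {t | t.2.1 ∈ cube (Fin R) ∧ t.2.2 ∈ cube (Fin n) ∧
      ∀ r, |t.2.1 r * pairMass t.2.2 - cellMass (fun p => t.1 p ∈ B r) t.2.2| ≤
        1 - (∑ i, t.2.2 i) ^ 2} with hgood
  have hgm : MeasurableSet good := by
    have hm1 : Measurable fun t : Data n X × (Fin R → ℝ) × (Fin n → ℝ) => t.2.1 :=
      measurable_fst.comp measurable_snd
    have hm2 : Measurable fun t : Data n X × (Fin R → ℝ) × (Fin n → ℝ) => t.2.2 :=
      measurable_snd.comp measurable_snd
    have hc : ∀ r, Measurable fun t : Data n X × (Fin R → ℝ) × (Fin n → ℝ) =>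
        cellMass (fun p => t.1 p ∈ B r) t.2.2 := by
      intro r
      unfold cellMass
      refine Finset.measurable_sum _ fun p _ => Measurable.ite ?_ ?_ measurable_const
      · exact ((measurable_pi_apply p).comp measurable_fst) (hB r)
      · exact Measurable.mul (f := fun t : Data n X × (Fin R → ℝ) × (Fin n → ℝ) => t.2.2 p.1.1)
          ((measurable_pi_apply _).comp hm2) ((measurable_pi_apply _).comp hm2)
    have hs : Measurable fun t : Data n X × (Fin R → ℝ) × (Fin n → ℝ) =>
        1 - (∑ i, t.2.2 i) ^ 2 :=
      measurable_const.sub ((Finset.measurable_sum _ fun i _ =>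
        (measurable_pi_apply i).comp hm2).pow_const 2)
    have hle : ∀ r, MeasurableSet {t : Data n X × (Fin R → ℝ) × (Fin n → ℝ) |
        |t.2.1 r * pairMass t.2.2 - cellMass (fun p => t.1 p ∈ B r) t.2.2| ≤
          1 - (∑ i, t.2.2 i) ^ 2} := by
      intro r
      refine measurableSet_le ?_ hs
      refine Measurable.abs (Measurable.sub ?_ (hc r))
      exact Measurable.mul (f := fun t : Data n X × (Fin R → ℝ) × (Fin n → ℝ) => t.2.1 r)
        ((measurable_pi_apply r).comp hm1) ((continuous_pairMass n).measurable.comp hm2)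
    have hEq : good = ((fun t => t.2.1) ⁻¹' cube (Fin R)) ∩ (((fun t => t.2.2) ⁻¹' cube (Fin n)) ∩
        ⋂ r, {t : Data n X × (Fin R → ℝ) × (Fin n → ℝ) |
          |t.2.1 r * pairMass t.2.2 - cellMass (fun p => t.1 p ∈ B r) t.2.2| ≤
            1 - (∑ i, t.2.2 i) ^ 2}) := by
      ext t
      simp [hgood]
    rw [hEq]
    exact (hm1 (measurableSet_cube R)).inter ((hm2 (measurableSet_cube n)).inter
      (MeasurableSet.iInter hle))
  have hae : ∀ᵐ ω ∂J, (O ω, V ω, W ω) ∈ good := by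
    filter_upwards [hdist] with ω hω
    refine ⟨fun r _ => ⟨measureReal_nonneg, ?_⟩, atomMass_mem_cube _ _, fun r =>
      abs_pairLaw_mul_sub_cellMass_le (hsec ω.1) ω.2.1 hω (hB r)⟩
    change (pairLaw (offDiag C) (η.h ω.1) ω.2.1).real (B r) ≤ 1
    rw [pairLaw_offDiag_real (hsec _) _ (hB r)]
    exact div_le_one_of_le₀ (measureReal_mono inter_subset_left) measureReal_nonneg
  have hfib : ∀ᵐ x ∂J.map O, ∀ᵐ q ∂κ x, (x, q) ∈ good := by
    refine Measure.ae_ae_of_ae_compProd (p := fun t => t ∈ good) ?_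
    rw [hκ, compProd_map_condDistrib hVW.aemeasurable]
    exact (ae_map_iff (hOm.prodMk hVW).aemeasurable (p := fun t => t ∈ good) hgm).2 hae
  have hφ : ∀ L : List (Fin n), Measurable fun q : (Fin R → ℝ) × (Fin n → ℝ) =>
      ENNReal.ofReal (mono L q.2) := fun L =>
    ((continuous_mono L).measurable.comp measurable_snd).ennreal_ofReal
  have hup : ∀ᵐ x ∂J.map O, ∀ L : List (Fin n),
      ∫⁻ q, ENNReal.ofReal (mono L q.2) ∂κ x ≤ ENNReal.ofReal (atomMoment n α α L) :=
    ae_all_iff.2 fun L => condDistrib_le_of_setLIntegral_le hOm hVW (hφ L) fun S hS =>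
      (h.setLIntegral_mono_atomMass hα η hn L hS).2
  have hlo : ∀ᵐ x ∂J.map O, ∀ L : List (Fin n),
      ENNReal.ofReal (atomMoment n α 0 L) ≤ ∫⁻ q, ENNReal.ofReal (mono L q.2) ∂κ x :=
    ae_all_iff.2 fun L => le_condDistrib_of_le_setLIntegral hOm hVW (hφ L) fun S hS =>
      (h.setLIntegral_mono_atomMass hα η hn L hS).1
  have hfst : condDistrib V O J =ᵐ[J.map O] κ.map Prod.fst :=
    condDistrib_comp O hVW.aemeasurable measurable_fst
  refine ⟨κ, inferInstance, ?_⟩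
  change ∀ᵐ x ∂J.map O, _
  filter_upwards [hfib, hup, hlo, hfst] with x hx hxu hxl hxf
  refine ⟨?_, hx, fun L => ?_⟩
  · rw [← Kernel.map_apply _ measurable_fst, ← hxf]
    rfl
  · have hnn : ∀ᵐ q ∂κ x, 0 ≤ mono L q.2 := hx.mono fun q hq => (mono_mem_Icc hq.2.1 L).1
    have hmm : Measurable fun q : (Fin R → ℝ) × (Fin n → ℝ) => mono L q.2 :=
      (continuous_mono L).measurable.comp measurable_snd
    rw [integral_eq_lintegral_of_nonneg_ae hnn hmm.aestronglyMeasurable]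
    constructor
    · rw [← ENNReal.ofReal_le_iff_le_toReal]
      · exact hxl L
      · exact ne_top_of_le_ne_top ENNReal.ofReal_ne_top (hxu L)
    · exact ENNReal.toReal_le_of_le_ofReal (atomMoment_nonneg hα.le hα.le L) (hxu L)

lemma pairMass_pos {n : ℕ} (p₀ : {p : Fin n × Fin n // p.1 ≠ p.2}) {w : Fin n → ℝ}
    (hw : ∀ i, 0 < w i) : 0 < pairMass w :=
  Finset.sum_pos (fun _ _ => mul_pos (hw _) (hw _)) ⟨p₀, Finset.mem_univ _⟩

/-- As the precision tends to zero, `P_C` concentrates on the latent values, with weights that are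
uniform on the simplex whatever the data are. -/
theorem isLimitPosterior_limitPosterior (Q : ProbabilityMeasure C) (η : LinkPrior.{u, v, w} C X)
    {n : ℕ} (p₀ : {p : Fin n × Fin n // p.1 ≠ p.2}) :
    IsLimitPosterior Q η n (limitPosterior p₀ X) := by
  intro α π hπ hα R B hB j
  have hn : 0 < n := p₀.1.1.pos
  choose κ hκM hκ using fun m =>
    (hπ m).2.exists_condDistrib (hπ m).1 η hn (B := B) hB.measurable
  have hall : ∀ᵐ x ∂dataLaw (offDiag C) η (π j) n, ∀ m, _ := ae_all_iff.2 fun m =>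
    ((hπ j).2.dataLaw_offDiag_absolutelyContinuous (hπ j).1 (hπ m).1 (hπ m).2 η n).ae_le (hκ m)
  filter_upwards [hall] with x hx f
  set D := dirichletLaw fun _ : Fin n => (1 : ℝ) with hD
  have hsum : 0 < ∑ _r : Fin n, (1 : ℝ) := by simpa using hn
  have hDae : ∀ᵐ w ∂D, (∀ i, 0 < w i) ∧ ∑ i, w i = 1 := by
    filter_upwards [ae_dirichletLaw (fun _ => zero_le_one) hsum] with w hw
    exact ⟨fun i => (hw.1 i).2 one_pos, hw.2⟩
  have hDcube : ∀ᵐ w ∂D, w ∈ cube (Fin n) := ae_dirichletLaw_mem_cube (fun _ => zero_le_one) hsum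
  -- convergence of the conditional law of the atom masses
  have hW : ∀ F : (Fin n → ℝ) → ℝ, Continuous F →
      Tendsto (fun m => ∫ q, F q.2 ∂κ m x) atTop (𝓝 (∫ w, F w ∂D)) := by
    intro F hF
    have hmap : ∀ m (F : (Fin n → ℝ) → ℝ), Continuous F →
        ∫ w, F w ∂(κ m x).map Prod.snd = ∫ q, F q.2 ∂κ m x := fun m F hF =>
      integral_map measurable_snd.aemeasurable hF.aestronglyMeasurable
    have hM : ∀ m, IsProbabilityMeasure ((κ m x).map Prod.snd) := fun m =>
      Measure.isProbabilityMeasure_map measurable_snd.aemeasurable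
    have := tendsto_integral_of_moments (μ := fun m => (κ m x).map Prod.snd) (ν := D)
      (fun m => (ae_map_iff measurable_snd.aemeasurable (p := fun w => w ∈ cube (Fin n))
        (measurableSet_cube n)).2 ((hx m).2.1.mono fun q hq => hq.2.1)) hDcube
      (fun L => by
        simp only [hmap _ _ (continuous_mono L)]
        exact tendsto_of_tendsto_of_tendsto_of_le_of_le
          (tendsto_atomMoment hn hα tendsto_const_nhds L) (tendsto_atomMoment hn hα hα L)
          (fun m => ((hx m).2.2 L).1) fun m => ((hx m).2.2 L).2) F hF
    simpa only [hmap _ _ hF] using this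
  have hnn : ∀ w ∈ cube (Fin n), ∀ i, 0 ≤ w i := fun w hw i => (hw i (mem_univ i)).1
  -- convergence of the moments of the posterior
  have hV : ∀ L : List (Fin R), Tendsto (fun m => ∫ q, mono L q.1 ∂κ m x) atTop
      (𝓝 (∫ w, mono L (fun r => cellMass (fun p => x p ∈ B r) w / pairMass w) ∂D)) := by
    refine tendsto_integral_mono_of_ratio (s := fun w => 1 - (∑ i, w i) ^ 2)
      (continuous_pairMass n) (by fun_prop) (fun r => continuous_cellMass _) (fun m => (hx m).2.1)
      (fun w hw => ⟨pairMass_nonneg (hnn w hw), fun r => ⟨cellMass_nonneg _ (hnn w hw),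
        cellMass_le_pairMass _ (hnn w hw)⟩⟩) ?_ hW
    filter_upwards [hDae, hDcube] with w hw hwc
    refine ⟨hwc, pairMass_pos p₀ hw.1, ?_⟩
    rw [hw.2]
    norm_num
  have hpost : ∀ m, IsProbabilityMeasure (posterior (offDiag C) η (π m) n B x) := by
    intro m
    rw [(hx m).1]
    exact Measure.isProbabilityMeasure_map measurable_fst.aemeasurable
  have hevm := measurable_evalVec (C := X) hB.measurable
  have hlim : IsProbabilityMeasure ((limitPosterior p₀ X x).map (evalVec B)) :=
    Measure.isProbabilityMeasure_map hevm.aemeasurable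
  refine tendsto_integral_of_moments (fun m => ?_) ?_ (fun L => ?_) f f.continuous
  · rw [(hx m).1]
    exact (ae_map_iff measurable_fst.aemeasurable (p := fun w => w ∈ cube (Fin R))
      (measurableSet_cube R)).2 ((hx m).2.1.mono fun q hq => hq.1)
  · exact (ae_map_iff hevm.aemeasurable (p := fun w => w ∈ cube (Fin R))
      (measurableSet_cube R)).2 (ae_of_all _ fun P => evalVec_mem_cube B P)
  · have h1 : ∀ m, ∫ v, mono L v ∂posterior (offDiag C) η (π m) n B x =
        ∫ q, mono L q.1 ∂κ m x := by
      intro m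
      rw [(hx m).1]
      exact integral_map measurable_fst.aemeasurable (continuous_mono L).aestronglyMeasurable
    have hmix : Measurable fun w => evalVec B (pairMixture p₀ x w) :=
      hevm.comp (Measurable.of_uncurry_left (f := pairMixture p₀) (measurable_pairMixture p₀))
    have h2 : ∫ v, mono L v ∂(limitPosterior p₀ X x).map (evalVec B) =
        ∫ w, mono L (fun r => cellMass (fun p => x p ∈ B r) w / pairMass w) ∂D := by
      rw [limitPosterior_map_evalVec p₀ hB.measurable,
        integral_map hmix.aemeasurable (continuous_mono L).aestronglyMeasurable]
      refine integral_congr_ae ?_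
      filter_upwards [hDae] with w hw
      rw [evalVec_pairMixture_of_pos p₀ hB.measurable x (fun i => (hw.1 i).le)
        (pairMass_pos p₀ hw.1)]
    simp only [h1, h2]
    exact hV L

end Convergence

end Bilateral

end

theorem mainTheorem4 {C : Type u} {X : Type v}
    [MeasurableSpace C] [StandardBorelSpace C] [MeasurableSpace X] [StandardBorelSpace X] :
    (∀ (Q : ProbabilityMeasure C) (η : LinkPrior.{u, v, w} C X) (n : ℕ), 2 ≤ n →
      ∃ Lim : Kernel (Data n X) (ProbabilityMeasure X), IsMarkovKernel Lim ∧
        IsLimitPosterior Q η n Lim ∧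
        ∀ (α : ℝ) (π : ProbabilityMeasure (ProbabilityMeasure C)),
          0 < α → IsDirichletProcess Q α π →
          DoesNotSmooth (dataLaw (offDiag C) η π n) fun B x => (Lim x).map (evalVec B)) ∧
    ((∃ e : C → X, Measurable e ∧ Function.Injective e) →
      ∃ η : LinkPrior.{u, v, w} C X, ∀ π : ProbabilityMeasure (ProbabilityMeasure C),
        (∀ n : ℕ, 2 ≤ n → DoesNotSmooth (dataLaw Set.univ η π n) (posterior Set.univ η π n)) ↔
          ((∃ (Q : ProbabilityMeasure C) (α : ℝ), 0 < α ∧ IsDirichletProcess Q α π) ∨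
            IsTrivialProcess π)) := by
  constructor
  · intro Q η n hn
    have p₀ : {p : Fin n × Fin n // p.1 ≠ p.2} :=
      ⟨(⟨0, by omega⟩, ⟨1, by omega⟩), fun h => zero_ne_one (congrArg Fin.val h)⟩
    exact ⟨limitPosterior p₀ X, inferInstance, isLimitPosterior_limitPosterior Q η p₀,
      fun _ _ _ _ => limitPosterior_doesNotSmooth p₀ _⟩
  · rintro ⟨e, he, hinj⟩
    exact ⟨coordLink e he, fun π => doesNotSmooth_coordLink_iff he hinj⟩
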